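/- Let $\nu>0$ and $\beta>0$. Let $u_0\in L^2(\mathbb R^3;\mathbb R^3)$ be divergence free and let $f\in L^2(\mathbb R^3;\mathbb R^3)\cap\dot H^{-1}(\mathbb R^3;\mathbb R^3)$ be a divergence-free, time-independent force (divergences are taken in the sense of distributions). Then there exists $$u\in L^\infty_{loc}([0,+\infty[,L^2(\mathbb R^3))\cap L^2_{loc}([0,+\infty[,\dot H^1(\mathbb R^3))$$ which is a global weak solution of the damped Navier--Stokes equations $$\partial_t u=\nu\Delta u-(u\cdot\nabla)u-\nabla p+f-\beta u,\qquad \operatorname{div} u=0,\qquad u(0,\cdot)=u_0 ,$$ that is: $\operatorname{div}u(t,\cdot)=0$ for all $t\ge 0$; there is a pressure $p\in L^1_{loc}(]0,+\infty[\times\mathbb R^3)$ such that the first equation, with $(u\cdot\nabla)u=\sum_j\partial_j(u_ju)$, holds in the sense of distributions on $]0,+\infty[\times\mathbb R^3$; and $u$ is continuous from $[0,+\infty[$ to $L^2(\mathbb R^3)$ with the weak topology, with $u(0,\cdot)=u_0$. Moreover, $u$ satisfies, for all $t\ge 0$, the energy inequality $$\|u(t,\cdot)\|_{L^2}^2\le\|u_0\|_{L^2}^2-2\nu\int_0^t\|u(s,\cdot)\|_{\dot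 H^1}^2\,ds+2\int_0^t\langle f,u(s,\cdot)\rangle_{L^2}\,ds-2\beta\int_0^t\|u(s,\cdot)\|_{L^2}^2\,ds,$$ where $\|v\|_{\dot H^1}=\|\nabla v\|_{L^2}$. -/

import Mathlib

open MeasureTheory Set
open scoped ContDiff FourierTransform

noncomputable section

namespace DampedNS

/-- Three-dimensional Euclidean space. -/
abbrev E3 : Type := EuclideanSpace ℝ (Fin 3)

/-- The Hilbert space `L²(ℝ³; ℝ³)`. -/
abbrev L2 : Type := Lp E3 2 (volume : Measure E3)

/-- The `j`-th vector of the canonical basis of `ℝ³`. -/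
def basisVec (j : Fin 3) : E3 := EuclideanSpace.single j (1 : ℝ)

/-- Real test functions in `C_c^∞(ℝ³)`. -/
def IsTest (φ : E3 → ℝ) : Prop := ContDiff ℝ ∞ φ ∧ HasCompactSupport φ

/-- Real test functions in `C_c^∞((0,∞) × ℝ³)`. -/
def IsSpaceTimeTest (φ : ℝ × E3 → ℝ) : Prop :=
  ContDiff ℝ ∞ φ ∧ HasCompactSupport φ ∧ tsupport φ ⊆ Ioi (0 : ℝ) ×ˢ (univ : Set E3)

/-- The classical partial derivative `∂_j φ` on `ℝ³`. -/
def pd (j : Fin 3) (φ : E3 → ℝ) (x : E3) : ℝ := fderiv ℝ φ x (basisVec j)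

/-- The time derivative `∂_t φ` of a function on space-time. -/
def dt (φ : ℝ × E3 → ℝ) (z : ℝ × E3) : ℝ := fderiv ℝ φ z (1, 0)

/-- The spatial derivative `∂_j φ` of a function on space-time. -/
def dx (j : Fin 3) (φ : ℝ × E3 → ℝ) (z : ℝ × E3) : ℝ := fderiv ℝ φ z (0, basisVec j)

/-- The spatial Laplacian `Δφ = ∑_j ∂_j ∂_j φ` of a function on space-time. -/
def lap (φ : ℝ × E3 → ℝ) (z : ℝ × E3) : ℝ := ∑ j, dx j (dx j φ) z

/-- `div v = 0` in the sense of distributions on `ℝ³`. -/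
def IsDivFree (v : L2) : Prop :=
  ∀ φ : E3 → ℝ, IsTest φ → ∫ x, ∑ j, v x j * pd j φ x = 0

/-- The `i`-th component of `v`, as an element of the complex space `L²(ℝ³; ℂ)`. -/
def component (i : Fin 3) (v : L2) : Lp ℂ 2 (volume : Measure E3) :=
  (Complex.ofRealCLM ∘L (EuclideanSpace.proj i : E3 →L[ℝ] ℝ)).compLp v

/-- Membership of a field `v ∈ L²` in the homogeneous Sobolev space of order `-1`:
`|ξ|⁻¹ v̂(ξ)` is square integrable. -/
def MemHDotNegOne (v : L2) : Prop :=
  ∀ i, MemLp (fun ξ : E3 => ((‖ξ‖⁻¹ : ℝ) : ℂ) * (𝓕 (component i v)) ξ) 2 volume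

/-- `w ∈ L²` is the weak derivative `∂_j v` of `v ∈ L²`. -/
def IsWeakPartial (j : Fin 3) (v w : L2) : Prop :=
  ∀ φ : E3 → ℝ, IsTest φ → ∀ i, ∫ x, v x i * pd j φ x = - ∫ x, w x i * φ x

/-- Membership of a field `v ∈ L²` in the homogeneous Sobolev space of order `1`:
all its first weak derivatives are square integrable. -/
def MemHDotOne (v : L2) : Prop := ∀ j, ∃ w : L2, IsWeakPartial j v w

open Classical in
/-- The weak derivative `∂_j v ∈ L²` (it is unique when it exists; `0` otherwise). -/
def weakPartial (j : Fin 3) (v : L2) : L2 :=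
  if h : ∃ w : L2, IsWeakPartial j v w then h.choose else 0

/-- The square of the homogeneous norm of order `1`:
`‖∇v‖²_{L²} = ∑_j ‖∂_j v‖²_{L²} = ∑_{i,j} ‖∂_j v_i‖²_{L²}`. -/
def hDotOneSq (v : L2) : ℝ := ∑ j, ‖weakPartial j v‖ ^ 2

/-- `u ∈ L^∞_loc([0,∞), L²)`. -/
def MemLinftyLocL2 (u : ℝ → L2) : Prop :=
  ∀ T : ℝ, 0 < T → MemLp u ⊤ (volume.restrict (Icc 0 T))

/-- `u ∈ L²_loc([0,∞), Ḣ¹)`, for an `L²`-valued `u`. -/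
def MemL2LocHDotOne (u : ℝ → L2) : Prop :=
  ∀ T : ℝ, 0 < T → (∀ᵐ t ∂(volume.restrict (Icc 0 T)), MemHDotOne (u t)) ∧
    ∀ j, MemLp (fun t => weakPartial j (u t)) 2 (volume.restrict (Icc 0 T))

/-- The momentum equation
`∂_t u = ν Δu - (u·∇)u - ∇p + f - β u` in the sense of distributions on `(0,∞) × ℝ³`,
component by component. As `div u = 0`, the nonlinear term is `(u·∇)u_i = ∑_j ∂_j (u_i u_j)`. -/
def MomentumEq (ν β : ℝ) (f : L2) (u : ℝ → L2) (p : ℝ × E3 → ℝ) : Prop :=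
  ∀ φ : ℝ × E3 → ℝ, IsSpaceTimeTest φ → ∀ i : Fin 3,
    ∫ t in Ioi (0 : ℝ), ∫ x : E3,
      (u t x i * dt φ (t, x) + ν * (u t x i * lap φ (t, x))
        + ∑ j, u t x i * u t x j * dx j φ (t, x)
        + p (t, x) * dx i φ (t, x)
        + f x i * φ (t, x) - β * (u t x i * φ (t, x))) = 0

/-- `u` is a global weak solution of the damped Navier-Stokes equations with initial value `u₀`
and force `f`: it is divergence free, there is a locally integrable pressure with which the
momentum equation holds in the sense of distributions, and the initial value is attained by
`u`, which is continuous from `[0,∞)` to `L²` with its weak topology. -/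
structure IsWeakSolution (ν β : ℝ) (u₀ f : L2) (u : ℝ → L2) : Prop where
  divFree : ∀ t : ℝ, 0 ≤ t → IsDivFree (u t)
  momentum : ∃ p : ℝ × E3 → ℝ,
    LocallyIntegrableOn p (Ioi (0 : ℝ) ×ˢ (univ : Set E3)) ∧ MomentumEq ν β f u p
  weakCont : ∀ w : L2, ContinuousOn (fun t => inner ℝ (u t) w) (Ici (0 : ℝ))
  initial : u 0 = u₀

end DampedNS

end

open MeasureTheory Set
open scoped ContDiff FourierTransform

noncomputable section

namespace DampedNS

open Filter Topology

/-! ### Test fields and pairings in `L²(ℝ³; ℝ³)` -/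

/-! The solution is a weak limit of Galerkin approximations. Let `w` be a sequence of
divergence-free fields with square integrable gradient, dense in the graph norm of the gradient
(`exists_dense_seq_solenoidalOne`). On the span of the first `n` vectors the equation is an ordinary
differential equation with a quadratic right-hand side. The transport term vanishes when tested
against the solution itself (`sum_inner_prodF_self`), so the field is dissipative, the solution
exists on `[0, n]`, and it satisfies an exact energy balance (`exists_galerkin`). The damping
absorbs the force, since `2⟨f,v⟩ - 2β‖v‖² ≤ ‖f‖²/(2β)`. This bounds the approximations in `L²` and
their gradients in `L²` of time, uniformly in `n` on each bounded interval.

The Sobolev embedding interpolates to `‖v‖₄⁴ ≤ C ‖v‖ ‖∇v‖³`, which puts the products `v_j v` in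
`L²`. With Young's inequality it makes the pairings with each `w k` equicontinuous in time, and
`exists_weak_limit_curve` gives a subsequence converging weakly in `L²` at every time `t ≥ 0`. In
the quadratic term weak convergence is not enough. On a ball, `v` differs from its averages over
balls of radius `δ` by at most `δ` times its gradient in `L²`, and these averages converge strongly
because each one is a pairing with a fixed kernel. Letting `δ` tend to `0` gives
`IsLimit.integral_quadForm_tendsto`. The energy inequality comes from Fatou's lemma in time and weak
lower semicontinuity (`IsLimit.exists_energy`).

The limit equation holds against divergence-free fields (`IsLimit.weak_eq`). To reach all test
fields it is tested against projections `leray g`; the projection commutes with translations, hence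
with derivatives. The remainder `v_j v - leray (v_j v)` is orthogonal to the divergence-free fields,
hence curl-free in the weak sense: pairing it with `∂_jφ e_k` or with `∂_kφ e_j` gives the same
number. Summing over `j` produces a gradient in the direction `k`, with pressure `p = -∑_j (v_j v -
leray (v_j v))_j`. No singular integral is needed.

Density of test fields in the graph norm also rests on translations: averaging translates over a
cube turns a weak derivative into a difference quotient, which is bounded on `L²`. -/

/-- Smooth compactly supported vector fields on `ℝ³`. -/
def IsTestField (g : E3 → E3) : Prop := ContDiff ℝ ∞ g ∧ HasCompactSupport g

/-- The classical partial derivative of a vector field. -/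
def pdv (j : Fin 3) (g : E3 → E3) (x : E3) : E3 := fderiv ℝ g x (basisVec j)

/-- The gradient of a scalar function, as a vector field. -/
def gradField (φ : E3 → ℝ) (x : E3) : E3 := WithLp.toLp 2 fun j => pd j φ x

open Classical in
/-- The class in `L²` of a square integrable field (`0` for the other fields). -/
def toL2 (g : E3 → E3) : L2 := if h : MemLp g 2 volume then h.toLp g else 0

lemma toL2_of_memLp {g : E3 → E3} (h : MemLp g 2 volume) : toL2 g = h.toLp g := by
  simp [toL2, h]

lemma coeFn_toL2 {g : E3 → E3} (h : MemLp g 2 volume) : toL2 g =ᵐ[volume] g := by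
  rw [toL2_of_memLp h]; exact h.coeFn_toLp

lemma toL2_coeFn (v : L2) : toL2 v = v := by
  rw [toL2_of_memLp (Lp.memLp v), Lp.toLp_coeFn]

lemma toL2_congr {g h : E3 → E3} (e : g =ᵐ[volume] h) : toL2 g = toL2 h := by
  by_cases hg : MemLp g 2 volume
  · have hh := hg.ae_eq e
    rw [toL2_of_memLp hg, toL2_of_memLp hh]
    exact MemLp.toLp_congr hg hh e
  · have hh : ¬ MemLp h 2 volume := fun hh => hg (hh.ae_eq e.symm)
    simp [toL2, hg, hh]

lemma toL2_add {g h : E3 → E3} (hg : MemLp g 2 volume) (hh : MemLp h 2 volume) :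
    toL2 (fun x => g x + h x) = toL2 g + toL2 h := by
  rw [toL2_of_memLp hg, toL2_of_memLp hh, ← MemLp.toLp_add hg hh, ← toL2_of_memLp (hg.add hh)]
  rfl

lemma toL2_sub {g h : E3 → E3} (hg : MemLp g 2 volume) (hh : MemLp h 2 volume) :
    toL2 (fun x => g x - h x) = toL2 g - toL2 h := by
  rw [toL2_of_memLp hg, toL2_of_memLp hh, ← MemLp.toLp_sub hg hh, ← toL2_of_memLp (hg.sub hh)]
  rfl

lemma toL2_smul (c : ℝ) {g : E3 → E3} (hg : MemLp g 2 volume) :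
    toL2 (fun x => c • g x) = c • toL2 g := by
  rw [toL2_of_memLp hg, ← MemLp.toLp_const_smul c hg, ← toL2_of_memLp (hg.const_smul c)]
  rfl

lemma inner_eq_sum (a b : E3) : inner ℝ a b = ∑ i, a i * b i := by
  simp [PiLp.inner_apply, mul_comm]

@[simp] lemma basisVec_apply (i j : Fin 3) : basisVec i j = if j = i then 1 else 0 := by
  simp [basisVec]

lemma sum_smul_basisVec (a : E3) : ∑ i, a i • basisVec i = a := by
  ext k; simp

lemma abs_apply_le_norm (a : E3) (i : Fin 3) : |a i| ≤ ‖a‖ := by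
  simpa using PiLp.norm_apply_le a i

lemma inner_toL2 (v : L2) {g : E3 → E3} (h : MemLp g 2 volume) :
    inner ℝ v (toL2 g) = ∫ x, ∑ i, v x i * g x i := by
  rw [L2.inner_def]
  refine integral_congr_ae ?_
  filter_upwards [coeFn_toL2 h] with x hx
  rw [hx, inner_eq_sum]

lemma norm_sq_L2_eq (v : L2) : ‖v‖ ^ 2 = ∫ x, ‖v x‖ ^ 2 := by
  rw [← real_inner_self_eq_norm_sq, L2.inner_def]
  simp only [real_inner_self_eq_norm_sq]

lemma memLp_apply {g : E3 → E3} {p : ENNReal} (h : MemLp g p volume) (i : Fin 3) :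
    MemLp (fun x => g x i) p volume :=
  h.continuousLinearMap_comp (EuclideanSpace.proj i : E3 →L[ℝ] ℝ)

lemma memLp_coeFn_apply (v : L2) (i : Fin 3) : MemLp (fun x => v x i) 2 volume :=
  memLp_apply (Lp.memLp v) i

lemma IsTestField.memLp {g : E3 → E3} (h : IsTestField g) {p : ENNReal} : MemLp g p volume :=
  h.1.continuous.memLp_of_hasCompactSupport h.2

lemma IsTestField.differentiable {g : E3 → E3} (h : IsTestField g) : Differentiable ℝ g :=
  h.1.differentiable (by simp)

lemma IsTest.differentiable {φ : E3 → ℝ} (h : IsTest φ) : Differentiable ℝ φ :=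
  h.1.differentiable (by simp)

lemma IsTestField.pdv {g : E3 → E3} (h : IsTestField g) (j : Fin 3) :
    IsTestField (pdv j g) :=
  ⟨(h.1.fderiv_right (m := ∞) (by simp)).clm_apply contDiff_const,
    h.2.fderiv_apply (𝕜 := ℝ) (basisVec j)⟩

lemma IsTest.pd {φ : E3 → ℝ} (h : IsTest φ) (j : Fin 3) : IsTest (pd j φ) :=
  ⟨(h.1.fderiv_right (m := ∞) (by simp)).clm_apply contDiff_const,
    h.2.fderiv_apply (𝕜 := ℝ) (basisVec j)⟩

lemma IsTest.memLp {φ : E3 → ℝ} (h : IsTest φ) {p : ENNReal} : MemLp φ p volume :=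
  h.1.continuous.memLp_of_hasCompactSupport h.2

lemma IsTest.smul_basisVec {φ : E3 → ℝ} (h : IsTest φ) (i : Fin 3) :
    IsTestField (fun x => φ x • basisVec i) :=
  ⟨h.1.smul contDiff_const, h.2.smul_right⟩

lemma IsTestField.apply {g : E3 → E3} (h : IsTestField g) (i : Fin 3) :
    IsTest (fun x => g x i) :=
  ⟨(EuclideanSpace.proj i : E3 →L[ℝ] ℝ).contDiff.comp h.1,
    h.2.comp_left (g := fun a : E3 => a i) (by simp)⟩

lemma IsTest.gradField {φ : E3 → ℝ} (h : IsTest φ) : IsTestField (gradField φ) := by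
  constructor
  · exact (PiLp.contDiff_toLp (p := 2)).comp (contDiff_pi.2 fun j => (h.pd j).1)
  · have : DampedNS.gradField φ
        = (fun l : E3 →L[ℝ] ℝ => (WithLp.toLp 2 fun j => l (basisVec j) : E3)) ∘ fderiv ℝ φ := rfl
    rw [this]
    refine (h.2.fderiv (𝕜 := ℝ)).comp_left ?_
    ext; simp

lemma IsTestField.add {g h : E3 → E3} (hg : IsTestField g) (hh : IsTestField h) :
    IsTestField (fun x => g x + h x) := ⟨hg.1.add hh.1, hg.2.add hh.2⟩

lemma IsTestField.const_smul {g : E3 → E3} (hg : IsTestField g) (c : ℝ) :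
    IsTestField (fun x => c • g x) :=
  ⟨hg.1.const_smul c, hg.2.smul_left (f := fun _ => c)⟩

lemma pdv_apply {g : E3 → E3} (h : Differentiable ℝ g) (j i : Fin 3) (x : E3) :
    pdv j g x i = pd j (fun y => g y i) x := by
  have := ((EuclideanSpace.proj i : E3 →L[ℝ] ℝ).hasFDerivAt.comp x (h x).hasFDerivAt).fderiv
  have h2 : fderiv ℝ (fun y => g y i) x
      = (EuclideanSpace.proj i : E3 →L[ℝ] ℝ).comp (fderiv ℝ g x) := this
  simp [pdv, pd, h2]

lemma pdv_smul_basisVec {φ : E3 → ℝ} (h : Differentiable ℝ φ) (i j : Fin 3) :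
    pdv j (fun x => φ x • basisVec i) = fun x => pd j φ x • basisVec i := by
  ext1 x
  simp [pdv, pd, fderiv_smul_const (h x)]

lemma pdv_add {g h : E3 → E3} (hg : Differentiable ℝ g) (hh : Differentiable ℝ h) (j : Fin 3) :
    pdv j (fun x => g x + h x) = fun x => pdv j g x + pdv j h x := by
  ext1 x
  simp only [pdv]
  rw [fderiv_fun_add (hg x) (hh x)]; rfl

lemma pdv_const_smul {g : E3 → E3} (hg : Differentiable ℝ g) (c : ℝ) (j : Fin 3) :
    pdv j (fun x => c • g x) = fun x => c • pdv j g x := by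
  ext1 x
  simp only [pdv]
  rw [fderiv_fun_const_smul (hg x)]; rfl

lemma pd_comm {φ : E3 → ℝ} (h : ContDiff ℝ ∞ φ) (j k : Fin 3) (x : E3) :
    pd j (pd k φ) x = pd k (pd j φ) x := by
  have hs : IsSymmSndFDerivAt ℝ φ x := h.contDiffAt.isSymmSndFDerivAt (by
    simp only [minSmoothness_of_isRCLikeNormedField]; norm_cast)
  have hd : DifferentiableAt ℝ (fderiv ℝ φ) x :=
    (h.fderiv_right (m := 1) (by norm_cast)).differentiable (by simp) x
  have e : ∀ a b : Fin 3, pd a (pd b φ) x = fderiv ℝ (fderiv ℝ φ) x (basisVec a) (basisVec b) := by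
    intro a b
    have : pd b φ = fun y => fderiv ℝ φ y (basisVec b) := rfl
    rw [this]
    simp only [pd]
    rw [fderiv_clm_apply hd (differentiableAt_const _)]
    simp
  rw [e, e, hs]

lemma integral_mul_pd {φ ψ : E3 → ℝ} (hφ : IsTest φ) (hψ : IsTest ψ) (j : Fin 3) :
    ∫ x, φ x * pd j ψ x = - ∫ x, pd j φ x * ψ x := by
  have hi : ∀ {a b : E3 → ℝ}, IsTest a → IsTest b → Integrable (fun x => a x * b x) volume :=
    fun ha hb => (ha.1.continuous.mul hb.1.continuous).integrable_of_hasCompactSupport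
      (ha.2.mul_right)
  exact integral_mul_fderiv_eq_neg_fderiv_mul_of_integrable (v := basisVec j)
    (hi (hφ.pd j) hψ) (hi hφ (hψ.pd j)) (hi hφ hψ) (fun x _ => hφ.differentiable x)
    (fun x _ => hψ.differentiable x)

lemma integrable_mul_of_memLp_two {φ ψ : E3 → ℝ} (hφ : MemLp φ 2 volume) (hψ : MemLp ψ 2 volume) :
    Integrable (fun x => φ x * ψ x) volume := hφ.integrable_mul hψ

lemma inner_smul_basisVec (v : L2) {φ : E3 → ℝ} (h : MemLp φ 2 volume) (i : Fin 3) :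
    inner ℝ v (toL2 fun x => φ x • basisVec i) = ∫ x, v x i * φ x := by
  have hm : MemLp (fun x => φ x • basisVec i) 2 volume :=
    h.continuousLinearMap_comp ((ContinuousLinearMap.id ℝ ℝ).smulRight (basisVec i))
  rw [inner_toL2 v hm]
  simp

lemma inner_toL2_eq_sum (v : L2) {g : E3 → E3} (h : MemLp g 2 volume) :
    inner ℝ v (toL2 g) = ∑ i, ∫ x, v x i * g x i := by
  rw [inner_toL2 v h, integral_finsetSum]
  exact fun i _ => integrable_mul_of_memLp_two (memLp_coeFn_apply v i) (memLp_apply h i)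

/-! ### Density of test fields -/

lemma dense_testField : Dense {v : L2 | ∃ g, IsTestField g ∧ v = toL2 g} := by
  refine (Lp.dense_hasCompactSupport_contDiff (μ := (volume : Measure E3)) (F := E3)
    (p := 2) (by simp)).mono ?_
  rintro v ⟨g, hv, hc, hg⟩
  exact ⟨g, ⟨hg, hc⟩, by rw [← toL2_congr hv, toL2_coeFn]⟩

lemma exists_testField_near (v : L2) {ε : ℝ} (hε : 0 < ε) :
    ∃ g, IsTestField g ∧ ‖v - toL2 g‖ < ε := by
  obtain ⟨_, ⟨g, hg, rfl⟩, h⟩ := Metric.mem_closure_iff.1 (dense_testField v) ε hε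
  exact ⟨g, hg, by rwa [← dist_eq_norm]⟩

lemma exists_seq_testField (v : L2) :
    ∃ g : ℕ → E3 → E3, (∀ n, IsTestField (g n)) ∧ Tendsto (fun n => toL2 (g n)) atTop (𝓝 v) := by
  obtain ⟨x, hx, hl⟩ := mem_closure_iff_seq_limit.1 (dense_testField v)
  choose g hg hxg using hx
  exact ⟨g, hg, by simpa only [← hxg] using hl⟩

lemma eq_of_inner_testField {v w : L2}
    (h : ∀ g, IsTestField g → inner ℝ v (toL2 g) = inner ℝ w (toL2 g)) : v = w := by
  refine dense_testField.eq_of_inner_left (𝕜 := ℝ) ?_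
  rintro _ ⟨g, hg, rfl⟩
  exact h g hg

/-! ### Weak derivatives -/

/-- Both sides of the identity become `L²` pairings with vector test fields, so weak limits and
bounded operators can be applied directly. -/
lemma isWeakPartial_iff {j : Fin 3} {v w : L2} : IsWeakPartial j v w ↔
    ∀ g, IsTestField g → inner ℝ v (toL2 (pdv j g)) = - inner ℝ w (toL2 g) := by
  constructor
  · intro h g hg
    rw [inner_toL2_eq_sum v (hg.pdv j).memLp, inner_toL2_eq_sum w hg.memLp, ← Finset.sum_neg_distrib]
    refine Finset.sum_congr rfl fun i _ => ?_
    simp only [pdv_apply hg.differentiable]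
    exact h _ (hg.apply i) i
  · intro h φ hφ i
    have := h _ (hφ.smul_basisVec i)
    rwa [pdv_smul_basisVec hφ.differentiable, inner_smul_basisVec v (hφ.pd j).memLp,
      inner_smul_basisVec w hφ.memLp] at this

lemma IsWeakPartial.unique {j : Fin 3} {v w w' : L2} (h : IsWeakPartial j v w)
    (h' : IsWeakPartial j v w') : w = w' := by
  rw [isWeakPartial_iff] at h h'
  refine eq_of_inner_testField fun g hg => ?_
  have := (h g hg).symm.trans (h' g hg)
  linarith

lemma weakPartial_eq {j : Fin 3} {v w : L2} (h : IsWeakPartial j v w) : weakPartial j v = w := by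
  have hex : ∃ w : L2, IsWeakPartial j v w := ⟨w, h⟩
  rw [weakPartial, dif_pos hex]
  exact hex.choose_spec.unique h

lemma MemHDotOne.isWeakPartial {v : L2} (h : MemHDotOne v) (j : Fin 3) :
    IsWeakPartial j v (weakPartial j v) := by
  obtain ⟨w, hw⟩ := h j
  rwa [weakPartial_eq hw]

lemma IsWeakPartial.add {j : Fin 3} {v w v' w' : L2} (h : IsWeakPartial j v w)
    (h' : IsWeakPartial j v' w') : IsWeakPartial j (v + v') (w + w') := by
  rw [isWeakPartial_iff] at *
  intro g hg
  rw [inner_add_left, inner_add_left, h g hg, h' g hg]; ring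

lemma IsWeakPartial.smul {j : Fin 3} {v w : L2} (h : IsWeakPartial j v w) (c : ℝ) :
    IsWeakPartial j (c • v) (c • w) := by
  rw [isWeakPartial_iff] at *
  intro g hg
  rw [real_inner_smul_left, real_inner_smul_left, h g hg]; ring

lemma isWeakPartial_zero (j : Fin 3) : IsWeakPartial j 0 0 := by
  rw [isWeakPartial_iff]; simp

lemma IsTestField.isWeakPartial {g : E3 → E3} (hg : IsTestField g) (j : Fin 3) :
    IsWeakPartial j (toL2 g) (toL2 (DampedNS.pdv j g)) := by
  intro φ hφ i
  have e1 : ∫ x, toL2 g x i * pd j φ x = ∫ x, g x i * pd j φ x := by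
    refine integral_congr_ae ?_
    filter_upwards [coeFn_toL2 hg.memLp] with x hx
    rw [hx]
  have e2 : ∫ x, toL2 (DampedNS.pdv j g) x i * φ x = ∫ x, pd j (fun y => g y i) x * φ x := by
    refine integral_congr_ae ?_
    filter_upwards [coeFn_toL2 (hg.pdv j).memLp] with x hx
    rw [hx, pdv_apply hg.differentiable]
  rw [e1, e2]
  exact integral_mul_pd (hg.apply i) hφ j

lemma IsTestField.memHDotOne {g : E3 → E3} (hg : IsTestField g) : MemHDotOne (toL2 g) :=
  fun j => ⟨_, hg.isWeakPartial j⟩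

/-- Weak derivatives pass to weak limits along any filter. -/
lemma IsWeakPartial.of_tendsto {ι : Type*} {l : Filter ι} [l.NeBot] {j : Fin 3} {x y : ι → L2}
    {v w : L2} (h : ∀ᶠ n in l, IsWeakPartial j (x n) (y n))
    (hx : ∀ a, Tendsto (fun n => inner ℝ (x n) a) l (𝓝 (inner ℝ v a)))
    (hy : ∀ a, Tendsto (fun n => inner ℝ (y n) a) l (𝓝 (inner ℝ w a))) :
    IsWeakPartial j v w := by
  rw [isWeakPartial_iff]
  intro g hg
  refine tendsto_nhds_unique (hx _) ((hy _).neg.congr' ?_)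
  filter_upwards [h] with n hn
  exact (isWeakPartial_iff.1 hn g hg).symm

/-! ### Divergence-free fields -/

/-- The closed subspace of divergence-free fields. -/
def solenoidal : Submodule ℝ L2 :=
  (Submodule.span ℝ {v | ∃ φ, IsTest φ ∧ v = toL2 (gradField φ)})ᗮ

lemma isDivFree_iff {v : L2} :
    IsDivFree v ↔ ∀ φ, IsTest φ → inner ℝ v (toL2 (gradField φ)) = 0 := by
  refine forall₂_congr fun φ hφ => ?_
  rw [inner_toL2 v hφ.gradField.memLp]
  rfl

lemma mem_solenoidal {v : L2} : v ∈ solenoidal ↔ IsDivFree v := by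
  rw [isDivFree_iff, solenoidal, Submodule.mem_orthogonal']
  constructor
  · exact fun h φ hφ => h _ (Submodule.subset_span ⟨φ, hφ, rfl⟩)
  · intro h u hu
    induction hu using Submodule.span_induction with
    | mem x hx => obtain ⟨φ, hφ, rfl⟩ := hx; exact h φ hφ
    | zero => simp
    | add x y _ _ hx hy => rw [inner_add_right, hx, hy, add_zero]
    | smul c x _ hx => rw [inner_smul_right, hx, mul_zero]

instance : CompleteSpace solenoidal := by
  unfold solenoidal; infer_instance

/-- The orthogonal projection onto divergence-free fields, as an operator on `L²`. -/
def leray : L2 →L[ℝ] L2 := solenoidal.starProjection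

lemma leray_mem (v : L2) : leray v ∈ solenoidal := Submodule.starProjection_apply_mem _ v

lemma leray_eq_self {v : L2} (h : v ∈ solenoidal) : leray v = v :=
  Submodule.starProjection_eq_self_iff.2 h

lemma inner_leray_left (v w : L2) : inner ℝ (leray v) w = inner ℝ v (leray w) :=
  Submodule.inner_starProjection_left_eq_right _ v w

lemma inner_leray_of_mem {v : L2} (h : v ∈ solenoidal) (w : L2) :
    inner ℝ v (leray w) = inner ℝ v w := by
  rw [← inner_leray_left, leray_eq_self h]

lemma norm_leray_le (v : L2) : ‖leray v‖ ≤ ‖v‖ :=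
  Submodule.norm_starProjection_apply_le _ v

/-- Divergence-free fields with square integrable weak derivatives. -/
def solenoidalOne : Submodule ℝ L2 where
  carrier := {v | v ∈ solenoidal ∧ MemHDotOne v}
  add_mem' := fun ha hb => ⟨solenoidal.add_mem ha.1 hb.1,
    fun j => ⟨_, (ha.2.isWeakPartial j).add (hb.2.isWeakPartial j)⟩⟩
  zero_mem' := ⟨solenoidal.zero_mem, fun j => ⟨_, isWeakPartial_zero j⟩⟩
  smul_mem' := fun c _ ha => ⟨solenoidal.smul_mem c ha.1,
    fun j => ⟨_, (ha.2.isWeakPartial j).smul c⟩⟩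

lemma solenoidalOne_one (v : solenoidalOne) : MemHDotOne (v : L2) := v.2.2

/-- The weak derivative as a linear map. -/
def wpd (j : Fin 3) : solenoidalOne →ₗ[ℝ] L2 where
  toFun v := weakPartial j v
  map_add' v w := weakPartial_eq
    (((solenoidalOne_one v).isWeakPartial j).add ((solenoidalOne_one w).isWeakPartial j))
  map_smul' c v := weakPartial_eq (((solenoidalOne_one v).isWeakPartial j).smul c)

lemma wpd_apply (j : Fin 3) (v : solenoidalOne) : wpd j v = weakPartial j (v : L2) := rfl

/-- Derivatives commute on test functions, so `∂_j` of a gradient field is again the gradient of a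
test function. -/
lemma weakPartial_mem_solenoidal {v : L2} (hv : v ∈ solenoidal) (h : MemHDotOne v) (j : Fin 3) :
    weakPartial j v ∈ solenoidal := by
  rw [mem_solenoidal, isDivFree_iff] at *
  intro φ hφ
  have h1 := isWeakPartial_iff.1 (h.isWeakPartial j) _ hφ.gradField
  have h2 : pdv j (gradField φ) = gradField (pd j φ) := by
    ext1 x
    ext i
    rw [pdv_apply hφ.gradField.differentiable]
    exact pd_comm hφ.1 j i x
  rw [h2, hv _ (hφ.pd j)] at h1
  linarith

/-! ### Smooth families of compactly supported fields -/

lemma norm_toL2_le {g : E3 → E3} {K : Set E3} (hK : IsCompact K) (h0 : ∀ x ∉ K, g x = 0)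
    {c : ℝ} (hc : ∀ x ∈ K, ‖g x‖ ≤ c) (hm : MemLp g 2 volume) :
    ‖toL2 g‖ ≤ √(volume.real K) * c := by
  rcases K.eq_empty_or_nonempty with rfl | ⟨x₀, hx₀⟩
  · have : g = fun _ => 0 := by ext1 x; exact h0 x (by simp)
    have : toL2 g = 0 := by
      rw [toL2_of_memLp hm]; subst this; exact MemLp.toLp_zero _
    simp [this]
  have hc0 : 0 ≤ c := (norm_nonneg _).trans (hc x₀ hx₀)
  refine le_of_sq_le_sq ?_ (by positivity)
  rw [mul_pow, Real.sq_sqrt measureReal_nonneg, norm_sq_L2_eq]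
  have hfin : volume K ≠ ⊤ := hK.measure_lt_top.ne
  calc ∫ x, ‖toL2 g x‖ ^ 2 = ∫ x, ‖g x‖ ^ 2 := by
        refine integral_congr_ae ?_
        filter_upwards [coeFn_toL2 hm] with x hx
        rw [hx]
    _ ≤ ∫ x, K.indicator (fun _ => c ^ 2) x := by
        refine integral_mono (hm.integrable_norm_pow (by simp)) ?_ fun x => ?_
        · exact (integrable_indicator_iff hK.measurableSet).2 (integrableOn_const hfin)
        · by_cases hx : x ∈ K
          · simp only [indicator_of_mem hx]
            exact pow_le_pow_left₀ (norm_nonneg _) (hc x hx) 2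
          · simp [hx, h0 x hx]
    _ = volume.real K * c ^ 2 := by
        rw [integral_indicator hK.measurableSet, setIntegral_const, smul_eq_mul]

lemma memLp_of_continuous_of_compact {g : E3 → E3} (hg : Continuous g) {K : Set E3}
    (hK : IsCompact K) (h0 : ∀ x ∉ K, g x = 0) {p : ENNReal} : MemLp g p volume :=
  hg.memLp_of_hasCompactSupport (HasCompactSupport.intro hK h0)

/-- Near `t₀` all the fields live on one compact set of finite measure, where uniform smallness of
the remainder implies smallness in `L²`. -/
lemma hasDerivAt_toL2 {Φ Ψ : ℝ → E3 → E3} (hΦ : ∀ t, Continuous (Φ t))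
    (hΨ : Continuous (Function.uncurry Ψ))
    (hd : ∀ t x, HasDerivAt (fun s => Φ s x) (Ψ t x) t) {t₀ : ℝ} {K : Set E3} (hK : IsCompact K)
    (h0 : ∀ᶠ t in 𝓝 t₀, ∀ x ∉ K, Φ t x = 0) :
    HasDerivAt (fun t => toL2 (Φ t)) (toL2 (Ψ t₀)) t₀ := by
  have hm : ∀ t, (∀ x ∉ K, Φ t x = 0) → MemLp (Φ t) 2 volume := fun t ht =>
    memLp_of_continuous_of_compact (hΦ t) hK ht
  have h0d : ∀ x ∉ K, Ψ t₀ x = 0 := by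
    intro x hx
    refine (hd t₀ x).unique ((hasDerivAt_const t₀ (0 : E3)).congr_of_eventuallyEq ?_)
    filter_upwards [h0] with t ht using ht x hx
  have hmd : MemLp (Ψ t₀) 2 volume :=
    memLp_of_continuous_of_compact (hΨ.comp (by fun_prop : Continuous fun x => (t₀, x))) hK h0d
  rw [hasDerivAt_iff_isLittleO, Asymptotics.isLittleO_iff]
  intro ε hε
  obtain ⟨c, hc, hcε⟩ : ∃ c > 0, √(volume.real K) * c ≤ ε := by
    refine ⟨ε / (√(volume.real K) + 1), by positivity, ?_⟩
    rw [mul_div_assoc', div_le_iff₀ (by positivity)]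
    nlinarith [Real.sqrt_nonneg (volume.real K)]
  -- By compactness of `K`, the fields `Ψ t` are uniformly `c`-close to `Ψ t₀` on `K` for `t` near
  -- `t₀`.
  obtain ⟨s, hs, hs'⟩ := hK.mem_uniformity_of_prod (s := univ) (q := t₀) (f := Ψ)
    hΨ.continuousOn (mem_univ _) (Metric.dist_mem_uniformity hc)
  rw [nhdsWithin_univ] at hs
  obtain ⟨r, hr, hrs⟩ := Metric.mem_nhds_iff.1 hs
  have h0' := h0.self_of_nhds
  filter_upwards [h0, Metric.ball_mem_nhds t₀ hr] with t ht htr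
  have hms : MemLp (fun x => Φ t x - Φ t₀ x) 2 volume := (hm t ht).sub (hm _ h0')
  have hmc : MemLp (fun x => (t - t₀) • Ψ t₀ x) 2 volume := hmd.const_smul (t - t₀)
  have hmr : MemLp (fun x => Φ t x - Φ t₀ x - (t - t₀) • Ψ t₀ x) 2 volume := hms.sub hmc
  have e : toL2 (Φ t) - toL2 (Φ t₀) - (t - t₀) • toL2 (Ψ t₀)
      = toL2 (fun x => Φ t x - Φ t₀ x - (t - t₀) • Ψ t₀ x) := by
    rw [toL2_sub hms hmc,
      toL2_sub (hm t ht) (hm _ h0'), toL2_smul _ hmd]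
  rw [e]
  refine (norm_toL2_le hK (fun x hx => by rw [ht x hx, h0' x hx, h0d x hx]; simp)
    (c := c * ‖t - t₀‖) (fun x hx => ?_)
    hmr).trans ?_
  -- Mean value inequality for `s ↦ Φ s x - s • Ψ t₀ x`, whose derivative has norm at most `c` on
  -- the ball.
  · have hf : ∀ s ∈ Metric.ball t₀ r, HasDerivWithinAt (fun s => Φ s x - s • Ψ t₀ x)
        (Ψ s x - (1 : ℝ) • Ψ t₀ x) (Metric.ball t₀ r) s := fun s _ =>
      ((hd s x).sub ((hasDerivAt_id s).smul_const (Ψ t₀ x))).hasDerivWithinAt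
    have := (convex_ball t₀ r).norm_image_sub_le_of_norm_hasDerivWithin_le hf (C := c)
      (fun s hs'' => by
        have := hs' s (hrs hs'') x hx
        rw [one_smul, ← dist_eq_norm]; exact le_of_lt this)
      (Metric.mem_ball_self hr) htr
    have e2 : Φ t x - Φ t₀ x - (t - t₀) • Ψ t₀ x
        = Φ t x - t • Ψ t₀ x - (Φ t₀ x - t₀ • Ψ t₀ x) := by rw [sub_smul]; abel
    rw [e2]
    exact this
  · rw [← mul_assoc]
    gcongr

/-! ### Translations -/

/-- Translation of a field by a vector. -/
def trans (y : E3) : L2 →ₗᵢ[ℝ] L2 :=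
  Lp.compMeasurePreservingₗᵢ ℝ (fun x => x + y) (measurePreserving_add_right volume y)

lemma coeFn_trans (y : E3) (v : L2) : trans y v =ᵐ[volume] fun x => v (x + y) :=
  Lp.coeFn_compMeasurePreserving v (measurePreserving_add_right volume y)

lemma trans_toL2 (y : E3) {g : E3 → E3} (hg : MemLp g 2 volume) :
    trans y (toL2 g) = toL2 (fun x => g (x + y)) := by
  have hm := hg.comp_measurePreserving (measurePreserving_add_right volume y)
  rw [toL2_of_memLp hg]
  exact (toL2_of_memLp hm).symm

lemma trans_add (y z : E3) (v : L2) : trans (y + z) v = trans y (trans z v) := by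
  refine Lp.ext ?_
  have h1 := (measurePreserving_add_right (volume : Measure E3) y).quasiMeasurePreserving.ae
    (coeFn_trans z v)
  filter_upwards [coeFn_trans (y + z) v, coeFn_trans y (trans z v), h1] with x h1 h2 h3
  rw [h1, h2, h3, add_assoc]

lemma trans_zero (v : L2) : trans 0 v = v := by
  refine Lp.ext ?_
  filter_upwards [coeFn_trans 0 v] with x hx
  rw [hx, add_zero]

lemma inner_trans (y : E3) (v w : L2) :
    inner ℝ (trans y v) w = inner ℝ v (trans (-y) w) := by
  rw [← (trans y).inner_map_map v, ← trans_add, add_neg_cancel, trans_zero]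

lemma continuous_trans (v : L2) : Continuous fun y => trans y v := by
  let G : C(E3, C(E3, E3)) := (ContinuousMap.mk (fun a : E3 × E3 => a.2 + a.1)).curry
  exact (continuous_const (y := v)).compMeasurePreservingLp (g := fun y => G y) G.continuous
    (fun y => measurePreserving_add_right volume y) (by simp)

lemma continuous_trans_line (j : Fin 3) (v : L2) :
    Continuous fun s : ℝ => trans (s • basisVec j) v :=
  (continuous_trans v).comp (by fun_prop)

lemma IsTestField.comp_add {g : E3 → E3} (hg : IsTestField g) (y : E3) :
    IsTestField (fun x => g (x + y)) :=
  ⟨hg.1.comp (contDiff_id.add contDiff_const), hg.2.comp_homeomorph (Homeomorph.addRight y)⟩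

lemma IsTest.comp_add {φ : E3 → ℝ} (hφ : IsTest φ) (y : E3) :
    IsTest (fun x => φ (x + y)) :=
  ⟨hφ.1.comp (contDiff_id.add contDiff_const), hφ.2.comp_homeomorph (Homeomorph.addRight y)⟩

lemma pdv_comp_add (g : E3 → E3) (y : E3) (j : Fin 3) :
    pdv j (fun x => g (x + y)) = fun x => pdv j g (x + y) := by
  ext1 x
  simp only [pdv]
  rw [fderiv_comp_add_right]

lemma gradField_comp_add (φ : E3 → ℝ) (y : E3) :
    gradField (fun x => φ (x + y)) = fun x => gradField φ (x + y) := by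
  ext1 x
  simp only [gradField, pd]
  rw [fderiv_comp_add_right]

lemma hasDerivAt_trans_testField {g : E3 → E3} (hg : IsTestField g) (j : Fin 3) (t : ℝ) :
    HasDerivAt (fun s : ℝ => trans (s • basisVec j) (toL2 g))
      (trans (t • basisVec j) (toL2 (pdv j g))) t := by
  simp only [trans_toL2 _ hg.memLp, trans_toL2 _ (hg.pdv j).memLp]
  -- This compact set contains the supports of all translates with parameter within distance `1` of
  -- `t`.
  let K : Set E3 := (fun p : ℝ × E3 => p.2 - p.1 • basisVec j) ''
    (Metric.closedBall t 1 ×ˢ tsupport g)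
  have hK : IsCompact K := ((isCompact_closedBall t 1).prod hg.2).image (by fun_prop)
  refine hasDerivAt_toL2 (Φ := fun s x => g (x + s • basisVec j))
    (Ψ := fun s x => pdv j g (x + s • basisVec j)) (K := K) (t₀ := t) ?_ ?_ ?_ hK ?_
  · exact fun t => hg.1.continuous.comp (by fun_prop)
  · exact (hg.pdv j).1.continuous.comp (by fun_prop)
  · intro t x
    have h1 : HasDerivAt (fun s : ℝ => x + s • basisVec j) (basisVec j) t := by
      simpa using ((hasDerivAt_id t).smul_const (basisVec j)).const_add x
    exact (hg.differentiable _).hasFDerivAt.comp_hasDerivAt t h1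
  · filter_upwards [Metric.closedBall_mem_nhds t one_pos] with s hs x hx
    by_contra hne
    exact hx ⟨(s, x + s • basisVec j), ⟨hs, subset_tsupport _ hne⟩, by simp⟩

lemma inner_intervalIntegral (F : ℝ → L2) (hF : Continuous F) (a b : ℝ) (w : L2) :
    inner ℝ (∫ s in a..b, F s) w = ∫ s in a..b, inner ℝ (F s) w := by
  have := ((innerSL ℝ) w).intervalIntegral_comp_comm (hF.intervalIntegrable (μ := volume) a b)
  simp only [innerSL_apply_apply] at this
  rw [real_inner_comm, ← this]
  simp only [real_inner_comm]

/-- The fundamental theorem of calculus for a weak derivative. -/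
lemma IsWeakPartial.trans_sub {j : Fin 3} {v w : L2} (h : IsWeakPartial j v w) (r : ℝ) :
    trans (r • basisVec j) v - v = ∫ s in (0 : ℝ)..r, trans (s • basisVec j) w := by
  refine eq_of_inner_testField fun g hg => ?_
  rw [inner_intervalIntegral _ (continuous_trans_line j w)]
  -- The field `v` itself need not be differentiable along translations in a usable way; the
  -- translation is moved to the test field, with the opposite sign, and differentiated there.
  have hd : ∀ s : ℝ, HasDerivAt (fun s : ℝ => inner ℝ (trans (s • basisVec j) v) (toL2 g))
      (inner ℝ (trans (s • basisVec j) w) (toL2 g)) s := by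
    intro s
    have h1 := (hasDerivAt_trans_testField hg j (-s)).scomp s (hasDerivAt_neg s)
    have h2 := (hasDerivAt_const s v).inner ℝ h1
    convert! h2 using 1
    · ext s
      rw [inner_trans]
      simp
    · rw [inner_trans, ← neg_smul, trans_toL2 _ hg.memLp]
      have := isWeakPartial_iff.1 h _ (hg.comp_add (-s • basisVec j))
      rw [pdv_comp_add, ← trans_toL2 _ (hg.pdv j).memLp] at this
      rw [inner_smul_right, this]
      simp
  rw [intervalIntegral.integral_eq_sub_of_hasDerivAt (fun s _ => hd s)
    (((continuous_trans_line j w).inner continuous_const).intervalIntegrable _ _)]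
  simp [inner_sub_left, trans_zero]

lemma IsWeakPartial.norm_trans_sub_le {j : Fin 3} {v w : L2} (h : IsWeakPartial j v w) (r : ℝ) :
    ‖trans (r • basisVec j) v - v‖ ≤ |r| * ‖w‖ := by
  rw [h.trans_sub r]
  have := intervalIntegral.norm_integral_le_of_norm_le_const (a := 0) (b := r) (C := ‖w‖)
    (f := fun s => trans (s • basisVec j) w) (fun s _ => by simp)
  simpa [mul_comm] using this

/-- The translation is split into three moves along the axes. Since each is an isometry, the
displacements simply add up. -/
lemma norm_trans_sub_le {v : L2} (h : MemHDotOne v) (y : E3) :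
    ‖trans y v - v‖ ≤ ‖y‖ * ∑ j, ‖weakPartial j v‖ := by
  have hy : y = y 0 • basisVec 0 + (y 1 • basisVec 1 + y 2 • basisVec 2) := by
    conv_lhs => rw [← sum_smul_basisVec y, Fin.sum_univ_three, add_assoc]
  have key : ∀ j, ‖trans (y j • basisVec j) v - v‖ ≤ ‖y‖ * ‖weakPartial j v‖ := fun j =>
    ((h.isWeakPartial j).norm_trans_sub_le (y j)).trans (by gcongr; exact abs_apply_le_norm y j)
  have tri : ∀ (a : E3) (w : L2), ‖trans a w - v‖ ≤ ‖w - v‖ + ‖trans a v - v‖ := by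
    intro a w
    have : trans a w - v = trans a (w - v) + (trans a v - v) := by rw [map_sub]; abel
    rw [this]
    refine (norm_add_le _ _).trans ?_
    rw [LinearIsometry.norm_map]
  rw [hy, trans_add, trans_add, ← hy, Fin.sum_univ_three]
  have h1 := tri (y 0 • basisVec 0) (trans (y 1 • basisVec 1) (trans (y 2 • basisVec 2) v))
  have h2 := tri (y 1 • basisVec 1) (trans (y 2 • basisVec 2) v)
  linarith [key 0, key 1, key 2]

/-! ### Averages of translates and density of test fields in the graph norm -/

/-- The average of the translates of `v` along a segment of direction `e_j`. -/
def avg (j : Fin 3) (r : ℝ) : L2 →L[ℝ] L2 :=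
  LinearMap.mkContinuous
    { toFun := fun v => r⁻¹ • ∫ s in (0 : ℝ)..r, trans (s • basisVec j) v
      map_add' := fun v w => by
        simp only [map_add]
        rw [intervalIntegral.integral_add ((continuous_trans_line j v).intervalIntegrable _ _)
          ((continuous_trans_line j w).intervalIntegrable _ _), smul_add]
      map_smul' := fun c v => by
        simp only [map_smul, intervalIntegral.integral_smul, RingHom.id_apply]
        rw [smul_comm] } 1 fun v => by
    have := intervalIntegral.norm_integral_le_of_norm_le_const (a := 0) (b := r) (C := ‖v‖)
      (f := fun s => trans (s • basisVec j) v) (fun s _ => by simp)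
    simp only [LinearMap.coe_mk, AddHom.coe_mk, norm_smul, norm_inv, one_mul, Real.norm_eq_abs]
    rcases eq_or_ne r 0 with rfl | hr
    · simp
    · rw [sub_zero] at this
      calc |r|⁻¹ * _ ≤ |r|⁻¹ * (‖v‖ * |r|) := by gcongr
        _ = ‖v‖ := by field_simp

lemma avg_apply (j : Fin 3) (r : ℝ) (v : L2) :
    avg j r v = r⁻¹ • ∫ s in (0 : ℝ)..r, trans (s • basisVec j) v := rfl

lemma norm_avg_le (j : Fin 3) (r : ℝ) (v : L2) : ‖avg j r v‖ ≤ ‖v‖ := by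
  have := (avg j r).le_of_opNorm_le (LinearMap.mkContinuous_norm_le _ zero_le_one _) v
  simpa using this

lemma avg_trans (j : Fin 3) (r : ℝ) (y : E3) (v : L2) :
    avg j r (trans y v) = trans y (avg j r v) := by
  rw [avg_apply, avg_apply, map_smul]
  have := (trans y).toContinuousLinearMap.intervalIntegral_comp_comm
    ((continuous_trans_line j v).intervalIntegrable (μ := volume) 0 r)
  simp only [LinearIsometry.coe_toContinuousLinearMap] at this
  rw [← this]
  simp only [← trans_add, add_comm]

lemma avg_comm (j k : Fin 3) (r : ℝ) (v : L2) :
    avg j r (avg k r v) = avg k r (avg j r v) := by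
  rw [avg_apply k r v, map_smul]
  have := (avg j r).intervalIntegral_comp_comm
    ((continuous_trans_line k v).intervalIntegrable (μ := volume) 0 r)
  rw [← this, avg_apply k r]
  simp only [avg_trans]

lemma IsWeakPartial.avg_eq {j : Fin 3} {v w : L2} (h : IsWeakPartial j v w) (r : ℝ) :
    avg j r w = r⁻¹ • (trans (r • basisVec j) v - v) := by
  rw [avg_apply, h.trans_sub]

/-- The average is the slope at `0` of the primitive of `s ↦ trans (s • basisVec j) v`, a continuous
curve with value `v` at `0`. -/
lemma tendsto_avg (j : Fin 3) (v : L2) :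
    Tendsto (fun r => avg j r v) (𝓝[≠] 0) (𝓝 v) := by
  have := ((continuous_trans_line j v).integral_hasStrictDerivAt 0 0).hasDerivAt
  rw [hasDerivAt_iff_tendsto_slope] at this
  simp only [zero_smul, trans_zero] at this
  refine this.congr fun r => ?_
  simp [slope, avg_apply]

/-- The average of translates over a cube. -/
def cubeAvg (r : ℝ) : L2 →L[ℝ] L2 := avg 0 r ∘L avg 1 r ∘L avg 2 r

lemma tendsto_cubeAvg (v : L2) : Tendsto (fun r => cubeAvg r v) (𝓝[≠] 0) (𝓝 v) := by
  have key : ∀ (j : Fin 3) (w : ℝ → L2), Tendsto w (𝓝[≠] 0) (𝓝 v) →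
      Tendsto (fun r => avg j r (w r)) (𝓝[≠] 0) (𝓝 v) := by
    intro j w hw
    rw [tendsto_iff_norm_sub_tendsto_zero] at hw ⊢
    have h2 := tendsto_iff_norm_sub_tendsto_zero.1 (tendsto_avg j v)
    refine squeeze_zero (fun _ => norm_nonneg _) (fun r => ?_) (by simpa using hw.add h2)
    have : avg j r (w r) - v = avg j r (w r - v) + (avg j r v - v) := by rw [map_sub]; abel
    rw [this]
    exact (norm_add_le _ _).trans (by gcongr; exact norm_avg_le _ _ _)
  exact key 0 _ (key 1 _ (tendsto_avg 2 v))

/-- Averaging in the direction `j` turns `∂_j v` into the difference quotient of `v`, a bounded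
function of `v` for fixed `r`. The two other averages commute with it and remain. -/
lemma exists_cubeAvg_partial (j : Fin 3) (r : ℝ) : ∃ T : L2 →L[ℝ] L2,
    ∀ v w, IsWeakPartial j v w → cubeAvg r w = T v := by
  fin_cases j
  · refine ⟨avg 1 r ∘L avg 2 r ∘L (r⁻¹ • ((trans (r • basisVec 0)).toContinuousLinearMap -
      ContinuousLinearMap.id ℝ L2)), fun v w h => ?_⟩
    have := h.avg_eq r
    simp only [Fin.zero_eta] at this
    simp [cubeAvg, avg_comm 0, this]
  · refine ⟨avg 0 r ∘L avg 2 r ∘L (r⁻¹ • ((trans (r • basisVec 1)).toContinuousLinearMap -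
      ContinuousLinearMap.id ℝ L2)), fun v w h => ?_⟩
    have := h.avg_eq r
    simp only [Fin.mk_one] at this
    simp [cubeAvg, avg_comm 1, this]
  · refine ⟨avg 0 r ∘L avg 1 r ∘L (r⁻¹ • ((trans (r • basisVec 2)).toContinuousLinearMap -
      ContinuousLinearMap.id ℝ L2)), fun v w h => ?_⟩
    have := h.avg_eq r
    simp only [Fin.reduceFinMk] at this
    simp [cubeAvg, this]

/-- The graphs of the gradient on test fields. -/
def testGraph : Submodule ℝ (L2 × (Fin 3 → L2)) where
  carrier := {z | ∃ g, IsTestField g ∧ z = (toL2 g, fun j => toL2 (pdv j g))}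
  add_mem' := by
    rintro _ _ ⟨g, hg, rfl⟩ ⟨h, hh, rfl⟩
    refine ⟨_, hg.add hh, ?_⟩
    simp only [pdv_add hg.differentiable hh.differentiable, toL2_add hg.memLp hh.memLp,
      toL2_add (hg.pdv _).memLp (hh.pdv _).memLp]
    rfl
  zero_mem' := by
    refine ⟨fun _ => 0, ⟨contDiff_const, HasCompactSupport.zero⟩, ?_⟩
    have h0 : toL2 (fun _ => 0) = 0 := by
      rw [toL2_of_memLp (g := fun _ => (0 : E3)) (MemLp.zero' (μ := volume) (p := 2))]; exact MemLp.toLp_zero _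
    have h1 : ∀ j, pdv j (fun _ => 0) = fun _ => 0 := fun j => by ext1 x; simp [pdv]
    simp only [h1, h0]; rfl
  smul_mem' := by
    rintro c _ ⟨g, hg, rfl⟩
    refine ⟨_, hg.const_smul c, ?_⟩
    simp only [pdv_const_smul hg.differentiable, toL2_smul _ hg.memLp,
      toL2_smul _ (hg.pdv _).memLp]
    rfl

/-- An operator on `L²` acting on each entry of a graph. -/
def entrywise (T : L2 →L[ℝ] L2) : (L2 × (Fin 3 → L2)) →L[ℝ] (L2 × (Fin 3 → L2)) :=
  (T ∘L ContinuousLinearMap.fst ℝ _ _).prod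
    (ContinuousLinearMap.pi fun j =>
      T ∘L (ContinuousLinearMap.proj j) ∘L ContinuousLinearMap.snd ℝ _ _)

lemma entrywise_apply (T : L2 →L[ℝ] L2) (a : L2) (b : Fin 3 → L2) :
    entrywise T (a, b) = (T a, fun j => T (b j)) := rfl

/-- Translates of a test graph are test graphs, and a closed subspace is closed under averaging
along a continuous curve. By continuity it is enough to treat test graphs. -/
lemma entrywise_avg_mem (j : Fin 3) (r : ℝ) {z : L2 × (Fin 3 → L2)}
    (hz : z ∈ testGraph.topologicalClosure) :
    entrywise (avg j r) z ∈ testGraph.topologicalClosure := by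
  have hcl : IsClosed {z | entrywise (avg j r) z ∈ testGraph.topologicalClosure} :=
    testGraph.isClosed_topologicalClosure.preimage (entrywise (avg j r)).continuous
  refine closure_minimal ?_ hcl hz
  rintro _ ⟨g, hg, rfl⟩
  let F : ℝ → L2 × (Fin 3 → L2) := fun s =>
    (trans (s • basisVec j) (toL2 g), fun k => trans (s • basisVec j) (toL2 (pdv k g)))
  have hF : Continuous F := (continuous_trans_line j _).prodMk
    (continuous_pi fun k => continuous_trans_line j _)
  have hmem : ∀ s, F s ∈ testGraph.topologicalClosure := by
    intro s
    refine testGraph.le_topologicalClosure ⟨_, hg.comp_add (s • basisVec j), ?_⟩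
    simp only [F, pdv_comp_add, trans_toL2 _ hg.memLp, trans_toL2 _ (hg.pdv _).memLp]
  have he : entrywise (avg j r) (toL2 g, fun j => toL2 (pdv j g))
      = r⁻¹ • ∫ s in (0 : ℝ)..r, F s := by
    have hi := hF.intervalIntegrable (μ := volume) 0 r
    refine Prod.ext ?_ (funext fun k => ?_)
    · have := (ContinuousLinearMap.fst ℝ L2 (Fin 3 → L2)).intervalIntegral_comp_comm hi
      simp only [ContinuousLinearMap.coe_fst'] at this
      rw [Prod.smul_fst, ← this]
      rfl
    · have := ((ContinuousLinearMap.proj (R := ℝ) (φ := fun _ : Fin 3 => L2) k) ∘L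
        ContinuousLinearMap.snd ℝ L2 (Fin 3 → L2)).intervalIntegral_comp_comm hi
      simp only [ContinuousLinearMap.comp_apply, ContinuousLinearMap.coe_snd',
        ContinuousLinearMap.proj_apply] at this
      rw [Prod.smul_snd, Pi.smul_apply, ← this]
      rfl
  simp only [mem_ofPred_eq, he]
  refine Submodule.smul_mem _ _ ?_
  have hcv : Convex ℝ (testGraph.topologicalClosure : Set (L2 × (Fin 3 → L2))) :=
    testGraph.topologicalClosure.convex
  rcases eq_or_ne r 0 with rfl | hr
  · simp
  -- The normalized average stays in the closure because this is a closed convex set.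
  have hav : ⨍ s in (0 : ℝ)..r, F s ∈ testGraph.topologicalClosure := by
    refine hcv.set_average_mem testGraph.isClosed_topologicalClosure ?_ ?_
      (Eventually.of_forall hmem) ?_
    · simpa [uIoc] using fun h => lt_of_le_of_ne h hr
    · simp [uIoc]
    · exact (hF.intervalIntegrable (μ := volume) 0 r).def'
  rw [interval_average_eq, sub_zero] at hav
  have := Submodule.smul_mem _ r hav
  rwa [smul_smul, mul_inv_cancel₀ hr, one_smul] at this

lemma cubeAvg_mem_closure (r : ℝ) {g : E3 → E3} (hg : IsTestField g) :
    (cubeAvg r (toL2 g), fun j => cubeAvg r (toL2 (pdv j g))) ∈ testGraph.topologicalClosure := by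
  have h1 : (toL2 g, fun j => toL2 (pdv j g)) ∈ testGraph.topologicalClosure :=
    testGraph.le_topologicalClosure ⟨g, hg, rfl⟩
  have h2 := entrywise_avg_mem 0 r (entrywise_avg_mem 1 r (entrywise_avg_mem 2 r h1))
  simp only [entrywise_apply] at h2
  exact h2

/-- After averaging, the whole graph depends continuously on `v` in `L²` alone, so approximating `v`
by test fields in `L²` suffices, with no control of their gradients. -/
lemma cubeAvg_graph_mem_closure (r : ℝ) {v : L2} (h : MemHDotOne v) :
    (cubeAvg r v, fun j => cubeAvg r (weakPartial j v)) ∈ testGraph.topologicalClosure := by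
  choose T hT using fun j => exists_cubeAvg_partial j r
  obtain ⟨g, hg, hgv⟩ := exists_seq_testField v
  have e : (fun j => cubeAvg r (weakPartial j v)) = fun j => T j v :=
    funext fun j => hT j v _ (h.isWeakPartial j)
  rw [e]
  have hlim : Tendsto (fun n => (cubeAvg r (toL2 (g n)), fun j => T j (toL2 (g n)))) atTop
      (𝓝 (cubeAvg r v, fun j => T j v)) :=
    (((cubeAvg r).continuous.tendsto v).comp hgv).prodMk_nhds
      (tendsto_pi_nhds.2 fun j => ((T j).continuous.tendsto v).comp hgv)
  refine testGraph.isClosed_topologicalClosure.mem_of_tendsto hlim (Eventually.of_forall fun n => ?_)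
  have e' : (fun j => T j (toL2 (g n))) = fun j => cubeAvg r (toL2 (pdv j (g n))) :=
    funext fun j => (hT j _ _ ((hg n).isWeakPartial j)).symm
  rw [e']
  exact cubeAvg_mem_closure r (hg n)

lemma graph_mem_closure {v : L2} (h : MemHDotOne v) :
    (v, fun j => weakPartial j v) ∈ testGraph.topologicalClosure :=
  testGraph.isClosed_topologicalClosure.mem_of_tendsto (b := 𝓝[≠] (0 : ℝ))
    ((tendsto_cubeAvg v).prodMk_nhds (tendsto_pi_nhds.2 fun j => tendsto_cubeAvg (weakPartial j v)))
    (Eventually.of_forall fun r => cubeAvg_graph_mem_closure r h)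

/-- Test fields are dense for the graph norm of the gradient. -/
lemma MemHDotOne.exists_seq_testField {v : L2} (h : MemHDotOne v) :
    ∃ g : ℕ → E3 → E3, (∀ n, IsTestField (g n)) ∧ Tendsto (fun n => toL2 (g n)) atTop (𝓝 v) ∧
      ∀ j, Tendsto (fun n => toL2 (pdv j (g n))) atTop (𝓝 (weakPartial j v)) := by
  obtain ⟨x, hx, hl⟩ := mem_closure_iff_seq_limit.1 (graph_mem_closure h)
  choose g hg hxg using hx
  obtain rfl : x = _ := funext hxg
  exact ⟨g, hg, (continuous_fst.tendsto _).comp hl, fun j =>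
    ((continuous_apply j).tendsto _).comp ((continuous_snd.tendsto _).comp hl)⟩

/-! ### The projection onto divergence-free fields and weak derivatives -/

lemma trans_mem_solenoidal (y : E3) {v : L2} (h : v ∈ solenoidal) : trans y v ∈ solenoidal := by
  rw [mem_solenoidal, isDivFree_iff] at *
  intro φ hφ
  rw [inner_trans, trans_toL2 _ hφ.gradField.memLp, ← gradField_comp_add]
  exact h _ (hφ.comp_add _)

/-- Translations are unitary and preserve the divergence-free fields, so they commute with the
orthogonal projection. -/
lemma leray_trans (y : E3) (v : L2) : leray (trans y v) = trans y (leray v) := by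
  refine Submodule.eq_starProjection_of_mem_of_inner_eq_zero
    (trans_mem_solenoidal y (leray_mem v)) fun w hw => ?_
  rw [← map_sub, inner_trans]
  exact Submodule.starProjection_inner_eq_zero v _ (trans_mem_solenoidal _ hw)

/-- The function `s ↦ ⟨leray (trans (s e_j) g), h⟩` is differentiated at `0` in two ways: on `g`,
and on `h` after the translation has been carried through the projection. -/
lemma IsTestField.isWeakPartial_leray {g : E3 → E3} (hg : IsTestField g) (j : Fin 3) :
    IsWeakPartial j (leray (toL2 g)) (leray (toL2 (DampedNS.pdv j g))) := by
  rw [isWeakPartial_iff]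
  intro h hh
  have h1 : HasDerivAt (fun s : ℝ => inner ℝ (leray (trans (s • basisVec j) (toL2 g))) (toL2 h))
      (inner ℝ (leray (toL2 (DampedNS.pdv j g))) (toL2 h)) 0 := by
    have := (leray.hasFDerivAt.comp_hasDerivAt (0 : ℝ) (hasDerivAt_trans_testField hg j 0)).inner ℝ
      (hasDerivAt_const (0 : ℝ) (toL2 h))
    simpa [trans_zero] using this
  have h2 : HasDerivAt (fun s : ℝ => inner ℝ (leray (trans (s • basisVec j) (toL2 g))) (toL2 h))
      (- inner ℝ (leray (toL2 g)) (toL2 (DampedNS.pdv j h))) 0 := by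
    have h3 := hasDerivAt_trans_testField hh j (-0)
    have := (hasDerivAt_const (0 : ℝ) (leray (toL2 g))).inner ℝ (h3.scomp 0 (hasDerivAt_neg 0))
    convert! this using 1
    · ext s
      rw [leray_trans, inner_trans]
      simp
    · simp [trans_zero]
  have := h1.unique h2
  linarith

lemma leray_testField_mem {g : E3 → E3} (hg : IsTestField g) :
    leray (toL2 g) ∈ solenoidalOne :=
  ⟨leray_mem _, fun j => ⟨_, hg.isWeakPartial_leray j⟩⟩

/-- The orthogonal complement of the divergence-free fields consists of curl-free fields. -/
lemma inner_pd_comm_of_mem_orthogonal {z : L2} (hz : z ∈ solenoidalᗮ) {φ : E3 → ℝ} (hφ : IsTest φ)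
    (j k : Fin 3) : inner ℝ z (toL2 fun x => pd j φ x • basisVec k)
      = inner ℝ z (toL2 fun x => pd k φ x • basisVec j) := by
  have hj := (hφ.pd j).smul_basisVec k
  have hk := (hφ.pd k).smul_basisVec j
  -- The field `∂_jφ e_k - ∂_kφ e_j` is divergence free because second derivatives commute.
  have hc : (toL2 fun x => pd j φ x • basisVec k) - (toL2 fun x => pd k φ x • basisVec j)
      ∈ solenoidal := by
    rw [mem_solenoidal, isDivFree_iff]
    intro η hη
    have key : ∀ a b : Fin 3, inner ℝ (toL2 fun x => pd a φ x • basisVec b) (toL2 (gradField η))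
        = - ∫ x, pd b (pd a φ) x * η x := by
      intro a b
      rw [real_inner_comm, inner_smul_basisVec _ (hφ.pd a).memLp,
        ← integral_mul_pd (hφ.pd a) hη b]
      refine integral_congr_ae ?_
      filter_upwards [coeFn_toL2 hη.gradField.memLp] with x hx
      rw [hx, mul_comm]
      rfl
    rw [inner_sub_left, key, key]
    simp only [pd_comm hφ.1 j k, sub_self]
  have := (Submodule.mem_orthogonal _ _).1 hz _ hc
  rw [real_inner_comm, inner_sub_right] at this
  linarith

lemma sub_leray_mem_orthogonal (v : L2) : v - leray v ∈ solenoidalᗮ :=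
  Submodule.sub_starProjection_mem_orthogonal v

/-- Divergence-free fields with one weak derivative are dense in the divergence-free fields. -/
lemma exists_solenoidalOne_near {v : L2} (hv : v ∈ solenoidal) {ε : ℝ} (hε : 0 < ε) :
    ∃ w : solenoidalOne, ‖v - w‖ < ε := by
  obtain ⟨g, hg, hgv⟩ := exists_testField_near v hε
  refine ⟨⟨_, leray_testField_mem hg⟩, ?_⟩
  have : v - leray (toL2 g) = leray (v - toL2 g) := by rw [map_sub, leray_eq_self hv]
  simp only [this]
  exact (norm_leray_le _).trans_lt hgv

instance : SecondCountableTopology L2 := by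
  have : Fact ((2 : ENNReal) ≠ ⊤) := ⟨by simp⟩
  exact inferInstance

/-- A sequence that is dense for the graph norm of the gradient. -/
lemma exists_dense_seq_solenoidalOne : ∃ w : ℕ → solenoidalOne, ∀ (v : solenoidalOne) (ε : ℝ),
    0 < ε → ∃ k, ‖(v : L2) - w k‖ < ε ∧ ∀ j, ‖wpd j v - wpd j (w k)‖ < ε := by
  -- The graphs form a subset of a second countable space, so a dense sequence can be chosen inside
  -- this subset itself.
  let G : solenoidalOne → L2 × (Fin 3 → L2) := fun v => (v, fun j => wpd j v)
  have : Nonempty (range G) := ⟨⟨G 0, 0, rfl⟩⟩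
  let d := TopologicalSpace.denseSeq (range G)
  have hd : DenseRange d := TopologicalSpace.denseRange_denseSeq _
  choose w hw using fun n => (d n).2
  refine ⟨w, fun v ε hε => ?_⟩
  obtain ⟨k, hk⟩ := hd.exists_dist_lt ⟨G v, v, rfl⟩ hε
  rw [Subtype.dist_eq, ← hw k, Prod.dist_eq, max_lt_iff, dist_pi_lt_iff hε] at hk
  simp only [dist_eq_norm] at hk
  exact ⟨k, hk⟩

/-! ### Integrability of products -/

/-- The sum of the norms of the weak derivatives. -/
def gradSum (v : L2) : ℝ := ∑ j, ‖weakPartial j v‖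

lemma gradSum_nonneg (v : L2) : 0 ≤ gradSum v := Finset.sum_nonneg fun _ _ => norm_nonneg _

lemma hDotOneSq_nonneg (v : L2) : 0 ≤ hDotOneSq v := Finset.sum_nonneg fun _ _ => sq_nonneg _

lemma gradSum_sq_le (v : L2) : gradSum v ^ 2 ≤ 3 * hDotOneSq v := by
  have := sq_sum_le_card_mul_sum_sq (s := Finset.univ) (f := fun j => ‖weakPartial j v‖)
  simpa [gradSum, hDotOneSq] using this

lemma norm_weakPartial_le_gradSum (v : L2) (j : Fin 3) : ‖weakPartial j v‖ ≤ gradSum v :=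
  Finset.single_le_sum (f := fun j => ‖weakPartial j v‖) (fun _ _ => norm_nonneg _)
    (Finset.mem_univ j)

/-! ### Sobolev and Ladyzhenskaya inequalities -/

lemma eLpNorm_toL2 {g : E3 → E3} (hg : MemLp g 2 volume) :
    eLpNorm g 2 volume = ENNReal.ofReal ‖toL2 g‖ := by
  rw [Lp.norm_def, ENNReal.ofReal_toReal (Lp.eLpNorm_ne_top _)]
  exact eLpNorm_congr_ae (coeFn_toL2 hg).symm

lemma eLpNorm_coeFn (v : L2) : eLpNorm v 2 volume = ENNReal.ofReal ‖v‖ := by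
  rw [Lp.norm_def, ENNReal.ofReal_toReal (Lp.eLpNorm_ne_top _)]

lemma eLpNorm_fderiv_le {g : E3 → E3} (hg : IsTestField g) :
    eLpNorm (fderiv ℝ g) 2 volume ≤ ENNReal.ofReal (∑ j, ‖toL2 (pdv j g)‖) := by
  rw [ENNReal.ofReal_sum_of_nonneg fun _ _ => norm_nonneg _]
  simp only [← eLpNorm_toL2 (hg.pdv _).memLp]
  have h1 : eLpNorm (fderiv ℝ g) 2 volume
      ≤ eLpNorm (∑ j, fun x => ‖pdv j g x‖) 2 volume := by
    refine eLpNorm_mono_real fun x => ?_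
    rw [Finset.sum_apply]
    refine ContinuousLinearMap.opNorm_le_bound _ (Finset.sum_nonneg fun _ _ => norm_nonneg _)
      fun y => ?_
    conv_lhs => rw [← sum_smul_basisVec y, map_sum]
    rw [Finset.sum_mul]
    refine (norm_sum_le _ _).trans (Finset.sum_le_sum fun j _ => ?_)
    rw [map_smul, norm_smul, mul_comm]
    exact mul_le_mul_of_nonneg_left (abs_apply_le_norm y j) (norm_nonneg _)
  refine h1.trans ((eLpNorm_sum_le (fun j _ => ?_) (by norm_num)).trans_eq ?_)
  · exact (hg.pdv j).1.continuous.norm.aestronglyMeasurable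
  · exact Finset.sum_congr rfl fun j _ => eLpNorm_norm _

/-- The Sobolev embedding of `H¹` into `L⁶`. -/
lemma exists_eLpNorm_six_le : ∃ C : ℝ, 0 ≤ C ∧ ∀ v : L2, MemHDotOne v →
    eLpNorm v 6 volume ≤ ENNReal.ofReal (C * gradSum v) := by
  let C : NNReal := eLpNormLESNormFDerivOfEqInnerConst (volume : Measure E3) 2
  have htest : ∀ g, IsTestField g →
      eLpNorm g 6 volume ≤ ENNReal.ofReal (C * ∑ j, ‖toL2 (pdv j g)‖) := by
    intro g hg
    have hfr : Module.finrank ℝ E3 = 3 := by simp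
    -- Gagliardo–Nirenberg–Sobolev in dimension `3`, with `1/6 = 1/2 - 1/3`.
    have h := eLpNorm_le_eLpNorm_fderiv_of_eq_inner (μ := (volume : Measure E3)) (u := g)
      (hg.1.of_le (by norm_cast)) hg.2 (p := 2) (p' := 6) (by norm_num)
      (by rw [hfr]; norm_num) (by rw [hfr]; norm_num)
    rw [ENNReal.ofReal_mul (NNReal.coe_nonneg C), ENNReal.ofReal_coe_nnreal]
    refine le_trans (by simpa using h) ?_
    gcongr
    exact eLpNorm_fderiv_le hg
  refine ⟨C, C.2, fun v hv => ?_⟩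
  obtain ⟨g, hg, hgv, hgd⟩ := hv.exists_seq_testField
  -- Convergence of the test fields is known in `L²` only; an almost everywhere convergent
  -- subsequence lets Fatou's lemma carry the `L⁶` bound to `v`.
  obtain ⟨ns, hns, hae⟩ := (tendstoInMeasure_of_tendsto_Lp hgv).exists_seq_tendsto_ae
  have h1 := Lp.eLpNorm_lim_le_liminf_eLpNorm (p := 6) (μ := (volume : Measure E3))
    (f := fun n => (toL2 (g (ns n)) : E3 → E3)) (fun n => Lp.aestronglyMeasurable _) v hae
  refine h1.trans ?_
  have h2 : Tendsto (fun n => ENNReal.ofReal (C * ∑ j, ‖toL2 (pdv j (g (ns n)))‖)) atTop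
      (𝓝 (ENNReal.ofReal (C * gradSum v))) := by
    refine ENNReal.tendsto_ofReal (Tendsto.const_mul _ (tendsto_finsetSum _ fun j _ => ?_))
    exact ((hgd j).comp hns.tendsto_atTop).norm
  rw [← h2.liminf_eq]
  refine liminf_le_liminf (Eventually.of_forall fun n => ?_)
  rw [eLpNorm_congr_ae (coeFn_toL2 (hg _).memLp)]
  exact htest _ (hg _)

/-- Cauchy–Schwarz applied to `|g|⁴ = |g| · |g|³`. -/
lemma eLpNorm_four_pow_le {g : E3 → E3} (hg : AEStronglyMeasurable g volume) :
    eLpNorm g 4 volume ^ 4 ≤ eLpNorm g 2 volume * eLpNorm g 6 volume ^ 3 := by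
  have hp : ∀ n : ℕ, n ≠ 0 →
      eLpNorm g n volume ^ n = ∫⁻ x, ‖g x‖ₑ ^ n := by
    intro n hn
    rw [eLpNorm_eq_lintegral_rpow_enorm_toReal (by simpa using hn) (by simp)]
    simp only [ENNReal.toReal_natCast, ENNReal.rpow_natCast]
    rw [← ENNReal.rpow_natCast, ← ENNReal.rpow_mul]
    simp [hn]
  have h4 := hp 4 (by norm_num)
  have h2 := hp 2 (by norm_num)
  have h6 := hp 6 (by norm_num)
  have hol := ENNReal.lintegral_mul_le_Lp_mul_Lq (volume : Measure E3)
    (Real.HolderConjugate.two_two) (f := fun x => ‖g x‖ₑ) (g := fun x => ‖g x‖ₑ ^ 3)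
    hg.enorm (hg.enorm.pow_const 3)
  push_cast at h4 h2 h6
  rw [h4]
  calc ∫⁻ x, ‖g x‖ₑ ^ 4 = ∫⁻ x, ((fun x => ‖g x‖ₑ) * fun x => ‖g x‖ₑ ^ 3) x := by
        refine lintegral_congr fun x => ?_
        simp only [Pi.mul_apply]; ring
    _ ≤ _ := hol
    _ = eLpNorm g 2 volume * eLpNorm g 6 volume ^ 3 := by
        have e1 : ∀ x, ‖g x‖ₑ ^ (2 : ℝ) = ‖g x‖ₑ ^ 2 := fun x => by
          exact_mod_cast ENNReal.rpow_natCast ‖g x‖ₑ 2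
        have e2 : ∀ x, (‖g x‖ₑ ^ 3) ^ (2 : ℝ) = ‖g x‖ₑ ^ 6 := fun x => by
          have := ENNReal.rpow_natCast (‖g x‖ₑ ^ 3) 2
          push_cast at this
          rw [this]; ring
        simp only [e1, e2]
        rw [← h2, ← h6]
        congr 1
        · rw [← ENNReal.rpow_natCast, ← ENNReal.rpow_mul]; norm_num
        · rw [← ENNReal.rpow_natCast, ← ENNReal.rpow_mul, ← ENNReal.rpow_natCast]; norm_num

/-- The `L⁴` norm, as a real number. -/
def normFour (v : L2) : ℝ := (eLpNorm v 4 volume).toReal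

lemma normFour_nonneg (v : L2) : 0 ≤ normFour v := ENNReal.toReal_nonneg

/-- Interpolation of `L⁴` between `L²` and `L⁶`, followed by the Sobolev embedding. -/
lemma exists_normFour_le : ∃ C : ℝ, 0 ≤ C ∧ ∀ v : L2, MemHDotOne v →
    MemLp v 4 volume ∧ normFour v ^ 4 ≤ C * ‖v‖ * gradSum v ^ 3 := by
  obtain ⟨C, hC, h6⟩ := exists_eLpNorm_six_le
  refine ⟨C ^ 3, by positivity, fun v hv => ?_⟩
  have h := eLpNorm_four_pow_le (Lp.aestronglyMeasurable v)
  have h' : eLpNorm v 4 volume ^ 4 ≤ ENNReal.ofReal (C ^ 3 * ‖v‖ * gradSum v ^ 3) := by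
    refine h.trans ?_
    rw [eLpNorm_coeFn]
    have := h6 v hv
    calc ENNReal.ofReal ‖v‖ * eLpNorm v 6 volume ^ 3
        ≤ ENNReal.ofReal ‖v‖ * ENNReal.ofReal (C * gradSum v) ^ 3 := by gcongr
      _ = _ := by
        have h0 := mul_nonneg hC (gradSum_nonneg v)
        rw [← ENNReal.ofReal_pow h0, ← ENNReal.ofReal_mul (norm_nonneg _)]
        congr 1; ring
  have hne : eLpNorm v 4 volume ≠ ⊤ := by
    intro htop
    rw [htop] at h'
    simp at h'
  refine ⟨⟨Lp.aestronglyMeasurable v, hne.lt_top⟩, ?_⟩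
  have h0 : 0 ≤ C ^ 3 * ‖v‖ * gradSum v ^ 3 := by have := gradSum_nonneg v; positivity
  rw [normFour, ← ENNReal.toReal_pow]
  exact ENNReal.toReal_le_of_le_ofReal h0 h'

/-- A constant in the Ladyzhenskaya inequality. -/
def ladyConst : ℝ := exists_normFour_le.choose

lemma ladyConst_nonneg : 0 ≤ ladyConst := exists_normFour_le.choose_spec.1

lemma MemHDotOne.memLp_four {v : L2} (h : MemHDotOne v) : MemLp v 4 volume :=
  (exists_normFour_le.choose_spec.2 v h).1

lemma MemHDotOne.normFour_pow_le {v : L2} (h : MemHDotOne v) :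
    normFour v ^ 4 ≤ ladyConst * ‖v‖ * gradSum v ^ 3 :=
  (exists_normFour_le.choose_spec.2 v h).2

/-- A form of Young's inequality: the coefficient of the squared gradient can be made arbitrarily
small, which the a priori estimates in time require. -/
lemma MemHDotOne.normFour_sq_le {v : L2} (h : MemHDotOne v) {M lam : ℝ} (hM : ‖v‖ ≤ M)
    (hl : 0 < lam) : normFour v ^ 2 ≤ lam * gradSum v ^ 2 + (ladyConst * M) ^ 2 / lam ^ 3 := by
  have h1 := h.normFour_pow_le
  have hG := gradSum_nonneg v
  have hC := ladyConst_nonneg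
  have hM0 : 0 ≤ M := (norm_nonneg v).trans hM
  set G := gradSum v
  set A := ladyConst * M with hA
  have hA0 : 0 ≤ A := by positivity
  have h2 : (normFour v ^ 2) ^ 2 ≤ A * G ^ 3 := by
    calc (normFour v ^ 2) ^ 2 = normFour v ^ 4 := by ring
      _ ≤ ladyConst * ‖v‖ * G ^ 3 := h1
      _ ≤ A * G ^ 3 := by rw [hA]; gcongr
  refine le_of_sq_le_sq (h2.trans ?_) (by positivity)
  -- The two terms of the bound balance when `G * lam ^ 2 = A`; on either side of this threshold one
  -- of them dominates alone.
  rcases le_total (G * lam ^ 2) A with hle | hle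
  · have : G ≤ A / lam ^ 2 := by rwa [le_div_iff₀ (by positivity)]
    calc A * G ^ 3 ≤ A * (A / lam ^ 2) ^ 3 := by gcongr
      _ = (A ^ 2 / lam ^ 3) ^ 2 := by field_simp
      _ ≤ _ := by gcongr; exact le_add_of_nonneg_left (by positivity)
  · calc A * G ^ 3 ≤ (G * lam ^ 2) * G ^ 3 := by gcongr
      _ = (lam * G ^ 2) ^ 2 := by ring
      _ ≤ _ := by gcongr; exact le_add_of_nonneg_right (by positivity)

/-! ### The product `u_j v` and the cancellation of the transport term -/

/-- The field `u_j v`. -/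
def prodF (j : Fin 3) (u v : L2) : L2 := toL2 fun x => u x j • v x

lemma memLp_prodF (j : Fin 3) {u v : L2} (hu : MemLp u 4 volume) (hv : MemLp v 4 volume) :
    MemLp (fun x => u x j • v x) 2 volume := by
  have : ENNReal.HolderTriple 4 4 2 := ⟨by
    rw [← ENNReal.toReal_eq_toReal_iff' (by simp) (by simp), ENNReal.toReal_add (by simp) (by simp)]
    norm_num⟩
  exact hv.smul (memLp_apply hu j)

lemma coeFn_prodF (j : Fin 3) {u v : L2} (hu : MemLp u 4 volume) (hv : MemLp v 4 volume) :
    prodF j u v =ᵐ[volume] fun x => u x j • v x := coeFn_toL2 (memLp_prodF j hu hv)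

lemma norm_prodF_le (j : Fin 3) {u v : L2} (hu : MemLp u 4 volume) (hv : MemLp v 4 volume) :
    ‖prodF j u v‖ ≤ normFour u * normFour v := by
  have hT : ENNReal.HolderTriple 4 4 2 := ⟨by
    rw [← ENNReal.toReal_eq_toReal_iff' (by simp) (by simp), ENNReal.toReal_add (by simp) (by simp)]
    norm_num⟩
  have h := eLpNorm_smul_le_mul_eLpNorm (p := 4) (q := 4) (r := 2) hv.1 (memLp_apply hu j).1
  have h2 : eLpNorm (fun x => u x j) 4 volume ≤ eLpNorm u 4 volume :=
    eLpNorm_mono fun x => by simpa using abs_apply_le_norm (u x) j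
  have h3 : ENNReal.ofReal ‖prodF j u v‖ ≤ eLpNorm u 4 volume * eLpNorm v 4 volume := by
    rw [prodF, ← eLpNorm_toL2 (memLp_prodF j hu hv)]
    exact h.trans (by gcongr)
  rw [normFour, normFour, ← ENNReal.toReal_mul]
  exact (ENNReal.ofReal_le_iff_le_toReal (ENNReal.mul_ne_top hu.2.ne hv.2.ne)).1 h3

lemma prodF_add_left (j : Fin 3) {u u' v : L2} (hu : MemLp u 4 volume) (hu' : MemLp u' 4 volume)
    (hv : MemLp v 4 volume) : prodF j (u + u') v = prodF j u v + prodF j u' v := by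
  rw [prodF, prodF, prodF, ← toL2_add (memLp_prodF j hu hv) (memLp_prodF j hu' hv)]
  refine toL2_congr ?_
  filter_upwards [Lp.coeFn_add u u'] with x hx
  rw [hx, ← add_smul]; rfl

lemma prodF_add_right (j : Fin 3) {u v v' : L2} (hu : MemLp u 4 volume) (hv : MemLp v 4 volume)
    (hv' : MemLp v' 4 volume) : prodF j u (v + v') = prodF j u v + prodF j u v' := by
  rw [prodF, prodF, prodF, ← toL2_add (memLp_prodF j hu hv) (memLp_prodF j hu hv')]
  refine toL2_congr ?_
  filter_upwards [Lp.coeFn_add v v'] with x hx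
  rw [hx, ← smul_add]; rfl

lemma prodF_smul_left (j : Fin 3) (c : ℝ) {u v : L2} (hu : MemLp u 4 volume)
    (hv : MemLp v 4 volume) : prodF j (c • u) v = c • prodF j u v := by
  rw [prodF, prodF, ← toL2_smul c (memLp_prodF j hu hv)]
  refine toL2_congr ?_
  filter_upwards [Lp.coeFn_smul c u] with x hx
  rw [hx, smul_smul]; rfl

lemma prodF_smul_right (j : Fin 3) (c : ℝ) {u v : L2} (hu : MemLp u 4 volume)
    (hv : MemLp v 4 volume) : prodF j u (c • v) = c • prodF j u v := by
  rw [prodF, prodF, ← toL2_smul c (memLp_prodF j hu hv)]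
  refine toL2_congr ?_
  filter_upwards [Lp.coeFn_smul c v] with x hx
  rw [hx, Pi.smul_apply, smul_comm]

lemma MemHDotOne.add {v w : L2} (h : MemHDotOne v) (h' : MemHDotOne w) : MemHDotOne (v + w) :=
  fun j => ⟨_, (h.isWeakPartial j).add (h'.isWeakPartial j)⟩

lemma MemHDotOne.smul {v : L2} (h : MemHDotOne v) (c : ℝ) : MemHDotOne (c • v) :=
  fun j => ⟨_, (h.isWeakPartial j).smul c⟩

lemma MemHDotOne.sub {v w : L2} (h : MemHDotOne v) (h' : MemHDotOne w) : MemHDotOne (v - w) := by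
  have := h.add (h'.smul (-1))
  rwa [neg_one_smul, ← sub_eq_add_neg] at this

lemma weakPartial_sub {v w : L2} (h : MemHDotOne v) (h' : MemHDotOne w) (j : Fin 3) :
    weakPartial j (v - w) = weakPartial j v - weakPartial j w := by
  have := (h.isWeakPartial j).add ((h'.isWeakPartial j).smul (-1))
  rw [neg_one_smul, ← sub_eq_add_neg, neg_one_smul, ← sub_eq_add_neg] at this
  exact weakPartial_eq this

/-- The product `u_j v` as a bilinear map. -/
def prodL (j : Fin 3) : solenoidalOne →ₗ[ℝ] solenoidalOne →ₗ[ℝ] L2 :=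
  LinearMap.mk₂ ℝ (fun u v => prodF j u v)
    (fun u u' v => prodF_add_left j u.2.2.memLp_four u'.2.2.memLp_four v.2.2.memLp_four)
    (fun c u v => prodF_smul_left j c u.2.2.memLp_four v.2.2.memLp_four)
    (fun u v v' => prodF_add_right j u.2.2.memLp_four v.2.2.memLp_four v'.2.2.memLp_four)
    (fun c u v => prodF_smul_right j c u.2.2.memLp_four v.2.2.memLp_four)

/-- The sum is the pairing of `u` with the gradient of the test function `|g|²/2`, which vanishes
because `u` is divergence free. -/
lemma sum_inner_prodF_testField {u : L2} (hu : u ∈ solenoidal) (h4 : MemLp u 4 volume)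
    {g : E3 → E3} (hg : IsTestField g) :
    ∑ j, inner ℝ (prodF j u (toL2 g)) (toL2 (pdv j g)) = 0 := by
  let φ : E3 → ℝ := fun x => (1 / 2 : ℝ) * ∑ i, g x i ^ 2
  have hφ : IsTest φ := by
    constructor
    · exact contDiff_const.mul (ContDiff.sum fun i _ => (hg.apply i).1.pow 2)
    · exact hg.2.comp_left (g := fun a : E3 => (1 / 2 : ℝ) * ∑ i, a i ^ 2) (by simp)
  have hpd : ∀ j x, pd j φ x = ∑ i, g x i * pd j (fun y => g y i) x := by
    intro j x
    have h1 : HasFDerivAt φ ((1 / 2 : ℝ) • ∑ i, (2 • g x i ^ (2 - 1)) • fderiv ℝ (fun y => g y i) x) x :=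
      (HasFDerivAt.fun_sum fun i _ =>
        ((hg.apply i).differentiable x).hasFDerivAt.pow 2).const_mul _
    simp only [pd, h1.fderiv]
    simp only [_root_.smul_apply, _root_.sum_apply, smul_eq_mul,
      Finset.mul_sum]
    refine Finset.sum_congr rfl fun i _ => ?_
    rw [nsmul_eq_mul]
    push_cast
    ring
  have hg4 : MemLp (toL2 g) 4 volume := (hg.memLp).ae_eq (coeFn_toL2 hg.memLp).symm
  have hdiv := (isDivFree_iff.1 (mem_solenoidal.1 hu)) φ hφ
  rw [inner_toL2_eq_sum u hφ.gradField.memLp] at hdiv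
  rw [← hdiv]
  refine Finset.sum_congr rfl fun j _ => ?_
  rw [inner_toL2 _ (hg.pdv j).memLp]
  refine integral_congr_ae ?_
  filter_upwards [coeFn_prodF j h4 hg4, coeFn_toL2 hg.memLp] with x h1 h2
  simp only [gradField]
  rw [hpd, Finset.mul_sum]
  refine Finset.sum_congr rfl fun i _ => ?_
  rw [h1, h2, pdv_apply hg.differentiable]
  simp only [PiLp.smul_apply, smul_eq_mul]
  ring

lemma gradSum_sub_testField_tendsto {v : L2} (h : MemHDotOne v) {g : ℕ → E3 → E3}
    (hg : ∀ n, IsTestField (g n))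
    (hd : ∀ j, Tendsto (fun n => toL2 (pdv j (g n))) atTop (𝓝 (weakPartial j v))) :
    Tendsto (fun n => gradSum (toL2 (g n) - v)) atTop (𝓝 0) := by
  have : ∀ n, gradSum (toL2 (g n) - v) = ∑ j, ‖toL2 (pdv j (g n)) - weakPartial j v‖ := by
    intro n
    refine Finset.sum_congr rfl fun j _ => ?_
    rw [weakPartial_sub (hg n).memHDotOne h, weakPartial_eq ((hg n).isWeakPartial j)]
  simp only [this]
  have h0 : (0 : ℝ) = ∑ _j : Fin 3, 0 := by simp
  rw [h0]
  exact tendsto_finsetSum _ fun j _ => tendsto_iff_norm_sub_tendsto_zero.1 (hd j)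

lemma normFour_tendsto_zero {x : ℕ → L2} (h : ∀ n, MemHDotOne (x n))
    (h1 : Tendsto (fun n => ‖x n‖) atTop (𝓝 0))
    (h2 : Tendsto (fun n => gradSum (x n)) atTop (𝓝 0)) :
    Tendsto (fun n => normFour (x n)) atTop (𝓝 0) := by
  have h4 : Tendsto (fun n => normFour (x n) ^ 4) atTop (𝓝 0) := by
    refine squeeze_zero (fun n => by positivity) (fun n => (h n).normFour_pow_le) ?_
    simpa using (h1.const_mul ladyConst).mul (h2.pow 3)
  have := h4.sqrt.sqrt
  simp only [Real.sqrt_zero] at this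
  refine this.congr fun n => ?_
  have h0 := normFour_nonneg (x n)
  rw [show normFour (x n) ^ 4 = (normFour (x n) ^ 2) ^ 2 by ring, Real.sqrt_sq (by positivity),
    Real.sqrt_sq h0]

/-- The trilinear form is alternating in its last two arguments. -/
lemma sum_inner_prodF_self {u w : L2} (hu : u ∈ solenoidal) (hu1 : MemHDotOne u)
    (hw : MemHDotOne w) : ∑ j, inner ℝ (prodF j u w) (weakPartial j w) = 0 := by
  obtain ⟨g, hg, hgw, hgd⟩ := hw.exists_seq_testField
  have h4 := hu1.memLp_four
  -- Graph-norm convergence implies `L⁴` convergence by the Ladyzhenskaya inequality, and hence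
  -- convergence of the products in `L²`.
  have hn : Tendsto (fun n => normFour (toL2 (g n) - w)) atTop (𝓝 0) :=
    normFour_tendsto_zero (fun n => (hg n).memHDotOne.sub hw)
      (tendsto_iff_norm_sub_tendsto_zero.1 hgw) (gradSum_sub_testField_tendsto hw hg hgd)
  have hp : ∀ j, Tendsto (fun n => prodF j u (toL2 (g n))) atTop (𝓝 (prodF j u w)) := by
    intro j
    rw [tendsto_iff_norm_sub_tendsto_zero]
    refine squeeze_zero (fun _ => norm_nonneg _) (fun n => ?_)
      (by simpa using hn.const_mul (normFour u))
    have hd := ((hg n).memHDotOne.sub hw).memLp_four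
    have e : prodF j u (toL2 (g n)) - prodF j u w = prodF j u (toL2 (g n) - w) := by
      rw [sub_eq_iff_eq_add, ← prodF_add_right j h4 hd hw.memLp_four, sub_add_cancel]
    rw [e]
    exact norm_prodF_le j h4 hd
  have hlim : Tendsto (fun n => ∑ j, inner ℝ (prodF j u (toL2 (g n))) (toL2 (pdv j (g n)))) atTop
      (𝓝 (∑ j, inner ℝ (prodF j u w) (weakPartial j w))) :=
    tendsto_finsetSum _ fun j _ => (hp j).inner (hgd j)
  simp only [sum_inner_prodF_testField hu h4 (hg _)] at hlim
  exact tendsto_nhds_unique hlim tendsto_const_nhds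

/-! ### Local compactness -/

/-- The uniform probability measure on the ball of radius `δ` centred at the origin. -/
def ballProb (δ : ℝ) : Measure E3 :=
  (volume (Metric.ball (0 : E3) δ))⁻¹ • volume.restrict (Metric.ball (0 : E3) δ)

lemma isProbabilityMeasure_ballProb {δ : ℝ} (hδ : 0 < δ) : IsProbabilityMeasure (ballProb δ) := by
  constructor
  simp only [ballProb, Measure.smul_apply, Measure.restrict_apply_univ, smul_eq_mul]
  exact ENNReal.inv_mul_cancel (Metric.measure_ball_pos volume 0 hδ).ne' measure_ball_lt_top.ne

instance (δ : ℝ) : SFinite (ballProb δ) := by unfold ballProb; infer_instance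

/-- The average of `v` over the ball of radius `δ` centred at `x`. -/
def ballAvg (δ : ℝ) (v : L2) (x : E3) : E3 := ∫ y, v (x + y) ∂ballProb δ

lemma stronglyMeasurable_add (v : L2) : StronglyMeasurable fun p : E3 × E3 => v (p.1 + p.2) :=
  (Lp.stronglyMeasurable v).comp_measurable (measurable_fst.add measurable_snd)

lemma stronglyMeasurable_ballAvg (δ : ℝ) (v : L2) : StronglyMeasurable (ballAvg δ v) :=
  (stronglyMeasurable_add v).integral_prod_right

lemma memLp_add_left (v : L2) (x : E3) : MemLp (fun y => v (x + y)) 2 volume :=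
  (Lp.memLp v).comp_measurePreserving (measurePreserving_add_left volume x)

lemma memLp_add_left_ballProb {δ : ℝ} (hδ : 0 < δ) (v : L2) (x : E3) :
    MemLp (fun y => v (x + y)) 2 (ballProb δ) :=
  ((memLp_add_left v x).restrict _).smul_measure
    (ENNReal.inv_ne_top.2 (Metric.measure_ball_pos volume 0 hδ).ne')

/-- Jensen's inequality for the uniform probability measure on the ball. -/
lemma enorm_sub_ballAvg_sq_le {δ : ℝ} (hδ : 0 < δ) (v : L2) (x : E3) :
    ‖v x - ballAvg δ v x‖ₑ ^ 2 ≤ ∫⁻ y, ‖v x - v (x + y)‖ₑ ^ 2 ∂ballProb δ := by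
  have := isProbabilityMeasure_ballProb hδ
  have hm := memLp_add_left_ballProb hδ v x
  have hi : Integrable (fun y => v (x + y)) (ballProb δ) := hm.integrable (by norm_num)
  have e : v x - ballAvg δ v x = ∫ y, (v x - v (x + y)) ∂ballProb δ := by
    rw [integral_sub (integrable_const _) hi]; simp [ballAvg]
  have hm' : AEStronglyMeasurable (fun y => v x - v (x + y)) (ballProb δ) :=
    aestronglyMeasurable_const.sub hm.1
  have h1 : ‖v x - ballAvg δ v x‖ₑ ≤ eLpNorm (fun y => v x - v (x + y)) 2 (ballProb δ) := by
    rw [e]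
    refine (enorm_integral_le_lintegral_enorm _).trans ?_
    rw [← eLpNorm_one_eq_lintegral_enorm]
    exact eLpNorm_le_eLpNorm_of_exponent_le (by norm_num) hm'
  calc _ ≤ eLpNorm (fun y => v x - v (x + y)) 2 (ballProb δ) ^ 2 := by gcongr
    _ = _ := by
      rw [eLpNorm_eq_lintegral_rpow_enorm_toReal (by norm_num) (by simp), ← ENNReal.rpow_natCast,
        ← ENNReal.rpow_mul]
      simp

/-- After exchanging the integrals, each `y` in the ball contributes the squared `L²` distance from
`v` to its translate by `y`, at most `(δ * gradSum v) ^ 2`. -/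
lemma lintegral_sub_ballAvg_le {δ : ℝ} (hδ : 0 < δ) {v : L2} (hv : MemHDotOne v) :
    ∫⁻ x, ‖v x - ballAvg δ v x‖ₑ ^ 2 ≤ ENNReal.ofReal ((δ * gradSum v) ^ 2) := by
  have := isProbabilityMeasure_ballProb hδ
  have hmeas : StronglyMeasurable fun p : E3 × E3 => v p.1 - v (p.1 + p.2) :=
    ((Lp.stronglyMeasurable v).comp_measurable measurable_fst).sub (stronglyMeasurable_add v)
  calc ∫⁻ x, ‖v x - ballAvg δ v x‖ₑ ^ 2
      ≤ ∫⁻ x, ∫⁻ y, ‖v x - v (x + y)‖ₑ ^ 2 ∂ballProb δ :=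
        lintegral_mono fun x => enorm_sub_ballAvg_sq_le hδ v x
    _ = ∫⁻ y, (∫⁻ x, ‖v x - v (x + y)‖ₑ ^ 2) ∂ballProb δ :=
        lintegral_lintegral_swap (hmeas.enorm.pow_const 2).aemeasurable
    _ ≤ ∫⁻ _y, ENNReal.ofReal ((δ * gradSum v) ^ 2) ∂ballProb δ := by
        refine lintegral_mono_ae ?_
        have hb : ∀ᵐ y ∂ballProb δ, y ∈ Metric.ball (0 : E3) δ :=
          Measure.ae_smul_measure (ae_restrict_mem measurableSet_ball) _
        filter_upwards [hb] with y hy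
        have h1 : ‖v - trans y v‖ ≤ δ * gradSum v := by
          rw [norm_sub_rev]
          refine (norm_trans_sub_le hv y).trans ?_
          have : ‖y‖ ≤ δ := by simpa using (Metric.mem_ball.1 hy).le
          exact mul_le_mul_of_nonneg_right this (gradSum_nonneg v)
        have h2 : ∫⁻ x, ‖v x - v (x + y)‖ₑ ^ 2 = ENNReal.ofReal (‖v - trans y v‖ ^ 2) := by
          rw [ENNReal.ofReal_pow (norm_nonneg _), ← eLpNorm_coeFn,
            eLpNorm_eq_lintegral_rpow_enorm_toReal (by norm_num) (by simp), ← ENNReal.rpow_natCast,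
            ← ENNReal.rpow_mul]
          simp only [ENNReal.toReal_ofNat, ENNReal.rpow_ofNat, one_div, Nat.cast_ofNat,
            isUnit_iff_ne_zero, ne_eq, OfNat.ofNat_ne_zero, not_false_eq_true,
            IsUnit.inv_mul_cancel, ENNReal.rpow_one]
          refine lintegral_congr_ae ?_
          filter_upwards [Lp.coeFn_sub v (trans y v), coeFn_trans y v] with x h1 h2
          rw [h1, Pi.sub_apply, h2]
        rw [h2]
        gcongr
    _ = _ := by simp

/-- The square of the `L²` norm on a ball. -/
def locSq (R : ℝ) (v : L2) : ℝ := ∫ x in Metric.ball (0 : E3) R, ‖v x‖ ^ 2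

/-- The square of the `L²` norm of the local averages on a ball. -/
def avgSq (δ R : ℝ) (v : L2) : ℝ := ∫ x in Metric.ball (0 : E3) R, ‖ballAvg δ v x‖ ^ 2

instance (R : ℝ) : IsFiniteMeasure ((volume : Measure E3).restrict (Metric.ball 0 R)) :=
  isFiniteMeasure_restrict.2 measure_ball_lt_top.ne

lemma avgSq_nonneg (δ R : ℝ) (v : L2) : 0 ≤ avgSq δ R v := by unfold avgSq; positivity

/-- The averaging kernel. -/
def ballKernel (δ : ℝ) (x : E3) (i : Fin 3) : L2 :=
  toL2 fun y => ((Metric.ball x δ).indicator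
    (fun _ => (volume.real (Metric.ball (0 : E3) δ))⁻¹) y) • basisVec i

lemma memLp_ballKernel (δ : ℝ) (x : E3) : MemLp ((Metric.ball x δ).indicator
    (fun _ : E3 => (volume.real (Metric.ball (0 : E3) δ))⁻¹)) 2 volume :=
  memLp_indicator_const 2 measurableSet_ball _ (Or.inr measure_ball_lt_top.ne)

/-- Each value of the local average is a pairing with a fixed `L²` kernel. Weak convergence
therefore gives pointwise convergence of the averages, the source of all compactness here. -/
lemma ballAvg_apply {δ : ℝ} (hδ : 0 < δ) (v : L2) (x : E3) (i : Fin 3) :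
    ballAvg δ v x i = inner ℝ v (ballKernel δ x i) := by
  have := isProbabilityMeasure_ballProb hδ
  have hi : Integrable (fun y => v (x + y)) (ballProb δ) :=
    (memLp_add_left_ballProb hδ v x).integrable (by norm_num)
  have h1 : ballAvg δ v x i = ∫ y, v (x + y) i ∂ballProb δ :=
    ((EuclideanSpace.proj i : E3 →L[ℝ] ℝ).integral_comp_comm hi).symm
  rw [h1, ballKernel, inner_smul_basisVec v (memLp_ballKernel δ x), ballProb,
    integral_smul_measure, ENNReal.toReal_inv]
  rw [← integral_add_left_eq_self (μ := (volume : Measure E3)) _ x]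
  have h2 : ∀ y, v (x + y) i * (Metric.ball x δ).indicator
      (fun _ => (volume.real (Metric.ball (0 : E3) δ))⁻¹) (x + y)
      = (Metric.ball (0 : E3) δ).indicator
        (fun y => (volume.real (Metric.ball (0 : E3) δ))⁻¹ * v (x + y) i) y := by
    intro y
    by_cases hy : y ∈ Metric.ball (0 : E3) δ
    · have : x + y ∈ Metric.ball x δ := by simpa using hy
      simp only [indicator_of_mem this, indicator_of_mem hy]; ring
    · have : x + y ∉ Metric.ball x δ := by simpa using hy
      simp only [indicator_of_notMem this, indicator_of_notMem hy, mul_zero]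
  simp only [h2]
  rw [integral_indicator measurableSet_ball, integral_const_mul]
  rfl

lemma exists_norm_ballAvg_le {δ : ℝ} (hδ : 0 < δ) :
    ∃ C : ℝ, 0 ≤ C ∧ ∀ (v : L2) (x : E3), ‖ballAvg δ v x‖ ≤ C * ‖v‖ := by
  have := isProbabilityMeasure_ballProb hδ
  have hne : (volume (Metric.ball (0 : E3) δ))⁻¹ ≠ ⊤ :=
    ENNReal.inv_ne_top.2 (Metric.measure_ball_pos volume 0 hδ).ne'
  let c : ENNReal := (volume (Metric.ball (0 : E3) δ))⁻¹ ^ ((1 : ℝ) / (2 : ENNReal).toReal)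
  have hc : c ≠ ⊤ := ENNReal.rpow_ne_top_of_nonneg (by simp) hne
  refine ⟨c.toReal, ENNReal.toReal_nonneg, fun v x => ?_⟩
  have hm := memLp_add_left_ballProb hδ v x
  have h1 : ‖ballAvg δ v x‖ₑ ≤ c * ENNReal.ofReal ‖v‖ := by
    calc ‖ballAvg δ v x‖ₑ ≤ ∫⁻ y, ‖v (x + y)‖ₑ ∂ballProb δ := enorm_integral_le_lintegral_enorm _
      _ = eLpNorm (fun y => v (x + y)) 1 (ballProb δ) := by
        rw [eLpNorm_one_eq_lintegral_enorm]
      _ ≤ eLpNorm (fun y => v (x + y)) 2 (ballProb δ) :=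
        eLpNorm_le_eLpNorm_of_exponent_le (by norm_num) hm.1
      _ = c * eLpNorm (fun y => v (x + y)) 2 (volume.restrict (Metric.ball (0 : E3) δ)) := by
        rw [ballProb, eLpNorm_smul_measure_of_ne_top (by simp)]
        simp [c]
      _ ≤ c * eLpNorm (fun y => v (x + y)) 2 volume := by
        gcongr; exact Measure.restrict_le_self
      _ = c * ENNReal.ofReal ‖v‖ := by
        rw [← eLpNorm_coeFn]
        congr 1
        exact eLpNorm_comp_measurePreserving (Lp.aestronglyMeasurable v)
          (measurePreserving_add_left volume x)
  have h2 := ENNReal.toReal_mono (ENNReal.mul_ne_top hc ENNReal.ofReal_ne_top) h1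
  rwa [ENNReal.toReal_mul, ENNReal.toReal_ofReal (norm_nonneg _), toReal_enorm] at h2

lemma memLp_ballAvg {δ : ℝ} (hδ : 0 < δ) (R : ℝ) (v : L2) :
    MemLp (ballAvg δ v) 2 (volume.restrict (Metric.ball (0 : E3) R)) := by
  obtain ⟨C, -, hC⟩ := exists_norm_ballAvg_le hδ
  exact MemLp.of_bound (stronglyMeasurable_ballAvg δ v).aestronglyMeasurable (C * ‖v‖)
    (Eventually.of_forall (hC v))

lemma exists_avgSq_le {δ : ℝ} (hδ : 0 < δ) (R : ℝ) :
    ∃ C : ℝ, 0 ≤ C ∧ ∀ v : L2, avgSq δ R v ≤ C * ‖v‖ ^ 2 := by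
  obtain ⟨C, hC0, hC⟩ := exists_norm_ballAvg_le hδ
  refine ⟨volume.real (Metric.ball (0 : E3) R) * C ^ 2, by positivity, fun v => ?_⟩
  calc avgSq δ R v ≤ ∫ x in Metric.ball (0 : E3) R, (C * ‖v‖) ^ 2 := by
        refine integral_mono ((memLp_ballAvg hδ R v).integrable_norm_pow (by norm_num))
          (integrable_const _) fun x => ?_
        exact pow_le_pow_left₀ (norm_nonneg _) (hC v x) 2
    _ = _ := by rw [setIntegral_const, smul_eq_mul]; ring

/-- Weakly convergent bounded sequences have strongly convergent local averages. -/
lemma tendsto_avgSq {δ : ℝ} (hδ : 0 < δ) (R : ℝ) {x : ℕ → L2} {v : L2} {M : ℝ}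
    (hM : ∀ n, ‖x n‖ ≤ M) (h : ∀ a, Tendsto (fun n => inner ℝ (x n) a) atTop (𝓝 (inner ℝ v a))) :
    Tendsto (fun n => avgSq δ R (x n)) atTop (𝓝 (avgSq δ R v)) := by
  obtain ⟨C, hC0, hC⟩ := exists_norm_ballAvg_le hδ
  refine tendsto_integral_of_dominated_convergence (fun _ => (C * M) ^ 2)
    (fun n => ((stronglyMeasurable_ballAvg δ (x n)).norm.pow 2).aestronglyMeasurable)
    (integrable_const _) (fun n => Eventually.of_forall fun y => ?_)
    (Eventually.of_forall fun y => ?_)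
  · rw [Real.norm_eq_abs, abs_of_nonneg (by positivity)]
    exact pow_le_pow_left₀ (norm_nonneg _) ((hC _ y).trans (by gcongr; exact hM n)) 2
  · have hl : Tendsto (fun n => ∑ i, ballAvg δ (x n) y i ^ 2) atTop
        (𝓝 (∑ i, ballAvg δ v y i ^ 2)) := by
      simp only [ballAvg_apply hδ]
      exact tendsto_finsetSum _ fun i _ => (h _).pow 2
    simpa only [EuclideanSpace.norm_sq_eq, Real.norm_eq_abs, sq_abs] using hl

lemma continuous_avgSq {δ : ℝ} (hδ : 0 < δ) (R : ℝ) : Continuous (avgSq δ R) := by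
  refine continuous_iff_seqContinuous.2 fun x v hx => ?_
  obtain ⟨M, hM⟩ := hx.norm.bddAbove_range
  exact tendsto_avgSq hδ R (M := M) (fun n => hM ⟨n, rfl⟩)
    fun a => hx.inner tendsto_const_nhds

lemma integrableOn_norm_sq (R : ℝ) (v : L2) :
    IntegrableOn (fun x => ‖v x‖ ^ 2) (Metric.ball (0 : E3) R) volume :=
  ((Lp.memLp v).integrable_norm_pow (by norm_num)).integrableOn

/-- A local compactness estimate: up to a small multiple of the gradient, a field is controlled on
a ball by its local averages. -/
lemma locSq_le {δ : ℝ} (hδ : 0 < δ) (R : ℝ) {v : L2} (hv : MemHDotOne v) :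
    locSq R v ≤ 2 * (δ * gradSum v) ^ 2 + 2 * avgSq δ R v := by
  have h1 := lintegral_sub_ballAvg_le hδ hv
  have hm := memLp_ballAvg hδ R v
  have hmv : MemLp v 2 (volume.restrict (Metric.ball (0 : E3) R)) := (Lp.memLp v).restrict _
  have hmd : MemLp (fun x => v x - ballAvg δ v x) 2 (volume.restrict (Metric.ball (0 : E3) R)) :=
    hmv.sub hm
  have hid : Integrable (fun x => ‖v x - ballAvg δ v x‖ ^ 2)
      (volume.restrict (Metric.ball (0 : E3) R)) := hmd.integrable_norm_pow (by norm_num)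
  have h2 : ∫ x in Metric.ball (0 : E3) R, ‖v x - ballAvg δ v x‖ ^ 2 ≤ (δ * gradSum v) ^ 2 := by
    rw [integral_eq_lintegral_of_nonneg_ae (Eventually.of_forall fun x => by positivity) hid.1]
    refine ENNReal.toReal_le_of_le_ofReal (by positivity) (le_trans ?_ h1)
    refine le_trans (lintegral_mono fun x => ?_) (setLIntegral_le_lintegral _ _)
    rw [ENNReal.ofReal_pow (norm_nonneg _), ofReal_norm]
  calc locSq R v ≤ ∫ x in Metric.ball (0 : E3) R,
        (2 * ‖v x - ballAvg δ v x‖ ^ 2 + 2 * ‖ballAvg δ v x‖ ^ 2) := by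
        refine integral_mono (integrableOn_norm_sq R v)
          ((hid.const_mul 2).add ((hm.integrable_norm_pow (by norm_num)).const_mul 2)) fun x => ?_
        have h3 : ‖v x‖ ≤ ‖v x - ballAvg δ v x‖ + ‖ballAvg δ v x‖ := by
          simpa using norm_add_le (v x - ballAvg δ v x) (ballAvg δ v x)
        have h4 := pow_le_pow_left₀ (norm_nonneg _) h3 2
        simp only
        nlinarith [sq_nonneg (‖v x - ballAvg δ v x‖ - ‖ballAvg δ v x‖)]
    _ = 2 * (∫ x in Metric.ball (0 : E3) R, ‖v x - ballAvg δ v x‖ ^ 2) + 2 * avgSq δ R v := by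
        rw [integral_add (hid.const_mul 2) ((hm.integrable_norm_pow (by norm_num)).const_mul 2),
          integral_const_mul, integral_const_mul]
        rfl
    _ ≤ _ := by gcongr

/-! ### Global solutions of dissipative ordinary differential equations -/

section ODE

variable {V : Type*} [NormedAddCommGroup V] [InnerProductSpace ℝ V]

/-- Grönwall's argument: the derivative of `‖x‖² + m²` is at most `2m‖x‖`, hence at most `‖x‖² +
m²`. -/
lemma norm_sq_add_le_of_dissipative {G : V → V} {m T : ℝ}
    (hm : ∀ x, inner ℝ (G x) x ≤ m * ‖x‖) {x : ℝ → V}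
    (hx : ∀ t ∈ Icc 0 T, HasDerivWithinAt x (G (x t)) (Icc 0 T) t) {t : ℝ} (ht : t ∈ Icc 0 T) :
    ‖x t‖ ^ 2 + m ^ 2 ≤ (‖x 0‖ ^ 2 + m ^ 2) * Real.exp t := by
  have hT : (0 : ℝ) ≤ T := ht.1.trans ht.2
  let h : ℝ → ℝ := fun t => (‖x t‖ ^ 2 + m ^ 2) * Real.exp (-t)
  have hder : ∀ s ∈ Icc 0 T, HasDerivWithinAt h
      ((2 * inner ℝ (x s) (G (x s))) * Real.exp (-s)
        + (‖x s‖ ^ 2 + m ^ 2) * (Real.exp (-s) * -1)) (Icc 0 T) s := fun s hs =>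
    ((hx s hs).norm_sq.add_const _).mul ((hasDerivAt_neg s).exp.hasDerivWithinAt)
  have hanti : AntitoneOn h (Icc 0 T) := by
    refine antitoneOn_of_deriv_nonpos (convex_Icc 0 T) (fun s hs => (hder s hs).continuousWithinAt)
      (fun s hs => ?_) fun s hs => ?_
    · exact ((hder s (interior_subset hs)).mono interior_subset).differentiableWithinAt
    · rw [interior_Icc] at hs
      rw [((hder s (Ioo_subset_Icc_self hs)).hasDerivAt (Icc_mem_nhds hs.1 hs.2)).deriv]
      have h1 := hm (x s)
      rw [real_inner_comm] at h1
      have h2 : 2 * inner ℝ (x s) (G (x s)) - (‖x s‖ ^ 2 + m ^ 2) ≤ 0 := by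
        nlinarith [sq_nonneg (‖x s‖ - m)]
      have h3 := (Real.exp_pos (-s)).le
      nlinarith
  have := hanti (left_mem_Icc.2 hT) ht ht.1
  simp only [h, neg_zero, Real.exp_zero, mul_one] at this
  rwa [Real.exp_neg, ← div_eq_mul_inv, div_le_iff₀ (Real.exp_pos t)] at this

/-- The field is cut off outside a large ball so that Picard–Lindelöf applies on all of `[0, T]`.
The cutoff preserves the dissipativity bound, so the a priori estimate keeps the solution where
nothing was changed. -/
lemma exists_solution_of_dissipative [FiniteDimensional ℝ V] {G : V → V} (hG : ContDiff ℝ 1 G)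
    {m : ℝ} (hm0 : 0 ≤ m) (hm : ∀ x, inner ℝ (G x) x ≤ m * ‖x‖) (x₀ : V) {T : ℝ} (hT : 0 ≤ T) :
    ∃ x : ℝ → V, Continuous x ∧ x 0 = x₀ ∧
      ∀ t ∈ Icc 0 T, HasDerivWithinAt x (G (x t)) (Icc 0 T) t := by
  have : CompleteSpace V := FiniteDimensional.complete ℝ V
  set R : ℝ := √((‖x₀‖ ^ 2 + m ^ 2) * Real.exp T) + 1 with hR
  have hR0 : 0 < R := by positivity
  let b : ContDiffBump (0 : V) := ⟨R, R + 1, hR0, by linarith⟩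
  let G' : V → V := fun x => b x • G x
  have hcs : HasCompactSupport G' := b.hasCompactSupport.smul_right
  have hG' : ContDiff ℝ 1 G' := b.contDiff.smul hG
  obtain ⟨K, hK⟩ := ContDiff.lipschitzWith_of_hasCompactSupport hcs hG' (by simp)
  obtain ⟨L, hL⟩ := hcs.exists_bound_of_continuous hG'.continuous
  have hL0 : 0 ≤ L := (norm_nonneg _).trans (hL 0)
  have hm' : ∀ x, inner ℝ (G' x) x ≤ m * ‖x‖ := by
    intro x
    simp only [G', real_inner_smul_left]
    have h1 := b.nonneg (x := x)
    have h2 := b.le_one (x := x)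
    have h3 : 0 ≤ m * ‖x‖ := by positivity
    calc b x * inner ℝ (G x) x ≤ b x * (m * ‖x‖) := by gcongr; exact hm x
      _ ≤ 1 * (m * ‖x‖) := by gcongr
      _ = _ := one_mul _
  -- The field `G'` is globally Lipschitz and bounded by `L`, so a ball of radius `L * T` is large
  -- enough for the whole interval.
  have hpl : IsPicardLindelof (fun _ => G') (⟨0, left_mem_Icc.2 hT⟩ : Icc (0 : ℝ) T) x₀
      (L.toNNReal * T.toNNReal) 0 L.toNNReal K := by
    refine ⟨fun t _ => hK.lipschitzOnWith, fun x _ => continuousOn_const, fun t _ x _ => ?_, ?_⟩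
    · rw [Real.coe_toNNReal _ hL0]; exact hL x
    · simp [hT]
  obtain ⟨x, hx0, hx⟩ := hpl.exists_eq_forall_mem_Icc_hasDerivWithinAt₀
  simp only at hx0
  have hbd : ∀ t ∈ Icc 0 T, G' (x t) = G (x t) := by
    intro t ht
    have h1 := norm_sq_add_le_of_dissipative hm' hx ht
    have h2 : ‖x t‖ ^ 2 ≤ (‖x₀‖ ^ 2 + m ^ 2) * Real.exp T := by
      rw [hx0] at h1
      have := Real.exp_le_exp.2 ht.2
      have h3 : 0 ≤ ‖x₀‖ ^ 2 + m ^ 2 := by positivity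
      nlinarith [sq_nonneg m]
    have h3 : ‖x t‖ ≤ R := by
      rw [hR]
      have := Real.abs_le_sqrt h2
      rw [abs_of_nonneg (norm_nonneg _)] at this
      linarith
    have h4 : b (x t) = 1 := b.one_of_mem_closedBall (by simpa [b] using h3)
    simp [G', h4]
  have hproj : ∀ t ∈ Icc 0 T, (projIcc 0 T hT t : ℝ) = t := fun t ht => by
    rw [projIcc_of_mem hT ht]
  have hxc : ContinuousOn x (Icc 0 T) := fun t ht => (hx t ht).continuousWithinAt
  -- Freezing the curve outside `[0, T]` makes it continuous on the whole line without changing the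
  -- equation inside.
  refine ⟨fun t => x (projIcc 0 T hT t), ?_, ?_, fun t ht => ?_⟩
  · exact hxc.comp_continuous (continuous_subtype_val.comp continuous_projIcc) fun t => (projIcc 0 T hT t).2
  · simp only [hproj 0 (left_mem_Icc.2 hT), hx0]
  · simp only [hproj t ht]
    rw [← hbd t ht]
    exact (hx t ht).congr (fun s hs => by simp only [hproj s hs]) (by simp only [hproj t ht])

end ODE

/-! ### Galerkin approximations -/

/-- The weak form of the right hand side of the momentum equation. -/
def nsForm (ν β : ℝ) (f v w : L2) : ℝ :=
  ∑ j, inner ℝ (prodF j v v - ν • weakPartial j v) (weakPartial j w) + inner ℝ (f - β • v) w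

/-- The weak form, as a linear functional of the test field. -/
def nsLin (ν β : ℝ) (f v : L2) : solenoidalOne →ₗ[ℝ] ℝ :=
  ∑ j, (innerₗ L2 (prodF j v v - ν • weakPartial j v)).comp (wpd j)
    + (innerₗ L2 (f - β • v)).comp solenoidalOne.subtype

lemma nsLin_apply (ν β : ℝ) (f v : L2) (w : solenoidalOne) :
    nsLin ν β f v w = nsForm ν β f v w := by
  simp [nsLin, nsForm, wpd_apply, LinearMap.sum_apply, inner_sub_left, real_inner_smul_left]

lemma nsForm_self (ν β : ℝ) (f : L2) {v : L2} (hv : v ∈ solenoidalOne) :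
    nsForm ν β f v v = - ν * hDotOneSq v + inner ℝ f v - β * ‖v‖ ^ 2 := by
  have h := sum_inner_prodF_self hv.1 hv.2 hv.2
  simp only [nsForm, inner_sub_left, Finset.sum_sub_distrib, h, real_inner_smul_left,
    real_inner_self_eq_norm_sq, ← Finset.mul_sum, hDotOneSq]
  ring

lemma continuous_nsForm (ν β : ℝ) (f : L2) {x y : ℝ → L2} (hx : Continuous x)
    (hd : ∀ j, Continuous fun t => weakPartial j (x t))
    (hp : ∀ j, Continuous fun t => prodF j (x t) (x t)) (hy : Continuous y)
    (hyd : ∀ j, Continuous fun t => weakPartial j (y t)) :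
    Continuous fun t => nsForm ν β f (x t) (y t) := by
  refine Continuous.add (continuous_finsetSum _ fun j _ => ?_) ?_
  · exact ((hp j).sub ((hd j).const_smul ν)).inner (hyd j)
  · exact (continuous_const.sub (hx.const_smul β)).inner hy

section FiniteDimensional

variable {W : Submodule ℝ L2} [FiniteDimensional ℝ W]

lemma contDiff_weakPartial_coe (hW : W ≤ solenoidalOne) (j : Fin 3) :
    ContDiff ℝ 1 fun x : W => weakPartial j (x : L2) :=
  (LinearMap.toContinuousLinearMap ((wpd j).comp (Submodule.inclusion hW))).contDiff

lemma contDiff_prodF_coe (hW : W ≤ solenoidalOne) (j : Fin 3) :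
    ContDiff ℝ 1 fun x : W => prodF j (x : L2) (x : L2) := by
  let P : W →L[ℝ] W →L[ℝ] L2 := LinearMap.toContinuousBilinearMap
    ((prodL j).compl₁₂ (Submodule.inclusion hW) (Submodule.inclusion hW))
  exact P.isBoundedBilinearMap.contDiff.comp (contDiff_id.prodMk contDiff_id)

lemma contDiff_nsForm_coe (ν β : ℝ) (f w : L2) (hW : W ≤ solenoidalOne) :
    ContDiff ℝ 1 fun x : W => nsForm ν β f (x : L2) w := by
  refine ContDiff.add (ContDiff.sum fun j _ => ?_) ?_
  · exact ContDiff.inner ℝ ((contDiff_prodF_coe hW j).sub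
      ((contDiff_weakPartial_coe hW j).const_smul ν)) contDiff_const
  · exact ContDiff.inner ℝ (contDiff_const.sub (W.subtypeL.contDiff.const_smul β)) contDiff_const

/-- Riesz representation in an orthonormal basis of `W`. The coefficients are polynomial in the
unknown, hence smooth. -/
lemma exists_nsField (ν β : ℝ) (f : L2) (hW : W ≤ solenoidalOne) :
    ∃ G : W → W, ContDiff ℝ 1 G ∧
      ∀ x w : W, inner ℝ (G x : L2) (w : L2) = nsForm ν β f (x : L2) (w : L2) := by
  let b := stdOrthonormalBasis ℝ W
  refine ⟨fun x => ∑ l, nsForm ν β f (x : L2) (b l : L2) • b l, ?_, fun x w => ?_⟩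
  · exact ContDiff.sum fun l _ => (contDiff_nsForm_coe ν β f (b l : L2) hW).smul_const (b l)
  · have e : ∀ y : W, nsForm ν β f (x : L2) (y : L2)
        = (nsLin ν β f (x : L2)).comp (Submodule.inclusion hW) y :=
      fun y => (nsLin_apply ν β f (x : L2) (Submodule.inclusion hW y)).symm
    rw [← Submodule.coe_inner, e w]
    conv_rhs => rw [← b.sum_repr' w]
    rw [map_sum, sum_inner]
    refine Finset.sum_congr rfl fun l _ => ?_
    rw [map_smul, real_inner_smul_left, smul_eq_mul, mul_comm, e (b l)]

lemma exists_projection (W : Submodule ℝ L2) [FiniteDimensional ℝ W] (u₀ : L2) :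
    ∃ x₀ : W, ‖(x₀ : L2)‖ ≤ ‖u₀‖ ∧ ∀ w ∈ W, inner ℝ (x₀ : L2) w = inner ℝ u₀ w := by
  have : CompleteSpace W := FiniteDimensional.complete ℝ W
  refine ⟨⟨W.starProjection u₀, W.starProjection_apply_mem u₀⟩, W.norm_starProjection_apply_le u₀,
    fun w hw => ?_⟩
  have := Submodule.starProjection_inner_eq_zero u₀ w hw
  rw [inner_sub_left] at this
  simp only
  linarith

end FiniteDimensional

/-- The weak form restricted to `W` is a vector field whose radial component is at most `‖f‖ ‖x‖`,
since transport cancels and viscosity and damping only dissipate. Testing the equation with `x`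
itself gives an energy equality. -/
lemma exists_galerkin {ν β : ℝ} (hν : 0 < ν) (hβ : 0 < β) (u₀ f : L2)
    {W : Submodule ℝ L2}
    (hW : W ≤ solenoidalOne) [FiniteDimensional ℝ W] {T : ℝ} (hT : 0 ≤ T) :
    ∃ x : ℝ → L2, (∀ t, x t ∈ solenoidalOne) ∧ Continuous x ∧
      (∀ j, Continuous fun t => weakPartial j (x t)) ∧
      (∀ j, Continuous fun t => prodF j (x t) (x t)) ∧
      ‖x 0‖ ≤ ‖u₀‖ ∧ (∀ w ∈ W, inner ℝ (x 0) w = inner ℝ u₀ w) ∧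
      (∀ w ∈ W, ∀ s ∈ Icc 0 T, ∀ t ∈ Icc 0 T, inner ℝ (x t) w - inner ℝ (x s) w
        = ∫ r in s..t, nsForm ν β f (x r) w) ∧
      ∀ t ∈ Icc 0 T, ‖x t‖ ^ 2 = ‖x 0‖ ^ 2 + ∫ r in (0 : ℝ)..t, 2 * nsForm ν β f (x r) (x r) := by
  obtain ⟨G, hG, hGi⟩ := exists_nsField ν β f hW
  obtain ⟨x₀, hx₀n, hx₀⟩ := exists_projection W u₀
  have hdis : ∀ x : W, inner ℝ (G x) x ≤ ‖f‖ * ‖x‖ := by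
    intro x
    rw [Submodule.coe_inner, hGi, nsForm_self ν β f (hW x.2), Submodule.coe_norm]
    have h1 := real_inner_le_norm f (x : L2)
    have h3 := hDotOneSq_nonneg (x : L2)
    nlinarith [mul_nonneg hν.le h3, mul_nonneg hβ.le (sq_nonneg ‖(x : L2)‖)]
  obtain ⟨x, hxc, hx0, hx⟩ := exists_solution_of_dissipative hG (norm_nonneg f) hdis x₀ hT
  have hxι : Continuous fun t => (x t : L2) := continuous_subtype_val.comp hxc
  have hcd : ∀ j, Continuous fun t => weakPartial j ((x t : L2)) := fun j =>
    (contDiff_weakPartial_coe hW j).continuous.comp hxc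
  have hcp : ∀ j, Continuous fun t => prodF j ((x t : L2)) ((x t : L2)) := fun j =>
    (contDiff_prodF_coe hW j).continuous.comp hxc
  have hder : ∀ t ∈ Icc 0 T, HasDerivWithinAt (fun t => (x t : L2)) ((G (x t) : L2)) (Icc 0 T) t :=
    fun t ht => W.subtypeL.hasFDerivAt.comp_hasDerivWithinAt t (hx t ht)
  refine ⟨fun t => (x t : L2), fun t => hW (x t).2, hxι, hcd, hcp, ?_, ?_, ?_, ?_⟩
  · simpa only [hx0] using hx₀n
  · simpa only [hx0] using hx₀
  · intro w hw s hs t ht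
    have hsub : uIcc s t ⊆ Icc 0 T := uIcc_subset_Icc hs ht
    refine (intervalIntegral.integral_eq_sub_of_hasDeriv_right
      (f := fun t => inner ℝ ((x t : L2)) w) ?_ ?_ ?_).symm
    · exact (hxι.inner continuous_const).continuousOn
    · intro r hr
      have hr' : r ∈ Icc 0 T := hsub (Ioo_subset_Icc_self hr)
      have hrT : r ∈ Ioo 0 T := ⟨lt_of_le_of_lt (le_min hs.1 ht.1) hr.1,
        lt_of_lt_of_le hr.2 (max_le hs.2 ht.2)⟩
      have h1 := ((hder r hr').hasDerivAt (Icc_mem_nhds hrT.1 hrT.2)).inner ℝ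
        (hasDerivAt_const r w)
      rw [inner_zero_right, zero_add] at h1
      have h2 := hGi (x r) ⟨w, hw⟩
      rw [← h2]
      exact h1.hasDerivWithinAt
    · exact (continuous_nsForm ν β f hxι hcd hcp continuous_const
        fun j => continuous_const).intervalIntegrable _ _
  · intro t ht
    have h := intervalIntegral.integral_eq_sub_of_hasDeriv_right (a := 0) (b := t)
      (f := fun t => ‖(x t : L2)‖ ^ 2)
      (f' := fun r => 2 * nsForm ν β f ((x r : L2)) ((x r : L2))) ?_ ?_ ?_
    · rw [h]; ring
    · exact (hxι.norm.pow 2).continuousOn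
    · intro r hr
      rw [min_eq_left ht.1, max_eq_right ht.1] at hr
      have hrT : r ∈ Ioo 0 T := ⟨hr.1, hr.2.trans_le ht.2⟩
      have h1 := ((hder r (Ioo_subset_Icc_self hrT)).hasDerivAt
        (Icc_mem_nhds hrT.1 hrT.2)).norm_sq
      rw [real_inner_comm, hGi] at h1
      exact h1.hasDerivWithinAt
    · exact ((continuous_nsForm ν β f hxι hcd hcp hxι hcd).const_mul 2).intervalIntegrable _ _

/-! ### Extraction of weakly convergent subsequences -/

section Weak

variable {E : Type*} [NormedAddCommGroup E] [InnerProductSpace ℝ E]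

lemma norm_le_of_weak_limit {ι : Type*} {l : Filter ι} [l.NeBot] {y : ι → E} {v : E} {M : ℝ}
    (hM : ∀ᶠ n in l, ‖y n‖ ≤ M) (h : Tendsto (fun n => inner ℝ (y n) v) l (𝓝 (inner ℝ v v))) :
    ‖v‖ ≤ M := by
  have h1 : inner ℝ v v ≤ M * ‖v‖ := by
    refine le_of_tendsto h ?_
    filter_upwards [hM] with n hn
    exact (real_inner_le_norm _ _).trans (by gcongr)
  rw [real_inner_self_eq_norm_sq] at h1
  rcases (norm_nonneg v).eq_or_lt with h0 | h0
  · rw [← h0]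
    obtain ⟨n, hn⟩ := hM.exists
    exact (norm_nonneg _).trans hn
  · nlinarith

/-- The limits of the pairings define a bounded linear functional, which Riesz's theorem represents
by a vector. -/
lemma exists_weak_limit_of_cauchySeq [CompleteSpace E] {y : ℕ → E} {M : ℝ}
    (hM : ∀ᶠ n in atTop, ‖y n‖ ≤ M) (h : ∀ a, CauchySeq fun n => inner ℝ (y n) a) :
    ∃ v : E, ∀ a, Tendsto (fun n => inner ℝ (y n) a) atTop (𝓝 (inner ℝ v a)) := by
  choose L hL using fun a => cauchySeq_tendsto_of_complete (h a)
  let F : E →ₗ[ℝ] ℝ := linearMapOfTendsto L (fun n => innerₗ E (y n)) (l := atTop)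
    (tendsto_pi_nhds.2 hL)
  have hF : ∀ a, ‖F a‖ ≤ M * ‖a‖ := by
    intro a
    refine le_of_tendsto (hL a).norm ?_
    filter_upwards [hM] with n hn
    exact (norm_inner_le_norm (𝕜 := ℝ) _ _).trans (by gcongr)
  refine ⟨(InnerProductSpace.toDual ℝ E).symm (F.mkContinuous M hF), fun a => ?_⟩
  rw [InnerProductSpace.toDual_symm_apply]
  exact hL a

lemma abs_inner_sub_le (y a b : E) {M : ℝ} (hM : ‖y‖ ≤ M) :
    |inner ℝ y a - inner ℝ y b| ≤ M * ‖a - b‖ := by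
  rw [← inner_sub_right]
  exact (abs_real_inner_le_norm _ _).trans (by gcongr)

lemma inner_starProjection_of_mem {K : Submodule ℝ E} [K.HasOrthogonalProjection] {y : E}
    (hy : y ∈ K) (a : E) : inner ℝ y (K.starProjection a) = inner ℝ y a := by
  rw [← Submodule.inner_starProjection_left_eq_right, Submodule.starProjection_eq_self_iff.2 hy]

/-- Diagonal extraction, carried out as sequential compactness of a countable product of intervals.
-/
lemma exists_subseq_countable {ι : Type*} [Countable ι] (c : ℕ → ι → ℝ) (B : ι → ℝ)
    (hB : ∀ i, ∀ᶠ n in atTop, |c n i| ≤ B i) :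
    ∃ φ : ℕ → ℕ, StrictMono φ ∧ ∃ l : ι → ℝ, ∀ i, Tendsto (fun n => c (φ n) i) atTop (𝓝 (l i)) := by
  -- The bounds hold only eventually, at a rank depending on `i`; the truncated coefficients lie in
  -- the box for every `n` and eventually agree with the original ones.
  let d : ℕ → ι → ℝ := fun n i => if |c n i| ≤ B i then c n i else 0
  have hK : IsCompact (Set.pi univ fun i => Icc (-|B i|) |B i|) :=
    isCompact_univ_pi fun i => isCompact_Icc
  have hd : ∀ n, d n ∈ Set.pi univ fun i => Icc (-|B i|) |B i| := by
    intro n i _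
    refine mem_Icc.2 (abs_le.1 ?_)
    simp only [d]
    split_ifs with h
    · exact h.trans (le_abs_self _)
    · simp
  obtain ⟨l, -, φ, hφ, hl⟩ := hK.tendsto_subseq hd
  refine ⟨φ, hφ, l, fun i => ?_⟩
  refine ((tendsto_pi_nhds.1 hl) i).congr' ?_
  filter_upwards [hφ.tendsto_atTop.eventually (hB i)] with n hn
  simp [d, hn]

/-- A bounded sequence of curves that is equicontinuous when tested against a dense sequence has a
subsequence that converges weakly at all nonnegative times. -/
theorem exists_weak_limit_curve [CompleteSpace E] {K : Submodule ℝ E} [K.HasOrthogonalProjection]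
    {x : ℕ → ℝ → E} (hxK : ∀ n t, x n t ∈ K) {M : ℝ → ℝ}
    (hM : ∀ T, 0 ≤ T → ∀ᶠ n in atTop, ∀ t ∈ Icc 0 T, ‖x n t‖ ≤ M T)
    {w : ℕ → E} (hw : ∀ v ∈ K, ∀ ε > 0, ∃ k, ‖v - w k‖ < ε)
    (heq : ∀ k T ε, 0 < ε → ∃ δ > 0, ∀ᶠ n in atTop, ∀ s ∈ Icc 0 T, ∀ t ∈ Icc 0 T, |s - t| ≤ δ →
      |inner ℝ (x n s) (w k) - inner ℝ (x n t) (w k)| ≤ ε) :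
    ∃ φ : ℕ → ℕ, StrictMono φ ∧ ∃ u : ℝ → E,
      (∀ t, 0 ≤ t → ∀ a, Tendsto (fun n => inner ℝ (x (φ n) t) a) atTop (𝓝 (inner ℝ (u t) a))) ∧
      (∀ t, 0 ≤ t → u t ∈ K) ∧ ∀ a, ContinuousOn (fun t => inner ℝ (u t) a) (Ici 0) := by
  -- Convergence is extracted at the countably many pairs of a time `|q|`, with `q` rational, and a
  -- vector `w k`. Absolute values index the nonnegative rationals by all of `ℚ`.
  obtain ⟨φ, hφ, l, hl⟩ := exists_subseq_countable
    (fun n (i : ℚ × ℕ) => inner ℝ (x n |(i.1 : ℝ)|) (w i.2)) (fun i => M |(i.1 : ℝ)| * ‖w i.2‖)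
    (fun i => by
      filter_upwards [hM |(i.1 : ℝ)| (abs_nonneg _)] with n hn
      exact (abs_real_inner_le_norm _ _).trans
        (by gcongr; exact hn _ (right_mem_Icc.2 (abs_nonneg _))))
  have hφt := hφ.tendsto_atTop
  -- Equicontinuity transfers the Cauchy property from a nearby rational time to the time `t`.
  have hcw : ∀ t, 0 ≤ t → ∀ k, CauchySeq fun n => inner ℝ (x (φ n) t) (w k) := by
    intro t ht k
    rw [Metric.cauchySeq_iff']
    intro ε hε
    obtain ⟨δ, hδ, hev⟩ := heq k (t + 1) (ε / 8) (by positivity)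
    obtain ⟨q, hq1, hq2⟩ := exists_rat_btwn (show t < t + min δ 1 by
      have := lt_min hδ one_pos; linarith)
    have hq0 : |(q : ℝ)| = q := abs_of_nonneg (ht.trans hq1.le)
    have hcq := (hl (q, k)).cauchySeq
    rw [Metric.cauchySeq_iff'] at hcq
    obtain ⟨N, hN⟩ := hcq (ε / 8) (by positivity)
    obtain ⟨N', hN'⟩ := eventually_atTop.1 (hφt.eventually hev)
    have hmem1 : t ∈ Icc 0 (t + 1) := ⟨ht, by linarith⟩
    have hmem2 : (q : ℝ) ∈ Icc 0 (t + 1) :=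
      ⟨ht.trans hq1.le, by linarith [min_le_right δ 1]⟩
    have hdist : |t - q| ≤ δ := by
      rw [abs_sub_comm, abs_of_nonneg (by linarith)]; linarith [min_le_left δ 1]
    refine ⟨max N N', fun n hn => ?_⟩
    have h1 := hN' n ((le_max_right _ _).trans hn) t hmem1 q hmem2 hdist
    have h2 := hN' _ (le_max_right N N') t hmem1 q hmem2 hdist
    have h3 := hN n ((le_max_left _ _).trans hn)
    have h4 := hN _ (le_max_left N N')
    simp only [hq0, Real.dist_eq] at h3 h4 ⊢
    rw [abs_le] at h1 h2
    rw [abs_lt] at h3 h4 ⊢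
    constructor <;> linarith
  -- The curves lie in `K`, so `a` may be replaced by its projection to `K`, which is approximated
  -- by some `w k`.
  have hca : ∀ t, 0 ≤ t → ∀ a, CauchySeq fun n => inner ℝ (x (φ n) t) a := by
    intro t ht a
    rw [Metric.cauchySeq_iff']
    intro ε hε
    have hMt := hφt.eventually (hM t ht)
    obtain ⟨N', hN'⟩ := eventually_atTop.1 hMt
    have hM0 : 0 ≤ M t := (norm_nonneg _).trans (hN' N' le_rfl t (right_mem_Icc.2 ht))
    obtain ⟨k, hk⟩ := hw (K.starProjection a) (K.starProjection_apply_mem a)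
      (ε / (8 * (M t + 1))) (by positivity)
    have hsm : M t * ‖K.starProjection a - w k‖ ≤ ε / 8 := by
      calc M t * ‖K.starProjection a - w k‖ ≤ (M t + 1) * (ε / (8 * (M t + 1))) := by
            gcongr; linarith
        _ = ε / 8 := by field_simp
    have hcq := hcw t ht k
    rw [Metric.cauchySeq_iff'] at hcq
    obtain ⟨N, hN⟩ := hcq (ε / 8) (by positivity)
    have hap : ∀ n, N' ≤ n → |inner ℝ (x (φ n) t) a - inner ℝ (x (φ n) t) (w k)| ≤ ε / 8 := by
      intro n hn
      rw [← inner_starProjection_of_mem (hxK (φ n) t) a]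
      exact (abs_inner_sub_le _ _ _ (hN' n hn t (right_mem_Icc.2 ht))).trans hsm
    refine ⟨max N N', fun n hn => ?_⟩
    have h1 := hap n ((le_max_right _ _).trans hn)
    have h2 := hap _ (le_max_right N N')
    have h3 := hN n ((le_max_left _ _).trans hn)
    have h4 := hN _ (le_max_left N N')
    simp only [Real.dist_eq] at h3 h4 ⊢
    rw [abs_le] at h1 h2
    rw [abs_lt] at h3 h4 ⊢
    constructor <;> linarith
  have hMφ : ∀ T, 0 ≤ T → ∀ t ∈ Icc 0 T, ∀ᶠ n in atTop, ‖x (φ n) t‖ ≤ M T := fun T hT t ht =>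
    (hφt.eventually (hM T hT)).mono fun n hn => hn t ht
  have hex : ∀ t, ∃ v : E, 0 ≤ t →
      ∀ a, Tendsto (fun n => inner ℝ (x (φ n) t) a) atTop (𝓝 (inner ℝ v a)) := by
    intro t
    by_cases ht : 0 ≤ t
    · obtain ⟨v, hv⟩ := exists_weak_limit_of_cauchySeq (hMφ t ht t (right_mem_Icc.2 ht)) (hca t ht)
      exact ⟨v, fun _ => hv⟩
    · exact ⟨0, fun h => absurd h ht⟩
  choose u hu using hex
  have huK : ∀ t, 0 ≤ t → u t ∈ K := by
    intro t ht
    rw [← K.orthogonal_orthogonal, Submodule.mem_orthogonal']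
    intro a ha
    refine tendsto_nhds_unique (hu t ht a) (tendsto_const_nhds.congr fun n => ?_)
    exact ((Submodule.mem_orthogonal _ _).1 ha _ (hxK _ _)).symm
  refine ⟨φ, hφ, u, hu, huK, fun a t ht => ?_⟩
  rw [Metric.continuousWithinAt_iff]
  intro ε hε
  have ht' : (0 : ℝ) ≤ t := ht
  have hT : 0 ≤ t + 1 := by linarith
  have hub : ∀ s ∈ Icc 0 (t + 1), ‖u s‖ ≤ M (t + 1) := fun s hs =>
    norm_le_of_weak_limit (hMφ _ hT s hs) (hu s hs.1 (u s))
  have hM0 : 0 ≤ M (t + 1) := (norm_nonneg _).trans (hub 0 (left_mem_Icc.2 hT))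
  obtain ⟨k, hk⟩ := hw (K.starProjection a) (K.starProjection_apply_mem a)
    (ε / (8 * (M (t + 1) + 1))) (by positivity)
  have hsm : M (t + 1) * ‖K.starProjection a - w k‖ ≤ ε / 8 := by
    calc M (t + 1) * ‖K.starProjection a - w k‖
        ≤ (M (t + 1) + 1) * (ε / (8 * (M (t + 1) + 1))) := by gcongr; linarith
      _ = ε / 8 := by field_simp
  have hap : ∀ s ∈ Icc 0 (t + 1), |inner ℝ (u s) a - inner ℝ (u s) (w k)| ≤ ε / 8 := by
    intro s hs
    rw [← inner_starProjection_of_mem (huK s hs.1) a]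
    exact (abs_inner_sub_le _ _ _ (hub s hs)).trans hsm
  obtain ⟨δ, hδ, hev⟩ := heq k (t + 1) (ε / 8) (by positivity)
  refine ⟨min δ 1, lt_min hδ one_pos, fun s hs hst => ?_⟩
  rw [Real.dist_eq] at hst ⊢
  have hs0 : (0 : ℝ) ≤ s := hs
  have hsT : s ∈ Icc 0 (t + 1) :=
    ⟨hs0, by linarith [(abs_lt.1 (hst.trans_le (min_le_right _ _))).2]⟩
  have htT : t ∈ Icc 0 (t + 1) := ⟨ht', by linarith⟩
  have hlim : |inner ℝ (u s) (w k) - inner ℝ (u t) (w k)| ≤ ε / 8 := by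
    refine le_of_tendsto ((hu s hs0 (w k)).sub (hu t ht' (w k))).abs ?_
    filter_upwards [hφt.eventually hev] with n hn
    exact hn s hsT t htT (hst.le.trans (min_le_left _ _))
  have h1 := hap s hsT
  have h2 := hap t htT
  rw [abs_le] at h1 h2 hlim
  rw [abs_lt]
  constructor <;> linarith

end Weak

/-! ### The sequence of Galerkin approximations -/

/-- A sequence of Galerkin approximations, on the spaces spanned by the first vectors of `w`. -/
structure IsApprox (ν β : ℝ) (u₀ f : L2) (w : ℕ → solenoidalOne) (x : ℕ → ℝ → L2) : Prop where
  mem : ∀ n t, x n t ∈ solenoidalOne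
  cont : ∀ n, Continuous (x n)
  contD : ∀ n j, Continuous fun t => weakPartial j (x n t)
  contP : ∀ n j, Continuous fun t => prodF j (x n t) (x n t)
  init_le : ∀ n, ‖x n 0‖ ≤ ‖u₀‖
  init : ∀ k n : ℕ, k < n → inner ℝ (x n 0) (w k : L2) = inner ℝ u₀ (w k : L2)
  eqn : ∀ k n : ℕ, k < n → ∀ s ∈ Icc (0 : ℝ) (n : ℝ), ∀ t ∈ Icc (0 : ℝ) (n : ℝ),
    inner ℝ (x n t) (w k : L2) - inner ℝ (x n s) (w k : L2)
      = ∫ r in s..t, nsForm ν β f (x n r) (w k)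
  energy : ∀ n : ℕ, ∀ t ∈ Icc (0 : ℝ) (n : ℝ),
    ‖x n t‖ ^ 2 = ‖x n 0‖ ^ 2 + ∫ r in (0 : ℝ)..t, 2 * nsForm ν β f (x n r) (x n r)

lemma exists_isApprox {ν β : ℝ} (hν : 0 < ν) (hβ : 0 < β) (u₀ f : L2) (w : ℕ → solenoidalOne) :
    ∃ x, IsApprox ν β u₀ f w x := by
  let W : ℕ → Submodule ℝ L2 := fun n => Submodule.span ℝ ((fun k => (w k : L2)) '' Iio n)
  have hW : ∀ n, W n ≤ solenoidalOne := by
    intro n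
    refine Submodule.span_le.2 ?_
    rintro _ ⟨k, -, rfl⟩
    exact (w k).2
  have hfd : ∀ n, FiniteDimensional ℝ (W n) := fun n =>
    FiniteDimensional.span_of_finite ℝ ((finite_Iio n).image _)
  have hwm : ∀ k n, k < n → (w k : L2) ∈ W n := fun k n hk =>
    Submodule.subset_span ⟨k, hk, rfl⟩
  choose x h1 h2 h3 h4 h5 h6 h7 h8 using fun n : ℕ =>
    exists_galerkin hν hβ u₀ f (hW n) (T := (n : ℝ)) n.cast_nonneg
  exact ⟨x, h1, h2, h3, h4, h5, fun k n hk => h6 n _ (hwm k n hk),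
    fun k n hk => h7 n _ (hwm k n hk), h8⟩

section Approx

variable {ν β : ℝ} {u₀ f : L2} {w : ℕ → solenoidalOne} {x : ℕ → ℝ → L2}

/-- A strictly increasing `φ` satisfies `n ≤ φ n`, so both the time horizon and the list of
admissible test vectors only grow. -/
lemma IsApprox.comp (h : IsApprox ν β u₀ f w x) {φ : ℕ → ℕ} (hφ : StrictMono φ) :
    IsApprox ν β u₀ f w fun n => x (φ n) := by
  have hle : ∀ n : ℕ, (n : ℝ) ≤ φ n := fun n => by exact_mod_cast hφ.id_le n
  refine ⟨fun n => h.mem _, fun n => h.cont _, fun n => h.contD _, fun n => h.contP _,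
    fun n => h.init_le _, fun k n hk => h.init k _ (hk.trans_le (hφ.id_le n)),
    fun k n hk s hs t ht => ?_, fun n t ht => ?_⟩
  · exact h.eqn k _ (hk.trans_le (hφ.id_le n)) s (Icc_subset_Icc_right (hle n) hs) t
      (Icc_subset_Icc_right (hle n) ht)
  · exact h.energy _ t (Icc_subset_Icc_right (hle n) ht)

lemma IsApprox.one (h : IsApprox ν β u₀ f w x) (n : ℕ) (t : ℝ) : MemHDotOne (x n t) :=
  (h.mem n t).2

lemma IsApprox.continuous_hDotOneSq (h : IsApprox ν β u₀ f w x) (n : ℕ) :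
    Continuous fun t => hDotOneSq (x n t) :=
  continuous_finsetSum _ fun j _ => (h.contD n j).norm.pow 2

/-- The a priori bound of the energy at time `T`. -/
def energyBound (β : ℝ) (u₀ f : L2) (T : ℝ) : ℝ := ‖u₀‖ ^ 2 + T * (‖f‖ ^ 2 / (2 * β))

lemma energyBound_nonneg (hβ : 0 < β) (u₀ f : L2) {T : ℝ} (hT : 0 ≤ T) :
    0 ≤ energyBound β u₀ f T := by unfold energyBound; positivity

lemma energyBound_mono (hβ : 0 < β) (u₀ f : L2) {s t : ℝ} (hst : s ≤ t) :
    energyBound β u₀ f s ≤ energyBound β u₀ f t := by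
  unfold energyBound; gcongr

lemma IsApprox.energy_eq (h : IsApprox ν β u₀ f w x) {n : ℕ} {t : ℝ} (ht : t ∈ Icc (0 : ℝ) n) :
    ‖x n t‖ ^ 2 + 2 * ν * (∫ r in (0 : ℝ)..t, hDotOneSq (x n r))
      = ‖x n 0‖ ^ 2 + 2 * (∫ r in (0 : ℝ)..t, inner ℝ f (x n r))
        - 2 * β * ∫ r in (0 : ℝ)..t, ‖x n r‖ ^ 2 := by
  have h1 := h.energy n t ht
  have c1 := h.continuous_hDotOneSq n
  have c2 : Continuous fun r => inner ℝ f (x n r) := continuous_const.inner (h.cont n)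
  have c3 : Continuous fun r => ‖x n r‖ ^ 2 := (h.cont n).norm.pow 2
  have e : ∀ r, 2 * nsForm ν β f (x n r) (x n r) = -(2 * ν) * hDotOneSq (x n r)
      + (2 * inner ℝ f (x n r) - 2 * β * ‖x n r‖ ^ 2) := by
    intro r
    rw [nsForm_self ν β f (h.mem n r)]; ring
  simp only [e] at h1
  have c4 : Continuous fun r => 2 * inner ℝ f (x n r) - 2 * β * ‖x n r‖ ^ 2 :=
    (c2.const_mul _).sub (c3.const_mul _)
  rw [intervalIntegral.integral_add ((c1.const_mul _).intervalIntegrable _ _)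
      (c4.intervalIntegrable _ _),
    intervalIntegral.integral_sub ((c2.const_mul _).intervalIntegrable _ _)
      ((c3.const_mul _).intervalIntegrable _ _),
    intervalIntegral.integral_const_mul, intervalIntegral.integral_const_mul,
    intervalIntegral.integral_const_mul] at h1
  linarith

/-- Completion of the square in `‖v‖`: the damping absorbs the work of the force. -/
lemma force_le (hβ : 0 < β) (f v : L2) :
    2 * inner ℝ f v - 2 * β * ‖v‖ ^ 2 ≤ ‖f‖ ^ 2 / (2 * β) := by
  have h1 := real_inner_le_norm f v
  rw [le_div_iff₀ (by positivity)]
  nlinarith [sq_nonneg (‖f‖ - 2 * β * ‖v‖)]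

lemma IsApprox.energy_le (h : IsApprox ν β u₀ f w x) (hβ : 0 < β) {n : ℕ} {t : ℝ}
    (ht : t ∈ Icc (0 : ℝ) n) :
    ‖x n t‖ ^ 2 + 2 * ν * (∫ r in (0 : ℝ)..t, hDotOneSq (x n r)) ≤ energyBound β u₀ f t := by
  have c2 : Continuous fun r => inner ℝ f (x n r) := continuous_const.inner (h.cont n)
  have c3 : Continuous fun r => ‖x n r‖ ^ 2 := (h.cont n).norm.pow 2
  rw [h.energy_eq ht]
  have h1 : 2 * (∫ r in (0 : ℝ)..t, inner ℝ f (x n r)) - 2 * β * (∫ r in (0 : ℝ)..t, ‖x n r‖ ^ 2)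
      ≤ t * (‖f‖ ^ 2 / (2 * β)) := by
    rw [← intervalIntegral.integral_const_mul, ← intervalIntegral.integral_const_mul,
      ← intervalIntegral.integral_sub ((c2.const_mul _).intervalIntegrable _ _)
      ((c3.const_mul _).intervalIntegrable _ _)]
    calc _ ≤ ∫ _r in (0 : ℝ)..t, ‖f‖ ^ 2 / (2 * β) :=
          intervalIntegral.integral_mono_on ht.1
            (((c2.const_mul _).sub (c3.const_mul _)).intervalIntegrable _ _)
            (continuous_const.intervalIntegrable _ _) fun r _ => force_le hβ f _
      _ = _ := by simp; ring
  have h2 := pow_le_pow_left₀ (norm_nonneg _) (h.init_le n) 2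
  unfold energyBound
  linarith

lemma IsApprox.integral_hDotOneSq_nonneg (x : ℕ → ℝ → L2) (n : ℕ) {s t : ℝ} (hst : s ≤ t) :
    0 ≤ ∫ r in s..t, hDotOneSq (x n r) :=
  intervalIntegral.integral_nonneg hst fun _ _ => hDotOneSq_nonneg _

lemma IsApprox.norm_le (h : IsApprox ν β u₀ f w x) (hν : 0 < ν) (hβ : 0 < β) {T : ℝ} {n : ℕ}
    (hn : T ≤ n) {t : ℝ} (ht : t ∈ Icc 0 T) : ‖x n t‖ ≤ √(energyBound β u₀ f T) := by
  have h1 := h.energy_le hβ (Icc_subset_Icc_right hn ht)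
  have h2 := IsApprox.integral_hDotOneSq_nonneg x n ht.1
  refine Real.le_sqrt_of_sq_le ?_
  have h3 := energyBound_mono hβ u₀ f ht.2
  nlinarith [mul_nonneg hν.le h2]

lemma IsApprox.integral_hDotOneSq_le (h : IsApprox ν β u₀ f w x) (hν : 0 < ν) (hβ : 0 < β) {T : ℝ}
    (hT : 0 ≤ T) {n : ℕ} (hn : T ≤ n) :
    ∫ r in (0 : ℝ)..T, hDotOneSq (x n r) ≤ energyBound β u₀ f T / (2 * ν) := by
  have h1 := h.energy_le hβ (t := T) ⟨hT, hn⟩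
  rw [le_div_iff₀ (by positivity)]
  nlinarith [sq_nonneg ‖x n T‖]

/-- The weak form is bounded by a small multiple of the dissipation and a constant. -/
lemma exists_abs_nsForm_le (ν β : ℝ) (hν : 0 < ν) (hβ : 0 < β) (f w : L2) (M : ℝ) {lam : ℝ}
    (hl : 0 < lam) :
    ∃ C : ℝ, 0 ≤ C ∧ ∀ v : L2, MemHDotOne v → ‖v‖ ≤ M →
      |nsForm ν β f v w| ≤ lam * hDotOneSq v + C := by
  set G := gradSum w with hG
  have hG0 : 0 ≤ G := gradSum_nonneg w
  -- Chosen so that the gradient terms, multiplied by `(1 + ν) * (G + 1)` and by the `3` of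
  -- `gradSum_sq_le`, add up to exactly `lam * hDotOneSq v`. Writing `G + 1` avoids dividing by
  -- zero.
  set m : ℝ := lam / (3 * (G + 1) * (1 + ν)) with hm
  have hm0 : 0 < m := by positivity
  refine ⟨|G * ((ladyConst * M) ^ 2 / m ^ 3 + ν / (4 * m)) + (‖f‖ + β * M) * ‖w‖|, abs_nonneg _,
    fun v hv hvM => ?_⟩
  set g := gradSum v
  have hg0 : 0 ≤ g := gradSum_nonneg v
  have h4 := hv.normFour_sq_le hvM hm0
  have hnu : ν * g ≤ ν * (m * g ^ 2 + 1 / (4 * m)) := by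
    gcongr
    have e : m * g ^ 2 + 1 / (4 * m) - g = (2 * m * g - 1) ^ 2 / (4 * m) := by field_simp; ring
    have : 0 ≤ m * g ^ 2 + 1 / (4 * m) - g := by rw [e]; positivity
    linarith
  have h1 : |∑ j, inner ℝ (prodF j v v - ν • weakPartial j v) (weakPartial j w)|
      ≤ (normFour v ^ 2 + ν * g) * G := by
    rw [hG, gradSum, Finset.mul_sum]
    refine (Finset.abs_sum_le_sum_abs _ _).trans (Finset.sum_le_sum fun j _ => ?_)
    refine (abs_real_inner_le_norm _ _).trans ?_
    gcongr
    refine (norm_sub_le _ _).trans ?_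
    rw [norm_smul, Real.norm_of_nonneg hν.le]
    gcongr
    · rw [pow_two]; exact norm_prodF_le j hv.memLp_four hv.memLp_four
    · exact norm_weakPartial_le_gradSum v j
  have h2 : |inner ℝ (f - β • v) w| ≤ (‖f‖ + β * M) * ‖w‖ := by
    refine (abs_real_inner_le_norm _ _).trans ?_
    gcongr
    refine (norm_sub_le _ _).trans ?_
    rw [norm_smul, Real.norm_of_nonneg hβ.le]
    gcongr
  have h3 : |nsForm ν β f v w| ≤ (normFour v ^ 2 + ν * g) * G + (‖f‖ + β * M) * ‖w‖ :=
    (abs_add_le _ _).trans (add_le_add h1 h2)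
  refine h3.trans ?_
  have h5 : (normFour v ^ 2 + ν * g) * G
      ≤ (m * g ^ 2 * (1 + ν) + ((ladyConst * M) ^ 2 / m ^ 3 + ν / (4 * m))) * G := by
    refine mul_le_mul_of_nonneg_right ?_ hG0
    have : ν * (m * g ^ 2 + 1 / (4 * m)) = ν * (m * g ^ 2) + ν / (4 * m) := by ring
    linarith
  have h6 : m * g ^ 2 * (1 + ν) * G ≤ lam * hDotOneSq v := by
    have hq := gradSum_sq_le v
    calc m * g ^ 2 * (1 + ν) * G ≤ m * (3 * hDotOneSq v) * (1 + ν) * (G + 1) := by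
          have := hDotOneSq_nonneg v
          gcongr
          linarith
      _ = lam * hDotOneSq v := by rw [hm]; field_simp
  have h7 := le_abs_self (G * ((ladyConst * M) ^ 2 / m ^ 3 + ν / (4 * m)) + (‖f‖ + β * M) * ‖w‖)
  linarith

lemma IsApprox.continuous_nsForm (h : IsApprox ν β u₀ f w x) (n : ℕ) (a : L2) :
    Continuous fun t => nsForm ν β f (x n t) a :=
  DampedNS.continuous_nsForm ν β f (h.cont n) (h.contD n) (h.contP n) continuous_const
    fun _ => continuous_const

/-- The increment is the integral of the weak form, bounded by a small multiple of the total
dissipation plus a constant times the length of the interval. -/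
lemma IsApprox.equicontinuous (h : IsApprox ν β u₀ f w x) (hν : 0 < ν) (hβ : 0 < β) (k : ℕ)
    (T ε : ℝ) (hε : 0 < ε) : ∃ δ > 0, ∀ᶠ n in atTop, ∀ s ∈ Icc 0 T, ∀ t ∈ Icc 0 T, |s - t| ≤ δ →
      |inner ℝ (x n s) (w k : L2) - inner ℝ (x n t) (w k : L2)| ≤ ε := by
  rcases lt_or_ge T 0 with hT | hT
  · exact ⟨1, one_pos, Eventually.of_forall fun n s hs => absurd (hs.1.trans hs.2) (not_le.2 hT)⟩
  set A := energyBound β u₀ f T / (2 * ν) with hA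
  have hA0 : 0 ≤ A := div_nonneg (energyBound_nonneg hβ u₀ f hT) (by positivity)
  -- This `lam` makes the dissipation contribute at most `ε / 2`; the length `δ` is then chosen in
  -- terms of `C` for the other half.
  obtain ⟨C, hC0, hC⟩ := exists_abs_nsForm_le ν β hν hβ f (w k) (√(energyBound β u₀ f T))
    (lam := ε / (2 * (A + 1))) (by positivity)
  refine ⟨ε / (2 * (C + 1)), by positivity, ?_⟩
  filter_upwards [eventually_gt_atTop k, eventually_ge_atTop ⌈T⌉₊] with n hkn hnT
  have hTn : T ≤ n := Nat.ceil_le.1 hnT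
  have key : ∀ s ∈ Icc 0 T, ∀ t ∈ Icc 0 T, s ≤ t → t - s ≤ ε / (2 * (C + 1)) →
      |inner ℝ (x n t) (w k : L2) - inner ℝ (x n s) (w k : L2)| ≤ ε := by
    intro s hs t ht hst hd
    rw [h.eqn k n hkn s (Icc_subset_Icc_right hTn hs) t (Icc_subset_Icc_right hTn ht)]
    have ch := h.continuous_hDotOneSq n
    have b1 : ∫ r in s..t, hDotOneSq (x n r) ≤ A := by
      refine le_trans ?_ (h.integral_hDotOneSq_le hν hβ hT hTn)
      refine intervalIntegral.integral_mono_interval hs.1 hst ht.2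
        (Eventually.of_forall fun r => hDotOneSq_nonneg _) (ch.intervalIntegrable _ _)
    calc |∫ r in s..t, nsForm ν β f (x n r) (w k)|
        ≤ ∫ r in s..t, |nsForm ν β f (x n r) (w k)| :=
          intervalIntegral.abs_integral_le_integral_abs hst
      _ ≤ ∫ r in s..t, (ε / (2 * (A + 1)) * hDotOneSq (x n r) + C) := by
          refine intervalIntegral.integral_mono_on hst
            ((h.continuous_nsForm n _).abs.intervalIntegrable _ _)
            (((ch.const_mul _).add continuous_const).intervalIntegrable _ _) fun r hr => ?_
          exact hC _ (h.one n r) (h.norm_le hν hβ hTn ⟨hs.1.trans hr.1, hr.2.trans ht.2⟩)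
      _ = ε / (2 * (A + 1)) * (∫ r in s..t, hDotOneSq (x n r)) + (t - s) * C := by
          rw [intervalIntegral.integral_add ((ch.const_mul _).intervalIntegrable _ _)
            (continuous_const.intervalIntegrable _ _), intervalIntegral.integral_const_mul]
          simp
      _ ≤ ε / (2 * (A + 1)) * (A + 1) + ε / (2 * (C + 1)) * (C + 1) := by
          gcongr <;> linarith
      _ = ε := by field_simp; ring
  intro s hs t ht hst
  rcases le_total s t with hle | hle
  · rw [abs_sub_comm]
    exact key s hs t ht hle ((le_abs_self _).trans (by rwa [abs_sub_comm]))
  · exact key t ht s hs hle ((le_abs_self _).trans hst)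

/-- A weakly convergent sequence of approximations. -/
theorem exists_isApprox_limit (hν : 0 < ν) (hβ : 0 < β) (u₀ f : L2) (hu₀ : u₀ ∈ solenoidal)
    {w : ℕ → solenoidalOne} (hw : ∀ (v : solenoidalOne) (ε : ℝ), 0 < ε → ∃ k, ‖(v : L2) - w k‖ < ε) :
    ∃ (x : ℕ → ℝ → L2) (u : ℝ → L2), IsApprox ν β u₀ f w x ∧
      (∀ t, 0 ≤ t → ∀ a, Tendsto (fun n => inner ℝ (x n t) a) atTop (𝓝 (inner ℝ (u t) a))) ∧
      (∀ t, 0 ≤ t → u t ∈ solenoidal) ∧ (∀ a, ContinuousOn (fun t => inner ℝ (u t) a) (Ici 0)) ∧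
      u 0 = u₀ := by
  obtain ⟨x, hx⟩ := exists_isApprox hν hβ u₀ f w
  have hdense : ∀ v ∈ solenoidal, ∀ ε > 0, ∃ k, ‖v - (w k : L2)‖ < ε := by
    intro v hv ε hε
    obtain ⟨v', hv'⟩ := exists_solenoidalOne_near hv (half_pos hε)
    obtain ⟨k, hk⟩ := hw v' (ε / 2) (half_pos hε)
    refine ⟨k, ?_⟩
    have := norm_add_le (v - v') ((v' : L2) - w k)
    rw [sub_add_sub_cancel] at this
    linarith
  obtain ⟨φ, hφ, u, hu, huK, huc⟩ := exists_weak_limit_curve (K := solenoidal)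
    (x := x) (fun n t => (hx.mem n t).1) (M := fun T => √(energyBound β u₀ f T))
    (fun T _ => by
      filter_upwards [eventually_ge_atTop ⌈T⌉₊] with n hn t ht
      exact hx.norm_le hν hβ (Nat.ceil_le.1 hn) ht)
    hdense (fun k T ε hε => hx.equicontinuous hν hβ k T ε hε)
  refine ⟨fun n => x (φ n), u, hx.comp hφ, hu, huK, huc, ?_⟩
  -- The initial value of the `n`-th approximation is tested correctly against `w k` only for `k <
  -- n`, which is enough in the limit.
  have hk : ∀ k, inner ℝ (u 0 - u₀) (w k : L2) = 0 := by
    intro k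
    have h1 := hu 0 le_rfl (w k)
    have h2 : Tendsto (fun n => inner ℝ (x (φ n) 0) (w k : L2)) atTop
        (𝓝 (inner ℝ u₀ (w k : L2))) := by
      refine tendsto_const_nhds.congr' ?_
      filter_upwards [eventually_gt_atTop k] with n hn
      exact (hx.init k _ (hn.trans_le (hφ.id_le n))).symm
    rw [inner_sub_left, tendsto_nhds_unique h1 h2, sub_self]
  by_contra hne
  have hpos : 0 < ‖u 0 - u₀‖ := norm_pos_iff.2 (sub_ne_zero.2 hne)
  -- The defect `u 0 - u₀` is orthogonal to every `w k`, yet some `w k` lies closer to it than its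
  -- own norm, a contradiction.
  obtain ⟨k, hk'⟩ := hdense _ (solenoidal.sub_mem (huK 0 le_rfl) hu₀) _ hpos
  have h1 : ‖u 0 - u₀‖ ^ 2 = inner ℝ (u 0 - u₀) (u 0 - u₀ - w k) := by
    rw [inner_sub_right, hk k, sub_zero, real_inner_self_eq_norm_sq]
  have h2 := real_inner_le_norm (u 0 - u₀) (u 0 - u₀ - w k)
  nlinarith

end Approx

/-! ### Measurability of curves in `L²` -/

lemma aestronglyMeasurable_starProjection {α : Type*} [MeasurableSpace α] {μ : Measure α}
    {F : α → L2} (h : ∀ a, AEStronglyMeasurable (fun t => inner ℝ (F t) a) μ)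
    (W : Submodule ℝ L2) [FiniteDimensional ℝ W] :
    AEStronglyMeasurable (fun t => W.starProjection (F t)) μ := by
  have : CompleteSpace W := FiniteDimensional.complete ℝ W
  let b := stdOrthonormalBasis ℝ W
  have e : ∀ t, W.starProjection (F t) = ∑ i, inner ℝ (F t) (b i : L2) • (b i : L2) := by
    intro t
    rw [b.starProjection_eq_sum_rankOne]
    simp [real_inner_comm]
  simp only [e]
  exact Finset.aestronglyMeasurable_fun_sum _ fun i _ => (h _).smul_const _

/-- A curve in `L²` is strongly measurable as soon as its pairings with test fields are. -/
lemma aestronglyMeasurable_of_inner_testField {α : Type*} [MeasurableSpace α] {μ : Measure α}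
    {F : α → L2}
    (h : ∀ g, IsTestField g → AEStronglyMeasurable (fun t => inner ℝ (F t) (toL2 g)) μ) :
    AEStronglyMeasurable F μ := by
  have h' : ∀ a, AEStronglyMeasurable (fun t => inner ℝ (F t) a) μ := by
    intro a
    obtain ⟨g, hg, hga⟩ := exists_seq_testField a
    exact aestronglyMeasurable_of_tendsto_ae atTop (fun n => h _ (hg n))
      (Eventually.of_forall fun t => tendsto_const_nhds.inner hga)
  let d := TopologicalSpace.denseSeq L2
  -- As in Pettis' theorem: projections to an increasing sequence of finite-dimensional spaces are
  -- measurable in coordinates and converge pointwise to the curve.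
  let W : ℕ → Submodule ℝ L2 := fun n => Submodule.span ℝ (d '' Iio n)
  have hfd : ∀ n, FiniteDimensional ℝ (W n) := fun n =>
    FiniteDimensional.span_of_finite ℝ ((finite_Iio n).image _)
  have hc : ∀ n, CompleteSpace (W n) := fun n => FiniteDimensional.complete ℝ _
  have hmono : Monotone W := fun m n hmn =>
    Submodule.span_mono (image_mono (Iio_subset_Iio hmn))
  have htop : ⊤ ≤ (⨆ n, W n).topologicalClosure := by
    intro v _
    have hv : v ∈ closure (range d) := TopologicalSpace.denseRange_denseSeq L2 v
    refine closure_mono ?_ hv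
    rintro _ ⟨k, rfl⟩
    exact (le_iSup W (k + 1)) (Submodule.subset_span ⟨k, Nat.lt_succ_self k, rfl⟩)
  exact aestronglyMeasurable_of_tendsto_ae atTop
    (fun n => aestronglyMeasurable_starProjection h' (W n))
    (Eventually.of_forall fun t => Submodule.starProjection_tendsto_self W hmono (F t) htop)

/-! ### Weak lower semicontinuity of the dissipation -/

lemma cauchySeq_inner_of_dense {y : ℕ → L2} {M : ℝ} (hM : ∀ n, ‖y n‖ ≤ M)
    (h : ∀ g, IsTestField g → CauchySeq fun n => inner ℝ (y n) (toL2 g)) (a : L2) :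
    CauchySeq fun n => inner ℝ (y n) a := by
  have hM0 : 0 ≤ M := (norm_nonneg _).trans (hM 0)
  rw [Metric.cauchySeq_iff']
  intro ε hε
  obtain ⟨g, hg, hga⟩ := exists_testField_near a (ε := ε / (4 * (M + 1))) (by positivity)
  obtain ⟨N, hN⟩ := Metric.cauchySeq_iff'.1 (h g hg) (ε / 4) (by positivity)
  have hap : ∀ n, |inner ℝ (y n) a - inner ℝ (y n) (toL2 g)| ≤ ε / 4 := by
    intro n
    refine (abs_inner_sub_le _ _ _ (hM n)).trans ?_
    calc M * ‖a - toL2 g‖ ≤ (M + 1) * (ε / (4 * (M + 1))) := by gcongr; linarith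
      _ = ε / 4 := by field_simp
  refine ⟨N, fun n hn => ?_⟩
  have h1 := hap n
  have h2 := hap N
  have h3 := hN n hn
  rw [Real.dist_eq] at h3 ⊢
  rw [abs_le] at h1 h2
  rw [abs_lt] at h3 ⊢
  constructor <;> linarith

/-- Along a subsequence the derivatives are bounded, and their pairings with test fields converge by
integration by parts. They therefore have weak limits, which are the weak derivatives of `v`, and
the quadratic expression is lower semicontinuous. -/
lemma memHDotOne_of_weak_limit {x : ℕ → L2} {v : L2} (hx : ∀ n, MemHDotOne (x n))
    (h : ∀ a, Tendsto (fun n => inner ℝ (x n) a) atTop (𝓝 (inner ℝ v a))) {a b C : ℝ}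
    (ha : 0 < a) (hb : 0 ≤ b) (hC : ∃ᶠ n in atTop, a * hDotOneSq (x n) + b * ‖x n‖ ^ 2 ≤ C) :
    MemHDotOne v ∧ a * hDotOneSq v + b * ‖v‖ ^ 2 ≤ C := by
  obtain ⟨φ, hφ, hφC⟩ := extraction_of_frequently_atTop hC
  have hφt := hφ.tendsto_atTop
  have hbd : ∀ n j, ‖weakPartial j (x (φ n))‖ ≤ √(C / a) := by
    intro n j
    refine Real.le_sqrt_of_sq_le ?_
    rw [le_div_iff₀ ha]
    have h1 : ‖weakPartial j (x (φ n))‖ ^ 2 ≤ hDotOneSq (x (φ n)) :=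
      Finset.single_le_sum (f := fun j => ‖weakPartial j (x (φ n))‖ ^ 2)
        (fun _ _ => sq_nonneg _) (Finset.mem_univ j)
    have h2 := hφC n
    nlinarith [mul_nonneg hb (sq_nonneg ‖x (φ n)‖)]
  have hcs : ∀ j a, CauchySeq fun n => inner ℝ (weakPartial j (x (φ n))) a := by
    intro j
    refine cauchySeq_inner_of_dense (fun n => hbd n j) fun g hg => ?_
    have h1 : ∀ n, inner ℝ (weakPartial j (x (φ n))) (toL2 g)
        = - inner ℝ (x (φ n)) (toL2 (pdv j g)) := fun n => by
      rw [isWeakPartial_iff.1 ((hx (φ n)).isWeakPartial j) g hg, neg_neg]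
    simp only [h1]
    exact (((h _).comp hφt).neg).cauchySeq
  choose w hw using fun j => exists_weak_limit_of_cauchySeq
    (Eventually.of_forall fun n => hbd n j) (hcs j)
  have hwp : ∀ j, IsWeakPartial j v (w j) := fun j =>
    IsWeakPartial.of_tendsto (l := atTop) (Eventually.of_forall fun n => (hx (φ n)).isWeakPartial j)
      (fun a => (h a).comp hφt) (hw j)
  refine ⟨fun j => ⟨_, hwp j⟩, ?_⟩
  have hS : hDotOneSq v = ∑ j, ‖w j‖ ^ 2 :=
    Finset.sum_congr rfl fun j _ => by rw [weakPartial_eq (hwp j)]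
  have hlim : Tendsto (fun n => a * ∑ j, inner ℝ (weakPartial j (x (φ n))) (w j)
      + b * inner ℝ (x (φ n)) v) atTop (𝓝 (a * hDotOneSq v + b * ‖v‖ ^ 2)) := by
    rw [hS]
    simp only [← real_inner_self_eq_norm_sq]
    exact ((tendsto_finsetSum _ fun j _ => hw j (w j)).const_mul a).add
      (((h v).comp hφt).const_mul b)
  -- Writing `X` for the value at the limit, `⟨p,q⟩ ≤ (‖p‖² + ‖q‖²)/2` gives `X ≤ (C + X)/2`, that
  -- is, `X ≤ C`.
  have hle : a * hDotOneSq v + b * ‖v‖ ^ 2 ≤ (C + (a * hDotOneSq v + b * ‖v‖ ^ 2)) / 2 := by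
    refine le_of_tendsto hlim (Eventually.of_forall fun n => ?_)
    have key : ∀ p q : L2, inner ℝ p q ≤ (‖p‖ ^ 2 + ‖q‖ ^ 2) / 2 := fun p q => by
      have := real_inner_le_norm p q
      nlinarith [sq_nonneg (‖p‖ - ‖q‖)]
    have h1 : ∑ j, inner ℝ (weakPartial j (x (φ n))) (w j)
        ≤ (hDotOneSq (x (φ n)) + hDotOneSq v) / 2 := by
      rw [hS, hDotOneSq, ← Finset.sum_add_distrib, Finset.sum_div]
      exact Finset.sum_le_sum fun j _ => key _ _
    have h2 := key (x (φ n)) v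
    have h3 := hφC n
    have h4 := mul_le_mul_of_nonneg_left h1 ha.le
    have h5 := mul_le_mul_of_nonneg_left h2 hb
    linarith
  linarith

/-- Every bound strictly above the limit inferior holds for infinitely many indices, possibly along
a subsequence depending on the time; this is the pointwise input to Fatou's lemma. -/
lemma memHDotOne_of_liminf {x : ℕ → L2} {v : L2} (hx : ∀ n, MemHDotOne (x n))
    (h : ∀ a, Tendsto (fun n => inner ℝ (x n) a) atTop (𝓝 (inner ℝ v a))) {a b : ℝ}
    (ha : 0 < a) (hb : 0 ≤ b)
    (hl : liminf (fun n => ENNReal.ofReal (a * hDotOneSq (x n) + b * ‖x n‖ ^ 2)) atTop ≠ ⊤) :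
    MemHDotOne v ∧ ENNReal.ofReal (a * hDotOneSq v + b * ‖v‖ ^ 2)
      ≤ liminf (fun n => ENNReal.ofReal (a * hDotOneSq (x n) + b * ‖x n‖ ^ 2)) atTop := by
  set L := liminf (fun n => ENNReal.ofReal (a * hDotOneSq (x n) + b * ‖x n‖ ^ 2)) atTop with hL
  have key : ∀ C : ℝ, L < ENNReal.ofReal C →
      MemHDotOne v ∧ a * hDotOneSq v + b * ‖v‖ ^ 2 ≤ C := by
    intro C hC
    refine memHDotOne_of_weak_limit hx h ha hb ?_
    refine (frequently_lt_of_liminf_lt (by isBoundedDefault) hC).mono fun n hn => ?_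
    have hC0 : 0 < C := ENNReal.ofReal_pos.1 (zero_le.trans_lt hn)
    exact (ENNReal.ofReal_le_ofReal_iff hC0.le).1 hn.le
  have hlt : ∀ ε : ℝ, 0 < ε → L < ENNReal.ofReal (L.toReal + ε) := by
    intro ε hε
    rw [ENNReal.lt_ofReal_iff_toReal_lt hl]
    linarith
  refine ⟨(key _ (hlt 1 one_pos)).1, ?_⟩
  rw [← ENNReal.ofReal_toReal hl]
  exact ENNReal.ofReal_le_ofReal (le_of_forall_pos_le_add fun ε hε => (key _ (hlt ε hε)).2)

/-! ### The quadratic term, tested against a test field -/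

/-- The integral `∫ v_j v·g`. -/
def quadForm (j : Fin 3) (g : E3 → E3) (v : L2) : ℝ := ∫ x, v x j * inner ℝ (v x) (g x)

lemma inner_prodF_testField (j : Fin 3) {g : E3 → E3} (hg : IsTestField g) {v : L2}
    (hv : MemHDotOne v) : inner ℝ (prodF j v v) (toL2 g) = quadForm j g v := by
  rw [L2.inner_def]
  refine integral_congr_ae ?_
  filter_upwards [coeFn_toL2 hg.memLp, coeFn_prodF j hv.memLp_four hv.memLp_four] with x h1 h2
  rw [h1, h2, real_inner_smul_left]

lemma integrable_quadForm (j : Fin 3) {g : E3 → E3} (hg : IsTestField g) (v : L2) :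
    Integrable (fun x => v x j * inner ℝ (v x) (g x)) volume := by
  obtain ⟨c, hc⟩ := hg.2.exists_bound_of_continuous hg.1.continuous
  refine Integrable.mono' (((Lp.memLp v).integrable_norm_pow (p := 2) (by norm_num)).const_mul c)
    ((memLp_coeFn_apply v j).1.mul
      ((Lp.aestronglyMeasurable v).inner hg.1.continuous.aestronglyMeasurable))
    (Eventually.of_forall fun x => ?_)
  rw [norm_mul, Real.norm_eq_abs, Real.norm_eq_abs]
  have h1 := abs_apply_le_norm (v x) j
  have h2 := abs_real_inner_le_norm (v x) (g x)
  have h3 := hc x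
  calc |v x j| * |inner ℝ (v x) (g x)| ≤ ‖v x‖ * (‖v x‖ * c) := by gcongr; exact h2.trans (by gcongr)
    _ = c * ‖v x‖ ^ 2 := by ring

/-- The difference of the quadratic expressions is linear in `v - v'` and confined to the support of
`g`. Young's inequality separates the local norm of `v - v'` from the global norms, with a free
parameter `ε`. -/
lemma exists_abs_quadForm_sub_le (j : Fin 3) {g : E3 → E3} (hg : IsTestField g) :
    ∃ c R : ℝ, 0 ≤ c ∧ ∀ (v v' : L2) (ε : ℝ), 0 < ε →
      |quadForm j g v - quadForm j g v'| ≤ c * (locSq R (v - v') / ε + ε * (‖v‖ ^ 2 + ‖v'‖ ^ 2)) := by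
  obtain ⟨c, hc⟩ := hg.2.exists_bound_of_continuous hg.1.continuous
  have hc0 : 0 ≤ c := (norm_nonneg _).trans (hc 0)
  obtain ⟨R, hR⟩ := hg.2.isBounded.subset_ball (0 : E3)
  refine ⟨c, R, hc0, fun v v' ε hε => ?_⟩
  have hi1 : Integrable ((Metric.ball (0 : E3) R).indicator fun x => ‖(v - v' : L2) x‖ ^ 2 / ε)
      volume := IntegrableOn.integrable_indicator ((integrableOn_norm_sq R (v - v')).div_const ε)
        measurableSet_ball
  have hn : ∀ w : L2, Integrable (fun x => ‖w x‖ ^ 2) volume := fun w =>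
    (Lp.memLp w).integrable_norm_pow (by norm_num)
  have hi2 : Integrable (fun x => ε * (‖v x‖ ^ 2 + ‖v' x‖ ^ 2)) volume :=
    ((hn v).add (hn v')).const_mul ε
  have hi3 := hi1.add hi2
  rw [quadForm, quadForm, ← integral_sub (integrable_quadForm j hg v) (integrable_quadForm j hg v'),
    ← Real.norm_eq_abs]
  calc ‖∫ x, (v x j * inner ℝ (v x) (g x) - v' x j * inner ℝ (v' x) (g x))‖
      ≤ ∫ x, c * ((Metric.ball (0 : E3) R).indicator (fun x => ‖(v - v' : L2) x‖ ^ 2 / ε) x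
          + ε * (‖v x‖ ^ 2 + ‖v' x‖ ^ 2)) := by
        refine norm_integral_le_of_norm_le (hi3.const_mul c) ?_
        filter_upwards [Lp.coeFn_sub v v'] with x hx
        by_cases hxs : x ∈ tsupport g
        · rw [indicator_of_mem (hR hxs), hx, Real.norm_eq_abs]
          simp only [Pi.sub_apply]
          have e : v x j * inner ℝ (v x) (g x) - v' x j * inner ℝ (v' x) (g x)
              = (v x - v' x) j * inner ℝ (v x) (g x) + v' x j * inner ℝ (v x - v' x) (g x) := by
            rw [inner_sub_left]; simp only [PiLp.sub_apply]; ring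
          rw [e]
          set d := v x - v' x
          have b1 : |d j * inner ℝ (v x) (g x)| ≤ ‖d‖ * (‖v x‖ * c) := by
            rw [abs_mul]
            gcongr
            · exact abs_apply_le_norm d j
            · exact (abs_real_inner_le_norm _ _).trans (by gcongr; exact hc x)
          have b2 : |v' x j * inner ℝ d (g x)| ≤ ‖v' x‖ * (‖d‖ * c) := by
            rw [abs_mul]
            gcongr
            · exact abs_apply_le_norm _ j
            · exact (abs_real_inner_le_norm _ _).trans (by gcongr; exact hc x)
          have b3 : ‖d‖ * (‖v x‖ + ‖v' x‖) ≤ ‖d‖ ^ 2 / ε + ε * (‖v x‖ ^ 2 + ‖v' x‖ ^ 2) := by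
            have e1 : ‖d‖ ^ 2 / ε + ε * (‖v x‖ + ‖v' x‖) ^ 2 / 4 - ‖d‖ * (‖v x‖ + ‖v' x‖)
                = (2 * ‖d‖ - ε * (‖v x‖ + ‖v' x‖)) ^ 2 / (4 * ε) := by field_simp; ring
            have e2 : 0 ≤ (2 * ‖d‖ - ε * (‖v x‖ + ‖v' x‖)) ^ 2 / (4 * ε) := by positivity
            have e3 : (‖v x‖ + ‖v' x‖) ^ 2 ≤ 4 * (‖v x‖ ^ 2 + ‖v' x‖ ^ 2) := by
              nlinarith [sq_nonneg (‖v x‖ - ‖v' x‖), sq_nonneg ‖v x‖, sq_nonneg ‖v' x‖]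
            have e4 := mul_le_mul_of_nonneg_left e3 hε.le
            linarith
          calc _ ≤ ‖d‖ * (‖v x‖ * c) + ‖v' x‖ * (‖d‖ * c) := (abs_add_le _ _).trans (add_le_add b1 b2)
            _ = c * (‖d‖ * (‖v x‖ + ‖v' x‖)) := by ring
            _ ≤ _ := by gcongr
        · have h0 : g x = 0 := image_eq_zero_of_notMem_tsupport hxs
          simp only [h0, inner_zero_right, mul_zero, sub_self, norm_zero]
          have : 0 ≤ (Metric.ball (0 : E3) R).indicator (fun x => ‖(v - v' : L2) x‖ ^ 2 / ε) x :=
            indicator_nonneg (fun _ _ => by positivity) _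
          positivity
    _ = _ := by
        rw [integral_const_mul, integral_add hi1 hi2, integral_indicator measurableSet_ball,
          integral_div, integral_const_mul, integral_add (hn v) (hn v'), ← norm_sq_L2_eq,
          ← norm_sq_L2_eq]
        rfl

lemma locSq_le_norm_sq (R : ℝ) (v : L2) : locSq R v ≤ ‖v‖ ^ 2 := by
  rw [norm_sq_L2_eq]
  exact setIntegral_le_integral ((Lp.memLp v).integrable_norm_pow (by norm_num))
    (Eventually.of_forall fun x => by positivity)

lemma continuous_quadForm (j : Fin 3) {g : E3 → E3} (hg : IsTestField g) :
    Continuous (quadForm j g) := by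
  obtain ⟨c, R, hc, h⟩ := exists_abs_quadForm_sub_le j hg
  refine continuous_iff_continuousAt.2 fun v => ?_
  rw [ContinuousAt, tendsto_iff_norm_sub_tendsto_zero]
  have hlim : Tendsto (fun w : L2 => c * (‖w - v‖ * (1 + (‖w‖ ^ 2 + ‖v‖ ^ 2)))) (𝓝 v) (𝓝 0) := by
    have : Continuous fun w : L2 => c * (‖w - v‖ * (1 + (‖w‖ ^ 2 + ‖v‖ ^ 2))) := by fun_prop
    simpa using this.tendsto v
  refine squeeze_zero (fun _ => norm_nonneg _) (fun w => ?_) hlim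
  rcases eq_or_ne w v with rfl | hne
  · simp
  · have hp : 0 < ‖w - v‖ := norm_pos_iff.2 (sub_ne_zero.2 hne)
    refine (h w v _ hp).trans ?_
    gcongr
    rw [mul_add ‖w - v‖ 1, mul_one]
    gcongr
    rw [div_le_iff₀ hp, ← pow_two]
    exact locSq_le_norm_sq R _

/-! ### Properties of the limit -/

/-- A weak limit of Galerkin approximations. -/
structure IsLimit (ν β : ℝ) (u₀ f : L2) (w : ℕ → solenoidalOne) (x : ℕ → ℝ → L2) (u : ℝ → L2) :
    Prop where
  approx : IsApprox ν β u₀ f w x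
  tendsto : ∀ t, 0 ≤ t → ∀ a, Tendsto (fun n => inner ℝ (x n t) a) atTop (𝓝 (inner ℝ (u t) a))
  mem : ∀ t, 0 ≤ t → u t ∈ solenoidal
  weakCont : ∀ a, ContinuousOn (fun t => inner ℝ (u t) a) (Ici 0)
  initial : u 0 = u₀

section Limit

variable {ν β : ℝ} {u₀ f : L2} {w : ℕ → solenoidalOne} {x : ℕ → ℝ → L2} {u : ℝ → L2}

lemma IsLimit.norm_le (h : IsLimit ν β u₀ f w x u) (hν : 0 < ν) (hβ : 0 < β) {T t : ℝ}
    (ht : t ∈ Icc 0 T) : ‖u t‖ ≤ √(energyBound β u₀ f T) := by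
  refine norm_le_of_weak_limit (l := atTop) (y := fun n => x n t) ?_ (h.tendsto t ht.1 (u t))
  filter_upwards [eventually_ge_atTop ⌈T⌉₊] with n hn
  exact h.approx.norm_le hν hβ (Nat.ceil_le.1 hn) ht

lemma IsLimit.aestronglyMeasurable (h : IsLimit ν β u₀ f w x u) (T : ℝ) :
    AEStronglyMeasurable u (volume.restrict (Icc 0 T)) :=
  aestronglyMeasurable_of_inner_testField fun g _ =>
    ((h.weakCont (toL2 g)).mono Icc_subset_Ici_self).aestronglyMeasurable measurableSet_Icc

lemma IsLimit.memLinftyLocL2 (h : IsLimit ν β u₀ f w x u) (hν : 0 < ν) (hβ : 0 < β) :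
    MemLinftyLocL2 u := fun T _ =>
  memLp_top_of_bound (h.aestronglyMeasurable T) (√(energyBound β u₀ f T))
    ((ae_restrict_iff' measurableSet_Icc).2 (Eventually.of_forall fun _ ht => h.norm_le hν hβ ht))

lemma IsLimit.integral_inner_tendsto (h : IsLimit ν β u₀ f w x u) (hν : 0 < ν) (hβ : 0 < β) (a : L2)
    {s t : ℝ} (hs : 0 ≤ s) (hst : s ≤ t) :
    Tendsto (fun n => ∫ r in s..t, inner ℝ (x n r) a) atTop (𝓝 (∫ r in s..t, inner ℝ (u r) a)) := by
  refine intervalIntegral.tendsto_integral_filter_of_dominated_convergence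
    (fun _ => √(energyBound β u₀ f t) * ‖a‖) ?_ ?_ (by simp) ?_
  · exact Eventually.of_forall fun n =>
      ((h.approx.cont n).inner continuous_const).aestronglyMeasurable
  · filter_upwards [eventually_ge_atTop ⌈t⌉₊] with n hn
    refine Eventually.of_forall fun r hr => ?_
    rw [uIoc_of_le hst] at hr
    refine (norm_inner_le_norm (𝕜 := ℝ) _ _).trans ?_
    gcongr
    exact h.approx.norm_le hν hβ (Nat.ceil_le.1 hn) ⟨hs.trans hr.1.le, hr.2⟩
  · refine Eventually.of_forall fun r hr => ?_
    rw [uIoc_of_le hst] at hr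
    exact h.tendsto r (hs.trans hr.1.le) a

/-- The dissipation of the limit is bounded by the energy balance. -/
lemma IsLimit.exists_energy (h : IsLimit ν β u₀ f w x u) (hν : 0 < ν) (hβ : 0 < β) {t : ℝ}
    (ht : 0 ≤ t) :
    0 ≤ ‖u₀‖ ^ 2 + 2 * (∫ r in (0 : ℝ)..t, inner ℝ f (u r)) - ‖u t‖ ^ 2 ∧
    ∃ D : ℝ → ENNReal, AEMeasurable D (volume.restrict (Icc 0 t)) ∧
      (∀ r ∈ Icc 0 t, D r ≠ ⊤ → MemHDotOne (u r) ∧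
        ENNReal.ofReal (2 * ν * hDotOneSq (u r) + 2 * β * ‖u r‖ ^ 2) ≤ D r) ∧
      ∫⁻ r in Icc 0 t, D r
        ≤ ENNReal.ofReal (‖u₀‖ ^ 2 + 2 * (∫ r in (0 : ℝ)..t, inner ℝ f (u r)) - ‖u t‖ ^ 2) := by
  let e : ℕ → ℝ → ℝ := fun n r => 2 * ν * hDotOneSq (x n r) + 2 * β * ‖x n r‖ ^ 2
  have he0 : ∀ n r, 0 ≤ e n r := fun n r => by
    have := hDotOneSq_nonneg (x n r)
    positivity
  have c1 : ∀ n, Continuous fun r => 2 * ν * hDotOneSq (x n r) :=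
    fun n => (h.approx.continuous_hDotOneSq n).const_mul _
  have c2 : ∀ n, Continuous fun r => 2 * β * ‖x n r‖ ^ 2 :=
    fun n => ((h.approx.cont n).norm.pow 2).const_mul _
  have hec : ∀ n, Continuous (e n) := fun n => (c1 n).add (c2 n)
  -- The term `‖x n t‖²` in the energy balance is replaced by its lower bound `2⟨x n t, u t⟩ - ‖u
  -- t‖²`, which has a limit under weak convergence, namely `‖u t‖²`.
  let J : ℕ → ℝ := fun n => ‖u₀‖ ^ 2 + 2 * (∫ r in (0 : ℝ)..t, inner ℝ (x n r) f)
    - (2 * inner ℝ (x n t) (u t) - ‖u t‖ ^ 2)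
  have hJ : Tendsto J atTop
      (𝓝 (‖u₀‖ ^ 2 + 2 * (∫ r in (0 : ℝ)..t, inner ℝ f (u r)) - ‖u t‖ ^ 2)) := by
    have e1 : ‖u₀‖ ^ 2 + 2 * (∫ r in (0 : ℝ)..t, inner ℝ f (u r)) - ‖u t‖ ^ 2
        = ‖u₀‖ ^ 2 + 2 * (∫ r in (0 : ℝ)..t, inner ℝ (u r) f)
          - (2 * inner ℝ (u t) (u t) - ‖u t‖ ^ 2) := by
      rw [real_inner_self_eq_norm_sq]
      simp only [real_inner_comm f]
      ring
    rw [e1]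
    exact (((h.integral_inner_tendsto hν hβ f le_rfl ht).const_mul 2).const_add _).sub
      (((h.tendsto t ht (u t)).const_mul 2).sub_const _)
  have hI : ∀ᶠ n in atTop, ∫ r in (0 : ℝ)..t, e n r ≤ J n := by
    filter_upwards [eventually_ge_atTop ⌈t⌉₊] with n hn
    have h1 := h.approx.energy_eq (n := n) (t := t) ⟨ht, Nat.ceil_le.1 hn⟩
    have h2 : ∫ r in (0 : ℝ)..t, e n r = 2 * ν * (∫ r in (0 : ℝ)..t, hDotOneSq (x n r))
        + 2 * β * ∫ r in (0 : ℝ)..t, ‖x n r‖ ^ 2 := by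
      rw [← intervalIntegral.integral_const_mul, ← intervalIntegral.integral_const_mul,
        ← intervalIntegral.integral_add ((c1 n).intervalIntegrable _ _)
          ((c2 n).intervalIntegrable _ _)]
    have h3 := pow_le_pow_left₀ (norm_nonneg _) (h.approx.init_le n) 2
    have h4 : 2 * inner ℝ (x n t) (u t) - ‖u t‖ ^ 2 ≤ ‖x n t‖ ^ 2 := by
      have := real_inner_le_norm (x n t) (u t)
      nlinarith [sq_nonneg (‖x n t‖ - ‖u t‖)]
    simp only [J, real_inner_comm f] at *
    linarith
  have hJ0 : 0 ≤ ‖u₀‖ ^ 2 + 2 * (∫ r in (0 : ℝ)..t, inner ℝ f (u r)) - ‖u t‖ ^ 2 := by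
    refine ge_of_tendsto hJ ?_
    filter_upwards [hI] with n hn
    exact (intervalIntegral.integral_nonneg ht fun r _ => he0 n r).trans hn
  -- Viscous dissipation and damping are kept together in one limit inferior, so a single use of
  -- Fatou's lemma treats both.
  refine ⟨hJ0, fun r => liminf (fun n => ENNReal.ofReal (e n r)) atTop, ?_, ?_, ?_⟩
  · exact (Measurable.liminf fun n => (hec n).measurable.ennreal_ofReal).aemeasurable
  · intro r hr hD
    exact memHDotOne_of_liminf (fun n => h.approx.one n r) (h.tendsto r hr.1) (by positivity)
      (by positivity) hD
  · refine (lintegral_liminf_le fun n => (hec n).measurable.ennreal_ofReal).trans ?_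
    rw [← (ENNReal.continuous_ofReal.tendsto _ |>.comp hJ).liminf_eq]
    refine liminf_le_liminf ?_
    filter_upwards [hI] with n hn
    rw [← ofReal_integral_eq_lintegral_ofReal ((hec n).integrableOn_Icc)
      (Eventually.of_forall (he0 n)), integral_Icc_eq_integral_Ioc,
      ← intervalIntegral.integral_of_le ht]
    exact ENNReal.ofReal_le_ofReal hn

lemma IsLimit.ae_memHDotOne (h : IsLimit ν β u₀ f w x u) (hν : 0 < ν) (hβ : 0 < β) (T : ℝ) :
    ∀ᵐ t ∂(volume.restrict (Icc 0 T)), MemHDotOne (u t) := by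
  rcases lt_or_ge T 0 with hT | hT
  · simp [Icc_eq_empty (not_le.2 hT)]
  obtain ⟨-, D, hDm, hD, hDl⟩ := h.exists_energy hν hβ hT
  filter_upwards [ae_lt_top' hDm (hDl.trans_lt ENNReal.ofReal_lt_top).ne,
    ae_restrict_mem measurableSet_Icc] with t h1 h2
  exact (hD t h2 h1.ne).1

lemma IsLimit.aestronglyMeasurable_weakPartial (h : IsLimit ν β u₀ f w x u) (hν : 0 < ν)
    (hβ : 0 < β) (T : ℝ) (j : Fin 3) :
    AEStronglyMeasurable (fun t => weakPartial j (u t)) (volume.restrict (Icc 0 T)) := by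
  refine aestronglyMeasurable_of_inner_testField fun g hg => ?_
  have h1 : AEStronglyMeasurable (fun t => - inner ℝ (u t) (toL2 (pdv j g)))
    (volume.restrict (Icc 0 T)) := ((h.aestronglyMeasurable T).inner aestronglyMeasurable_const).neg
  refine h1.congr ?_
  filter_upwards [h.ae_memHDotOne hν hβ T] with t ht
  rw [isWeakPartial_iff.1 (ht.isWeakPartial j) g hg, neg_neg]

lemma IsLimit.integrable_norm_sq (h : IsLimit ν β u₀ f w x u) (hν : 0 < ν) (hβ : 0 < β) (T : ℝ) :
    Integrable (fun t => ‖u t‖ ^ 2) (volume.restrict (Icc 0 T)) := by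
  refine Integrable.mono' (integrable_const (√(energyBound β u₀ f T) ^ 2))
    ((h.aestronglyMeasurable T).norm.pow 2) ?_
  filter_upwards [ae_restrict_mem measurableSet_Icc] with t ht
  rw [norm_pow, norm_norm]
  gcongr
  exact h.norm_le hν hβ ht

lemma IsLimit.integrable_hDotOneSq_and_le (h : IsLimit ν β u₀ f w x u) (hν : 0 < ν) (hβ : 0 < β)
    {T : ℝ} (hT : 0 ≤ T) :
    Integrable (fun t => hDotOneSq (u t)) (volume.restrict (Icc 0 T)) ∧
    ∫ r in Icc 0 T, (2 * ν * hDotOneSq (u r) + 2 * β * ‖u r‖ ^ 2)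
      ≤ ‖u₀‖ ^ 2 + 2 * (∫ r in (0 : ℝ)..T, inner ℝ f (u r)) - ‖u T‖ ^ 2 := by
  obtain ⟨hJ0, D, hDm, hD, hDl⟩ := h.exists_energy hν hβ hT
  have hle : ∀ᵐ r ∂(volume.restrict (Icc 0 T)),
      ENNReal.ofReal (2 * ν * hDotOneSq (u r) + 2 * β * ‖u r‖ ^ 2) ≤ D r := by
    filter_upwards [ae_lt_top' hDm (hDl.trans_lt ENNReal.ofReal_lt_top).ne,
      ae_restrict_mem measurableSet_Icc] with t h1 h2
    exact (hD t h2 h1.ne).2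
  have hl := (lintegral_mono_ae hle).trans hDl
  have hm : AEStronglyMeasurable (fun t => hDotOneSq (u t)) (volume.restrict (Icc 0 T)) :=
    Finset.aestronglyMeasurable_fun_sum _ fun j _ =>
      (h.aestronglyMeasurable_weakPartial hν hβ T j).norm.pow 2
  have hm2 : AEStronglyMeasurable (fun r => 2 * ν * hDotOneSq (u r) + 2 * β * ‖u r‖ ^ 2)
    (volume.restrict (Icc 0 T)) := (hm.const_mul _).add
      (((h.aestronglyMeasurable T).norm.pow 2).const_mul _)
  have h0 : ∀ r, 0 ≤ 2 * ν * hDotOneSq (u r) + 2 * β * ‖u r‖ ^ 2 := fun r => by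
    have := hDotOneSq_nonneg (u r)
    positivity
  have hint : Integrable (fun r => 2 * ν * hDotOneSq (u r) + 2 * β * ‖u r‖ ^ 2)
      (volume.restrict (Icc 0 T)) := by
    refine ⟨hm2, (hasFiniteIntegral_iff_ofReal (Eventually.of_forall h0)).2 ?_⟩
    exact hl.trans_lt ENNReal.ofReal_lt_top
  refine ⟨?_, ?_⟩
  · refine Integrable.mono' (hint.const_mul (2 * ν)⁻¹) hm (Eventually.of_forall fun r => ?_)
    rw [Real.norm_of_nonneg (hDotOneSq_nonneg _), inv_mul_eq_div, le_div_iff₀ (by positivity)]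
    have : 0 ≤ 2 * β * ‖u r‖ ^ 2 := by positivity
    linarith
  · rw [integral_eq_lintegral_of_nonneg_ae (Eventually.of_forall h0) hm2]
    exact ENNReal.toReal_le_of_le_ofReal hJ0 hl

lemma IsLimit.integrable_hDotOneSq (h : IsLimit ν β u₀ f w x u) (hν : 0 < ν) (hβ : 0 < β) (T : ℝ) :
    Integrable (fun t => hDotOneSq (u t)) (volume.restrict (Icc 0 T)) := by
  rcases lt_or_ge T 0 with hT | hT
  · simp [Icc_eq_empty (not_le.2 hT)]
  · exact (h.integrable_hDotOneSq_and_le hν hβ hT).1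

lemma IsLimit.memL2LocHDotOne (h : IsLimit ν β u₀ f w x u) (hν : 0 < ν) (hβ : 0 < β) :
    MemL2LocHDotOne u := by
  intro T _
  refine ⟨h.ae_memHDotOne hν hβ T, fun j => ?_⟩
  have hm := h.aestronglyMeasurable_weakPartial hν hβ T j
  rw [memLp_two_iff_integrable_sq_norm hm]
  refine (h.integrable_hDotOneSq hν hβ T).mono' (hm.norm.pow 2) (Eventually.of_forall fun t => ?_)
  rw [norm_pow, norm_norm]
  exact Finset.single_le_sum (f := fun j => ‖weakPartial j (u t)‖ ^ 2)
    (fun _ _ => sq_nonneg _) (Finset.mem_univ j)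

theorem IsLimit.energy_inequality (h : IsLimit ν β u₀ f w x u) (hν : 0 < ν) (hβ : 0 < β) {t : ℝ}
    (ht : 0 ≤ t) : ‖u t‖ ^ 2 ≤ ‖u₀‖ ^ 2 - 2 * ν * (∫ s in (0 : ℝ)..t, hDotOneSq (u s))
      + 2 * (∫ s in (0 : ℝ)..t, inner ℝ f (u s)) - 2 * β * (∫ s in (0 : ℝ)..t, ‖u s‖ ^ 2) := by
  obtain ⟨h1, h2⟩ := h.integrable_hDotOneSq_and_le hν hβ ht
  rw [integral_add (h1.const_mul _) ((h.integrable_norm_sq hν hβ t).const_mul _),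
    integral_const_mul, integral_const_mul, integral_Icc_eq_integral_Ioc,
    integral_Icc_eq_integral_Ioc, ← intervalIntegral.integral_of_le ht,
    ← intervalIntegral.integral_of_le ht] at h2
  linarith

end Limit

/-! ### Passage to the limit in the weak formulation -/

/-- The momentum flux `v_j v - ν ∂_j v`. -/
def flux (ν : ℝ) (j : Fin 3) (v : L2) : L2 := prodF j v v - ν • weakPartial j v

lemma nsForm_eq_flux (ν β : ℝ) (f v w : L2) :
    nsForm ν β f v w = ∑ j, inner ℝ (flux ν j v) (weakPartial j w) + inner ℝ (f - β • v) w := rfl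

lemma MemHDotOne.norm_prodF_self_le {v : L2} (hv : MemHDotOne v) {M : ℝ} (hM : ‖v‖ ≤ M)
    (j : Fin 3) : ‖prodF j v v‖ ≤ 3 * hDotOneSq v + (ladyConst * M) ^ 2 := by
  have h1 := norm_prodF_le j hv.memLp_four hv.memLp_four
  have h2 := hv.normFour_sq_le hM one_pos
  have h3 := gradSum_sq_le v
  simp only [one_mul, one_pow, div_one] at h2
  nlinarith

lemma norm_weakPartial_le (v : L2) (j : Fin 3) : ‖weakPartial j v‖ ≤ 1 + hDotOneSq v := by
  have h1 : ‖weakPartial j v‖ ^ 2 ≤ hDotOneSq v :=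
    Finset.single_le_sum (f := fun j => ‖weakPartial j v‖ ^ 2)
      (fun _ _ => sq_nonneg _) (Finset.mem_univ j)
  nlinarith [sq_nonneg (‖weakPartial j v‖ - 1)]

lemma MemHDotOne.norm_flux_le {v : L2} (hv : MemHDotOne v) {ν M : ℝ} (hν : 0 ≤ ν) (hM : ‖v‖ ≤ M)
    (j : Fin 3) : ‖flux ν j v‖ ≤ (3 + ν) * hDotOneSq v + ((ladyConst * M) ^ 2 + ν) := by
  refine (norm_sub_le _ _).trans ?_
  rw [norm_smul, Real.norm_of_nonneg hν]
  have h1 := hv.norm_prodF_self_le hM j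
  have h2 := mul_le_mul_of_nonneg_left (norm_weakPartial_le v j) hν
  linarith

lemma MemHDotOne.inner_flux_testField {v : L2} (hv : MemHDotOne v) (ν : ℝ) (j : Fin 3)
    {g : E3 → E3} (hg : IsTestField g) :
    inner ℝ (flux ν j v) (toL2 g) = quadForm j g v + ν * inner ℝ v (toL2 (pdv j g)) := by
  rw [flux, inner_sub_left, inner_prodF_testField j hg hv, real_inner_smul_left,
    isWeakPartial_iff.1 (hv.isWeakPartial j) g hg]
  ring

lemma hDotOneSq_sub_le {v v' : L2} (h : MemHDotOne v) (h' : MemHDotOne v') :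
    hDotOneSq (v - v') ≤ 2 * (hDotOneSq v + hDotOneSq v') := by
  simp only [hDotOneSq]
  rw [← Finset.sum_add_distrib, Finset.mul_sum]
  refine Finset.sum_le_sum fun j _ => ?_
  rw [weakPartial_sub h h']
  have h1 := norm_sub_le (weakPartial j v) (weakPartial j v')
  have h2 := pow_le_pow_left₀ (norm_nonneg _) h1 2
  nlinarith [sq_nonneg (‖weakPartial j v‖ - ‖weakPartial j v'‖)]

/-- Convergence of integrated pairings follows from convergence on test fields. -/
lemma tendsto_integral_inner_of_testField {α : Type*} [MeasurableSpace α] {μ : Measure α}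
    {F : ℕ → α → L2} {G : α → L2} {B : ℝ} (hF : ∀ᶠ n in atTop, Integrable (F n) μ)
    (hFB : ∀ᶠ n in atTop, ∫ t, ‖F n t‖ ∂μ ≤ B) (hG : Integrable G μ) (hGB : ∫ t, ‖G t‖ ∂μ ≤ B)
    (h : ∀ g, IsTestField g → Tendsto (fun n => ∫ t, inner ℝ (F n t) (toL2 g) ∂μ) atTop
      (𝓝 (∫ t, inner ℝ (G t) (toL2 g) ∂μ))) (a : L2) :
    Tendsto (fun n => ∫ t, inner ℝ (F n t) a ∂μ) atTop (𝓝 (∫ t, inner ℝ (G t) a ∂μ)) := by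
  have hB0 : 0 ≤ B := (integral_nonneg fun _ => norm_nonneg _).trans hGB
  -- A uniform `L¹` bound in time makes the integrated pairing Lipschitz in the vector, with one
  -- constant for the sequence and its limit.
  have key : ∀ (H : α → L2) (b : L2), Integrable H μ → ∫ t, ‖H t‖ ∂μ ≤ B →
      |∫ t, inner ℝ (H t) a ∂μ - ∫ t, inner ℝ (H t) b ∂μ| ≤ B * ‖a - b‖ := by
    intro H b hH hHB
    rw [← integral_sub (hH.inner_const a) (hH.inner_const b), ← Real.norm_eq_abs]
    refine (norm_integral_le_of_norm_le (hH.norm.mul_const ‖a - b‖)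
      (Eventually.of_forall fun t => ?_)).trans ?_
    · rw [Real.norm_eq_abs]; exact abs_inner_sub_le _ _ _ le_rfl
    · rw [integral_mul_const]; gcongr
  rw [Metric.tendsto_atTop']
  intro ε hε
  obtain ⟨g, hg, hga⟩ := exists_testField_near a (ε := ε / (4 * (B + 1))) (by positivity)
  have hsm : B * ‖a - toL2 g‖ ≤ ε / 4 := by
    calc B * ‖a - toL2 g‖ ≤ (B + 1) * (ε / (4 * (B + 1))) := by gcongr; linarith
      _ = ε / 4 := by field_simp
  have hev := (Metric.tendsto_nhds.1 (h g hg)) (ε / 4) (by positivity)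
  obtain ⟨N, hN⟩ := eventually_atTop.1 (hF.and (hFB.and hev))
  refine ⟨N, fun n hn => ?_⟩
  obtain ⟨h1, h2, h3⟩ := hN n hn.le
  have k1 := (key _ (toL2 g) h1 h2).trans hsm
  have k2 := (key _ (toL2 g) hG hGB).trans hsm
  rw [Real.dist_eq] at h3 ⊢
  rw [abs_le] at k1 k2
  rw [abs_lt] at h3 ⊢
  constructor <;> linarith

section Limit

variable {ν β : ℝ} {u₀ f : L2} {w : ℕ → solenoidalOne} {x : ℕ → ℝ → L2} {u : ℝ → L2}

/-- At each time the differences converge weakly to zero, so their local averages converge strongly;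
dominated convergence then integrates this in time. -/
lemma IsLimit.integral_avgSq_tendsto (h : IsLimit ν β u₀ f w x u) (hν : 0 < ν) (hβ : 0 < β) (T : ℝ)
    {δ : ℝ} (hδ : 0 < δ) (R : ℝ) :
    Tendsto (fun n => ∫ r in Icc 0 T, avgSq δ R (x n r - u r)) atTop (𝓝 0) := by
  obtain ⟨C, hC0, hC⟩ := exists_avgSq_le hδ R
  set N := ⌈T⌉₊
  set M := √(energyBound β u₀ f T)
  have h0 : avgSq δ R 0 = 0 := le_antisymm (by simpa using hC 0) (avgSq_nonneg _ _ _)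
  have hM : ∀ n, ∀ r ∈ Icc 0 T, ‖x (n + N) r - u r‖ ≤ 2 * M := by
    intro n r hr
    have hn : T ≤ ((n + N : ℕ) : ℝ) := Nat.ceil_le.1 (Nat.le_add_left _ _)
    have h1 := h.approx.norm_le hν hβ hn hr
    have h2 := h.norm_le hν hβ hr
    exact (norm_sub_le _ _).trans (by linarith)
  -- The index is shifted so that the uniform bound, valid once the time horizon of the
  -- approximation reaches `T`, holds for every term.
  rw [← tendsto_add_atTop_iff_nat N]
  suffices Tendsto (fun n => ∫ r in Icc 0 T, avgSq δ R (x (n + N) r - u r)) atTop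
      (𝓝 (∫ _ in Icc 0 T, (0 : ℝ))) by simpa using this
  refine tendsto_integral_of_dominated_convergence (fun _ => C * (2 * M) ^ 2) (fun n => ?_)
    (integrable_const (μ := volume.restrict (Icc 0 T)) _) (fun n => ?_) ?_
  · exact (continuous_avgSq hδ R).comp_aestronglyMeasurable
      ((h.approx.cont _).aestronglyMeasurable.sub (h.aestronglyMeasurable T))
  · filter_upwards [ae_restrict_mem measurableSet_Icc] with r hr
    rw [Real.norm_of_nonneg (avgSq_nonneg _ _ _)]
    refine (hC _).trans ?_
    gcongr
    exact hM n r hr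
  · filter_upwards [ae_restrict_mem measurableSet_Icc] with r hr
    rw [← h0]
    refine tendsto_avgSq hδ R (fun n => hM n r hr) fun a => ?_
    simp only [inner_sub_left, inner_zero_left]
    rw [← sub_self (inner ℝ (u r) a)]
    exact (((tendsto_add_atTop_iff_nat N).2 (h.tendsto r hr.1 a))).sub_const _

lemma IsLimit.integrable_quadForm_limit (h : IsLimit ν β u₀ f w x u) (hν : 0 < ν) (hβ : 0 < β)
    (T : ℝ) (j : Fin 3) {g : E3 → E3} (hg : IsTestField g) :
    Integrable (fun r => quadForm j g (u r)) (volume.restrict (Icc 0 T)) := by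
  obtain ⟨c, R, hc, hq⟩ := exists_abs_quadForm_sub_le j hg
  refine Integrable.mono' (((h.integrable_norm_sq hν hβ T).const_mul (2 * c)))
    ((continuous_quadForm j hg).comp_aestronglyMeasurable (h.aestronglyMeasurable T))
    (Eventually.of_forall fun r => ?_)
  have h1 := hq (u r) 0 1 one_pos
  have h0 : quadForm j g 0 = 0 := by
    have : ∀ᵐ y : E3, (0 : L2) y j * inner ℝ ((0 : L2) y) (g y) = 0 := by
      filter_upwards [Lp.coeFn_zero E3 2 (volume : Measure E3)] with y hy
      rw [hy]; simp
    rw [quadForm, integral_congr_ae this, integral_zero]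
  have h2 := locSq_le_norm_sq R (u r)
  rw [h0, sub_zero, sub_zero, norm_zero] at h1
  rw [Real.norm_eq_abs]
  refine h1.trans ?_
  have : c * locSq R (u r) ≤ c * ‖u r‖ ^ 2 := by gcongr
  simp only [div_one, one_mul]
  linarith

/-- This is where compactness enters. The error splits into a gradient contribution, small with the
averaging radius by the energy bound, and local averages that tend to zero for each fixed radius. -/
lemma IsLimit.integral_quadForm_tendsto (h : IsLimit ν β u₀ f w x u) (hν : 0 < ν) (hβ : 0 < β)
    {T : ℝ} (hT : 0 ≤ T) (j : Fin 3) {g : E3 → E3} (hg : IsTestField g) :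
    Tendsto (fun n => ∫ r in Icc 0 T, quadForm j g (x n r)) atTop
      (𝓝 (∫ r in Icc 0 T, quadForm j g (u r))) := by
  obtain ⟨c, R, hc, hq⟩ := exists_abs_quadForm_sub_le j hg
  set M := √(energyBound β u₀ f T) with hMdef
  have hM0 : 0 ≤ M := Real.sqrt_nonneg _
  set A := energyBound β u₀ f T / (2 * ν) with hA
  have hA0 : 0 ≤ A := div_nonneg (energyBound_nonneg hβ u₀ f hT) (by positivity)
  set A' := ∫ r in Icc 0 T, hDotOneSq (u r) with hA'
  have hA'0 : 0 ≤ A' := integral_nonneg fun r => hDotOneSq_nonneg _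
  have hiu := h.integrable_hDotOneSq hν hβ T
  set S := 12 * (A + A') + 2 * M ^ 2 * T with hS
  have hS0 : 0 ≤ S := by positivity
  rw [tendsto_iff_norm_sub_tendsto_zero, Metric.tendsto_atTop']
  intro η hη
  -- The same `ε` serves as averaging radius and as Young parameter: dividing the gradient term `ε²
  -- * gradSum²` by `ε` still leaves a factor `ε`. All terms other than the averages then total at
  -- most `c * S * ε ≤ η / 2`.
  set ε := η / (2 * ((c + 1) * (S + 1))) with hε
  have hε0 : 0 < ε := by positivity
  have hav := h.integral_avgSq_tendsto hν hβ T hε0 R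
  have hav' : Tendsto (fun n => c * (2 / ε * ∫ r in Icc 0 T, avgSq ε R (x n r - u r))) atTop
      (𝓝 0) := by simpa using (hav.const_mul (2 / ε)).const_mul c
  obtain ⟨N, hN⟩ := eventually_atTop.1
    (((tendsto_order.1 hav').2 (η / 2) (half_pos hη)).and (eventually_ge_atTop ⌈T⌉₊))
  refine ⟨N, fun n hn => ?_⟩
  obtain ⟨hn1, hn2⟩ := hN n hn.le
  have hTn : T ≤ n := Nat.ceil_le.1 hn2
  have hix : Integrable (fun r => hDotOneSq (x n r)) (volume.restrict (Icc 0 T)) :=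
    (h.approx.continuous_hDotOneSq n).integrableOn_Icc
  have hxA : ∫ r in Icc 0 T, hDotOneSq (x n r) ≤ A := by
    rw [integral_Icc_eq_integral_Ioc, ← intervalIntegral.integral_of_le hT]
    exact h.approx.integral_hDotOneSq_le hν hβ hT hTn
  obtain ⟨C, hC0, hC⟩ := exists_avgSq_le hε0 R
  have hia : Integrable (fun r => avgSq ε R (x n r - u r)) (volume.restrict (Icc 0 T)) := by
    refine Integrable.mono' (integrable_const (C * (2 * M) ^ 2))
      ((continuous_avgSq hε0 R).comp_aestronglyMeasurable
        ((h.approx.cont _).aestronglyMeasurable.sub (h.aestronglyMeasurable T))) ?_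
    filter_upwards [ae_restrict_mem measurableSet_Icc] with r hr
    rw [Real.norm_of_nonneg (avgSq_nonneg _ _ _)]
    refine (hC _).trans ?_
    gcongr
    have h1 := h.approx.norm_le hν hβ hTn hr
    have h2 := h.norm_le hν hβ hr
    exact (norm_sub_le _ _).trans (by linarith)
  have hiq : Integrable (fun r => quadForm j g (x n r)) (volume.restrict (Icc 0 T)) :=
    ((continuous_quadForm j hg).comp (h.approx.cont n)).integrableOn_Icc
  have i1 : Integrable (fun r => 12 * ε * (hDotOneSq (x n r) + hDotOneSq (u r)))
    (volume.restrict (Icc 0 T)) := (hix.add hiu).const_mul _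
  have i2 : Integrable (fun r => 2 / ε * avgSq ε R (x n r - u r)) (volume.restrict (Icc 0 T)) :=
    hia.const_mul _
  have i3 : Integrable (fun _ : ℝ => 2 * M ^ 2 * ε) (volume.restrict (Icc 0 T)) :=
    integrable_const _
  have hmain : ‖∫ r in Icc 0 T, (quadForm j g (x n r) - quadForm j g (u r))‖
      ≤ ∫ r in Icc 0 T, c * (12 * ε * (hDotOneSq (x n r) + hDotOneSq (u r))
        + 2 / ε * avgSq ε R (x n r - u r) + 2 * M ^ 2 * ε) := by
    refine norm_integral_le_of_norm_le (((i1.add i2).add i3).const_mul c) ?_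
    filter_upwards [ae_restrict_mem measurableSet_Icc, h.ae_memHDotOne hν hβ T] with r hr hur
    rw [Real.norm_eq_abs]
    refine (hq _ _ ε hε0).trans ?_
    refine mul_le_mul_of_nonneg_left ?_ hc
    have b1 := locSq_le hε0 R ((h.approx.one n r).sub hur)
    have b2 := gradSum_sq_le (x n r - u r)
    have b3 := hDotOneSq_sub_le (h.approx.one n r) hur
    have b4 := pow_le_pow_left₀ (norm_nonneg _) (h.approx.norm_le hν hβ hTn hr) 2
    have b5 := pow_le_pow_left₀ (norm_nonneg _) (h.norm_le hν hβ hr) 2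
    have b6 : locSq R (x n r - u r) / ε
        ≤ 12 * ε * (hDotOneSq (x n r) + hDotOneSq (u r)) + 2 / ε * avgSq ε R (x n r - u r) := by
      rw [div_le_iff₀ hε0]
      have e1 : (12 * ε * (hDotOneSq (x n r) + hDotOneSq (u r))
          + 2 / ε * avgSq ε R (x n r - u r)) * ε
          = 12 * ε ^ 2 * (hDotOneSq (x n r) + hDotOneSq (u r)) + 2 * avgSq ε R (x n r - u r) := by
        field_simp
      rw [e1]
      have e2 : gradSum (x n r - u r) ^ 2 ≤ 6 * (hDotOneSq (x n r) + hDotOneSq (u r)) := by linarith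
      have e3 := mul_le_mul_of_nonneg_left e2 (sq_nonneg ε)
      nlinarith
    have b7 : ε * (‖x n r‖ ^ 2 + ‖u r‖ ^ 2) ≤ ε * (M ^ 2 + M ^ 2) := by gcongr
    linarith
  rw [← integral_sub hiq (h.integrable_quadForm_limit hν hβ T j hg)]
  rw [Real.dist_eq, sub_zero, abs_of_nonneg (norm_nonneg _)]
  refine hmain.trans_lt ?_
  have i12 : Integrable (fun r => 12 * ε * (hDotOneSq (x n r) + hDotOneSq (u r))
    + 2 / ε * avgSq ε R (x n r - u r)) (volume.restrict (Icc 0 T)) := i1.add i2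
  rw [integral_const_mul, integral_add i12 i3, integral_add i1 i2, integral_const_mul,
    integral_const_mul, integral_add hix hiu, integral_const]
  simp only [measureReal_restrict_apply_univ, Real.volume_real_Icc, sub_zero, max_eq_left hT,
    smul_eq_mul]
  have hfin : c * (12 * ε * (∫ r in Icc 0 T, hDotOneSq (x n r)) + 12 * ε * A' + T * (2 * M ^ 2 * ε))
      ≤ η / 2 := by
    calc _ ≤ c * (12 * ε * A + 12 * ε * A' + T * (2 * M ^ 2 * ε)) := by gcongr
      _ = c * S * ε := by rw [hS]; ring
      _ ≤ ((c + 1) * (S + 1)) * ε := by gcongr <;> linarith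
      _ = η / 2 := by rw [hε]; field_simp
  rw [← hA']
  linarith

/-- Pairing with a test field gives `quadForm`, a continuous function on `L²`, composed with a
measurable curve. -/
lemma IsLimit.aestronglyMeasurable_prodF (h : IsLimit ν β u₀ f w x u) (hν : 0 < ν) (hβ : 0 < β)
    (T : ℝ) (j : Fin 3) :
    AEStronglyMeasurable (fun t => prodF j (u t) (u t)) (volume.restrict (Icc 0 T)) := by
  refine aestronglyMeasurable_of_inner_testField fun g hg => ?_
  refine ((continuous_quadForm j hg).comp_aestronglyMeasurable (h.aestronglyMeasurable T)).congr ?_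
  filter_upwards [h.ae_memHDotOne hν hβ T] with t ht
  exact (inner_prodF_testField j hg ht).symm

lemma IsLimit.integrable_prodF (h : IsLimit ν β u₀ f w x u) (hν : 0 < ν) (hβ : 0 < β)
    (T : ℝ) (j : Fin 3) :
    Integrable (fun t => prodF j (u t) (u t)) (volume.restrict (Icc 0 T)) := by
  have hi : Integrable (fun t => 3 * hDotOneSq (u t) + (ladyConst * √(energyBound β u₀ f T)) ^ 2)
    (volume.restrict (Icc 0 T)) :=
    ((h.integrable_hDotOneSq hν hβ T).const_mul 3).add (integrable_const _)
  refine hi.mono' (h.aestronglyMeasurable_prodF hν hβ T j) ?_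
  filter_upwards [h.ae_memHDotOne hν hβ T, ae_restrict_mem measurableSet_Icc] with t h1 h2
  exact h1.norm_prodF_self_le (h.norm_le hν hβ h2) j

lemma IsLimit.integrable_weakPartial (h : IsLimit ν β u₀ f w x u) (hν : 0 < ν) (hβ : 0 < β)
    (T : ℝ) (j : Fin 3) :
    Integrable (fun t => weakPartial j (u t)) (volume.restrict (Icc 0 T)) := by
  have hi : Integrable (fun t => 1 + hDotOneSq (u t)) (volume.restrict (Icc 0 T)) :=
    (integrable_const _).add (h.integrable_hDotOneSq hν hβ T)
  exact hi.mono' (h.aestronglyMeasurable_weakPartial hν hβ T j)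
    (Eventually.of_forall fun t => norm_weakPartial_le _ j)

lemma IsLimit.integrable_flux (h : IsLimit ν β u₀ f w x u) (hν : 0 < ν) (hβ : 0 < β)
    (T : ℝ) (j : Fin 3) :
    Integrable (fun t => flux ν j (u t)) (volume.restrict (Icc 0 T)) :=
  (h.integrable_prodF hν hβ T j).sub ((h.integrable_weakPartial hν hβ T j).smul ν)

lemma IsLimit.integrable_limit (h : IsLimit ν β u₀ f w x u) (hν : 0 < ν) (hβ : 0 < β)
    (T : ℝ) : Integrable u (volume.restrict (Icc 0 T)) := by
  refine (integrable_const (√(energyBound β u₀ f T))).mono' (h.aestronglyMeasurable T) ?_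
  filter_upwards [ae_restrict_mem measurableSet_Icc] with t ht
  exact h.norm_le hν hβ ht

lemma IsApprox.continuous_flux (h : IsApprox ν β u₀ f w x) (n : ℕ) (j : Fin 3) :
    Continuous fun t => flux ν j (x n t) := (h.contP n j).sub ((h.contD n j).const_smul ν)

/-- For test fields the viscous part is linear in the approximation after integration by parts, and
the quadratic part is known. The dissipation bounds the fluxes in `L¹` of time, which allows an
arbitrary `a` by density. -/
lemma IsLimit.integral_flux_tendsto (h : IsLimit ν β u₀ f w x u) (hν : 0 < ν) (hβ : 0 < β)
    {T : ℝ} (hT : 0 ≤ T) (j : Fin 3) (a : L2) :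
    Tendsto (fun n => ∫ r in Icc 0 T, inner ℝ (flux ν j (x n r)) a) atTop
      (𝓝 (∫ r in Icc 0 T, inner ℝ (flux ν j (u r)) a)) := by
  set M := √(energyBound β u₀ f T) with hMdef
  set A := energyBound β u₀ f T / (2 * ν) with hA
  set B := (3 + ν) * A + ((ladyConst * M) ^ 2 + ν) * T with hB
  refine tendsto_integral_inner_of_testField
    (B := max B (∫ t in Icc 0 T, ‖flux ν j (u t)‖)) ?_ ?_ (h.integrable_flux hν hβ T j)
    (le_max_right _ _) (fun g hg => ?_) a
  · exact Eventually.of_forall fun n => (h.approx.continuous_flux n j).integrableOn_Icc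
  · filter_upwards [eventually_ge_atTop ⌈T⌉₊] with n hn
    have hTn : T ≤ n := Nat.ceil_le.1 hn
    refine le_trans ?_ (le_max_left _ _)
    have c1 := (h.approx.continuous_hDotOneSq n).const_mul (3 + ν)
    have hxA : ∫ r in Icc 0 T, hDotOneSq (x n r) ≤ A := by
      rw [integral_Icc_eq_integral_Ioc, ← intervalIntegral.integral_of_le hT]
      exact h.approx.integral_hDotOneSq_le hν hβ hT hTn
    calc ∫ t in Icc 0 T, ‖flux ν j (x n t)‖
        ≤ ∫ t in Icc 0 T, ((3 + ν) * hDotOneSq (x n t) + ((ladyConst * M) ^ 2 + ν)) := by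
          refine setIntegral_mono_on (h.approx.continuous_flux n j).norm.integrableOn_Icc
            (c1.add continuous_const).integrableOn_Icc measurableSet_Icc fun t ht => ?_
          exact (h.approx.one n t).norm_flux_le hν.le (h.approx.norm_le hν hβ hTn ht) j
      _ = (3 + ν) * (∫ t in Icc 0 T, hDotOneSq (x n t)) + ((ladyConst * M) ^ 2 + ν) * T := by
          rw [integral_add c1.integrableOn_Icc (integrable_const _), integral_const_mul]
          simp only [integral_const, measureReal_restrict_apply_univ, Real.volume_real_Icc, sub_zero,
            max_eq_left hT, smul_eq_mul]
          ring
      _ ≤ B := by rw [hB]; gcongr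
  · have e1 : ∀ n, ∫ t in Icc 0 T, inner ℝ (flux ν j (x n t)) (toL2 g)
        = (∫ t in Icc 0 T, quadForm j g (x n t))
          + ν * ∫ t in Icc 0 T, inner ℝ (x n t) (toL2 (pdv j g)) := by
      intro n
      simp only [(h.approx.one n _).inner_flux_testField ν j hg]
      have c1 : Continuous fun t => quadForm j g (x n t) :=
        (continuous_quadForm j hg).comp (h.approx.cont n)
      rw [integral_add c1.integrableOn_Icc
        (((h.approx.cont n).inner continuous_const).const_mul ν).integrableOn_Icc,
        integral_const_mul]
    have e2 : ∫ t in Icc 0 T, inner ℝ (flux ν j (u t)) (toL2 g)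
        = (∫ t in Icc 0 T, quadForm j g (u t))
          + ν * ∫ t in Icc 0 T, inner ℝ (u t) (toL2 (pdv j g)) := by
      rw [← integral_const_mul, ← integral_add (h.integrable_quadForm_limit hν hβ T j hg)
        (((h.integrable_limit hν hβ T).inner_const _).const_mul ν)]
      refine integral_congr_ae ?_
      filter_upwards [h.ae_memHDotOne hν hβ T] with t ht
      exact ht.inner_flux_testField ν j hg
    simp only [e1, e2]
    refine (h.integral_quadForm_tendsto hν hβ hT j hg).add (Tendsto.const_mul ν ?_)
    have := h.integral_inner_tendsto hν hβ (toL2 (pdv j g)) le_rfl hT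
    simpa only [integral_Icc_eq_integral_Ioc, ← intervalIntegral.integral_of_le hT] using this

lemma inner_integral_right {α : Type*} [MeasurableSpace α] {μ : Measure α} {F : α → L2}
    (hF : Integrable F μ) (a : L2) : ∫ t, inner ℝ (F t) a ∂μ = inner ℝ (∫ t, F t ∂μ) a := by
  rw [real_inner_comm, ← integral_inner hF a]
  simp only [real_inner_comm]

lemma integral_nsForm {μ : Measure ℝ} [IsFiniteMeasure μ] {v : ℝ → L2}
    (hF : ∀ j, Integrable (fun t => flux ν j (v t)) μ)
    (hv : Integrable v μ) (a : L2) : ∫ t, nsForm ν β f (v t) a ∂μ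
      = ∑ j, ∫ t, inner ℝ (flux ν j (v t)) (weakPartial j a) ∂μ
        + (μ.real univ * inner ℝ f a - β * ∫ t, inner ℝ (v t) a ∂μ) := by
  simp only [nsForm_eq_flux]
  have i1 : ∀ j, Integrable (fun t => inner ℝ (flux ν j (v t)) (weakPartial j a)) μ :=
    fun j => (hF j).inner_const _
  have i2 : Integrable (fun t => inner ℝ (v t) a) μ := hv.inner_const _
  have e : ∀ t, inner ℝ (f - β • v t) a = inner ℝ f a - β * inner ℝ (v t) a := fun t => by
    rw [inner_sub_left, real_inner_smul_left]
  simp only [e]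
  have i3 : Integrable (fun t => inner ℝ f a - β * inner ℝ (v t) a) μ :=
    (integrable_const _).sub (i2.const_mul β)
  rw [integral_add (integrable_finsetSum _ fun j _ => i1 j) i3, integral_finsetSum _ fun j _ => i1 j,
    integral_sub (integrable_const _) (i2.const_mul β), integral_const_mul]
  simp

/-- The weak formulation against divergence-free fields. -/
theorem IsLimit.weak_eq (h : IsLimit ν β u₀ f w x u) (hν : 0 < ν) (hβ : 0 < β)
    (hw : ∀ (v : solenoidalOne) (ε : ℝ), 0 < ε →
      ∃ k, ‖(v : L2) - w k‖ < ε ∧ ∀ j, ‖wpd j v - wpd j (w k)‖ < ε)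
    {T : ℝ} (hT : 0 ≤ T) (a : solenoidalOne) :
    inner ℝ (u T) (a : L2) - inner ℝ u₀ (a : L2)
      = ∑ j, inner ℝ (∫ t in Icc 0 T, flux ν j (u t)) (weakPartial j (a : L2))
        + inner ℝ (∫ t in Icc 0 T, (f - β • u t)) (a : L2) := by
  have hfu : Integrable (fun t => f - β • u t) (volume.restrict (Icc 0 T)) :=
    (integrable_const f).sub ((h.integrable_limit hν hβ T).smul β)
  -- For the basis vectors the identity is the limit of the Galerkin equations, which hold as soon
  -- as `k < n` and `T ≤ n`.
  have hk : ∀ k, inner ℝ (u T) (w k : L2) - inner ℝ u₀ (w k : L2)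
      = ∑ j, inner ℝ (∫ t in Icc 0 T, flux ν j (u t)) (wpd j (w k))
        + inner ℝ (∫ t in Icc 0 T, (f - β • u t)) (w k : L2) := by
    intro k
    have e1 : ∑ j, inner ℝ (∫ t in Icc 0 T, flux ν j (u t)) (wpd j (w k))
        + inner ℝ (∫ t in Icc 0 T, (f - β • u t)) (w k : L2)
        = ∑ j, (∫ t in Icc 0 T, inner ℝ (flux ν j (u t)) (weakPartial j (w k : L2)))
        + ((volume.restrict (Icc 0 T)).real univ * inner ℝ f (w k : L2)
          - β * ∫ t in Icc 0 T, inner ℝ (u t) (w k : L2)) := by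
      rw [← integral_nsForm (fun j => h.integrable_flux hν hβ T j) (h.integrable_limit hν hβ T)]
      simp only [nsForm_eq_flux]
      rw [integral_add (integrable_finsetSum _ fun j _ =>
          (h.integrable_flux hν hβ T j).inner_const _) (hfu.inner_const _),
        integral_finsetSum _ fun j _ => (h.integrable_flux hν hβ T j).inner_const _,
        inner_integral_right hfu]
      congr 1
      exact Finset.sum_congr rfl fun j _ =>
        (inner_integral_right (h.integrable_flux hν hβ T j) _).symm
    rw [e1, ← h.initial]
    refine tendsto_nhds_unique ((h.tendsto T hT (w k)).sub (h.tendsto 0 le_rfl (w k))) ?_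
    have hlim : Tendsto (fun n => ∑ j, (∫ t in Icc 0 T,
          inner ℝ (flux ν j (x n t)) (weakPartial j (w k : L2)))
        + ((volume.restrict (Icc 0 T)).real univ * inner ℝ f (w k : L2)
          - β * ∫ t in Icc 0 T, inner ℝ (x n t) (w k : L2))) atTop
        (𝓝 (∑ j, (∫ t in Icc 0 T, inner ℝ (flux ν j (u t)) (weakPartial j (w k : L2)))
        + ((volume.restrict (Icc 0 T)).real univ * inner ℝ f (w k : L2)
          - β * ∫ t in Icc 0 T, inner ℝ (u t) (w k : L2)))) := by
      refine (tendsto_finsetSum _ fun j _ => h.integral_flux_tendsto hν hβ hT j _).add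
        (tendsto_const_nhds.sub (Tendsto.const_mul β ?_))
      have := h.integral_inner_tendsto hν hβ (w k) le_rfl hT
      simpa only [integral_Icc_eq_integral_Ioc, ← intervalIntegral.integral_of_le hT] using this
    refine hlim.congr' ?_
    filter_upwards [eventually_gt_atTop k, eventually_ge_atTop ⌈T⌉₊] with n hn hnT
    have hTn : T ≤ n := Nat.ceil_le.1 hnT
    rw [h.approx.eqn k n hn 0 ⟨le_rfl, hT.trans hTn⟩ T ⟨hT, hTn⟩,
      ← integral_nsForm (fun j => (h.approx.continuous_flux n j).integrableOn_Icc)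
        (h.approx.cont n).integrableOn_Icc, integral_Icc_eq_integral_Ioc,
      intervalIntegral.integral_of_le hT]
  -- Both `a` and its derivatives are paired in the identity, hence density in the graph norm is
  -- needed.
  choose k hk1 hk2 using fun n : ℕ => hw a (1 / ((n : ℝ) + 1)) (by positivity)
  have hz : Tendsto (fun n : ℕ => 1 / ((n : ℝ) + 1)) atTop (𝓝 0) :=
    tendsto_one_div_add_atTop_nhds_zero_nat
  have t1 : Tendsto (fun n => (w (k n) : L2)) atTop (𝓝 (a : L2)) := by
    rw [tendsto_iff_norm_sub_tendsto_zero]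
    refine squeeze_zero (fun _ => norm_nonneg _) (fun n => ?_) hz
    rw [norm_sub_rev]; exact (hk1 n).le
  have t2 : ∀ j, Tendsto (fun n => wpd j (w (k n))) atTop (𝓝 (wpd j a)) := by
    intro j
    rw [tendsto_iff_norm_sub_tendsto_zero]
    refine squeeze_zero (fun _ => norm_nonneg _) (fun n => ?_) hz
    rw [norm_sub_rev]; exact (hk2 n j).le
  refine tendsto_nhds_unique
    ((tendsto_const_nhds.inner t1).sub (tendsto_const_nhds.inner t1)) ?_
  simp only [hk]
  exact (tendsto_finsetSum _ fun j _ => tendsto_const_nhds.inner (t2 j)).add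
    (tendsto_const_nhds.inner t1)

end Limit

/-! ### Jointly measurable representatives of curves in `L²` -/

lemma memLp_indicator_closedBall (δ : ℝ) (x : E3) :
    MemLp ((Metric.closedBall x δ).indicator fun _ : E3 => (1 : ℝ)) 2 volume :=
  memLp_indicator_const 2 measurableSet_closedBall _ (Or.inr measure_closedBall_lt_top.ne)

lemma inner_trans_indicator (v : L2) (δ : ℝ) (x : E3) (i : Fin 3) :
    inner ℝ v (trans (-x) (toL2 fun y =>
      (Metric.closedBall (0 : E3) δ).indicator (fun _ => (1 : ℝ)) y • basisVec i))
      = ∫ y in Metric.closedBall x δ, v y i := by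
  have hm : MemLp (fun y => (Metric.closedBall (0 : E3) δ).indicator (fun _ => (1 : ℝ)) y
      • basisVec i) 2 volume := (memLp_indicator_closedBall δ 0).continuousLinearMap_comp
        ((ContinuousLinearMap.id ℝ ℝ).smulRight (basisVec i))
  have e : ∀ y, (Metric.closedBall (0 : E3) δ).indicator (fun _ => (1 : ℝ)) (y + -x)
      = (Metric.closedBall x δ).indicator (fun _ => (1 : ℝ)) y := by
    intro y
    simp only [indicator, Metric.mem_closedBall, dist_eq_norm, sub_zero, ← sub_eq_add_neg]
  rw [trans_toL2 _ hm]
  simp only [e]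
  rw [inner_smul_basisVec v (memLp_indicator_closedBall δ x) i,
    ← integral_indicator measurableSet_closedBall]
  refine integral_congr_ae (Eventually.of_forall fun y => ?_)
  by_cases hy : y ∈ Metric.closedBall x δ <;> simp [hy]

/-- Averages of `F t` over small balls are pairings with translated indicators, so they are jointly
measurable in time and space. By Lebesgue differentiation they converge to `F t` for almost every
point at each time. -/
lemma exists_joint_representative {F : ℝ → L2} (hF : StronglyMeasurable F) (i : Fin 3) :
    ∃ p : ℝ × E3 → ℝ, StronglyMeasurable p ∧ ∀ t, ∀ᵐ x, p (t, x) = F t x i := by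
  let δ : ℕ → ℝ := fun m => 1 / ((m : ℝ) + 1)
  have hδ0 : ∀ m, 0 < δ m := fun m => by positivity
  have hδ : Tendsto δ atTop (𝓝[>] 0) := tendsto_nhdsWithin_iff.2
    ⟨tendsto_one_div_add_atTop_nhds_zero_nat, Eventually.of_forall hδ0⟩
  let K : ℕ → L2 := fun m => toL2 fun y =>
    (Metric.closedBall (0 : E3) (δ m)).indicator (fun _ => (1 : ℝ)) y • basisVec i
  let q : ℕ → ℝ × E3 → ℝ := fun m z =>
    (volume.real (Metric.closedBall (0 : E3) (δ m)))⁻¹ * inner ℝ (F z.1) (trans (-z.2) (K m))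
  have hq : ∀ m, StronglyMeasurable (q m) := fun m =>
    ((hF.comp_measurable measurable_fst).inner
      (((continuous_trans (K m)).comp continuous_neg).stronglyMeasurable.comp_measurable
        measurable_snd)).const_mul _
  refine ⟨fun z => limUnder atTop fun m => q m z, StronglyMeasurable.limUnder hq, fun t => ?_⟩
  have hli : LocallyIntegrable (fun x => F t x i) volume :=
    (memLp_coeFn_apply (F t) i).locallyIntegrable (by norm_num)
  filter_upwards [IsUnifLocDoublingMeasure.ae_tendsto_average (μ := (volume : Measure E3)) hli 1]
    with x hx
  have h1 := hx (fun _ => x) δ hδ (Eventually.of_forall fun m => by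
    rw [one_mul]; exact Metric.mem_closedBall_self (hδ0 m).le)
  refine Tendsto.limUnder_eq (h1.congr fun m => ?_)
  simp only [q, K]
  rw [inner_trans_indicator, setAverage_eq, smul_eq_mul, Measure.real, Measure.real,
    Measure.addHaar_closedBall_center]

/-- On a ball the spatial `L¹` norm is bounded by a linear function of the `L²` norm, so
integrability of `F` in time is enough. -/
lemma integrableOn_joint {F : ℝ → L2} {i : Fin 3} {p : ℝ × E3 → ℝ} (hp : StronglyMeasurable p)
    {T : ℝ} (hF : Integrable F (volume.restrict (Icc 0 T)))
    (hpF : ∀ᵐ t ∂volume.restrict (Icc 0 T), ∀ᵐ x, p (t, x) = F t x i) (R : ℝ) :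
    IntegrableOn p (Icc 0 T ×ˢ Metric.ball (0 : E3) R) := by
  rw [IntegrableOn, Measure.volume_eq_prod, ← Measure.prod_restrict,
    integrable_prod_iff hp.aestronglyMeasurable]
  have hfin : ∀ v : L2, Integrable (fun x => v x i) (volume.restrict (Metric.ball (0 : E3) R)) :=
    fun v => ((memLp_coeFn_apply v i).restrict _).integrable (by norm_num)
  refine ⟨?_, ?_⟩
  · filter_upwards [hpF] with t ht
    exact (hfin (F t)).congr (ae_restrict_of_ae (ht.mono fun x hx => hx.symm))
  · set V := volume.real (Metric.ball (0 : E3) R)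
    have hi : Integrable (fun t => (‖F t‖ + 1) * V + ‖F t‖) (volume.restrict (Icc 0 T)) :=
      ((hF.norm.add (integrable_const 1)).mul_const V).add hF.norm
    refine hi.mono' (hp.norm.aestronglyMeasurable.integral_prod_right') ?_
    filter_upwards [hpF] with t ht
    rw [Real.norm_of_nonneg (integral_nonneg fun _ => norm_nonneg _)]
    have e : ∫ x in Metric.ball (0 : E3) R, ‖p (t, x)‖
        = ∫ x in Metric.ball (0 : E3) R, ‖F t x i‖ :=
      integral_congr_ae (ae_restrict_of_ae (ht.mono fun x hx => by simp only [hx]))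
    rw [e]
    -- With this weight, the squared norm divided by `s` is at most `‖F t‖`; the added `1` keeps `s`
    -- positive.
    set s := ‖F t‖ + 1
    have hs : 0 < s := by positivity
    calc ∫ x in Metric.ball (0 : E3) R, ‖F t x i‖
        ≤ ∫ x in Metric.ball (0 : E3) R, (s + ‖F t x‖ ^ 2 / s) := by
          refine integral_mono (hfin (F t)).norm
            ((integrable_const s).add ((integrableOn_norm_sq R (F t)).div_const s)) fun x => ?_
          have h1 : ‖F t x i‖ ≤ ‖F t x‖ := abs_apply_le_norm (F t x) i
          have h2 : ‖F t x‖ ≤ s + ‖F t x‖ ^ 2 / s := by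
            have : s + ‖F t x‖ ^ 2 / s - ‖F t x‖
                = ((s - ‖F t x‖) ^ 2 + s * ‖F t x‖) / s := by field_simp; ring
            have h3 : 0 ≤ ((s - ‖F t x‖) ^ 2 + s * ‖F t x‖) / s := by positivity
            linarith
          exact h1.trans h2
      _ = s * V + locSq R (F t) / s := by
          rw [integral_add (integrable_const s) ((integrableOn_norm_sq R (F t)).div_const s),
            integral_div, locSq]
          simp [V, mul_comm]
      _ ≤ s * V + ‖F t‖ := by
          gcongr
          rw [div_le_iff₀ hs]
          have := locSq_le_norm_sq R (F t)
          nlinarith [norm_nonneg (F t)]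

/-! ### Integration by parts in time -/

/-- Fubini's theorem on the triangle `r ≤ t`: integrating `ψ'` from `r` to `T` gives `-ψ r`. No
differentiability of the primitive of `b` is used. -/
lemma integral_inner_primitive {b : ℝ → L2} {T : ℝ}
    (hb : Integrable b (volume.restrict (Icc 0 T))) {ψ ψ' : ℝ → L2}
    (hψ : ∀ t, HasDerivAt ψ (ψ' t) t) (hc : Continuous ψ') (h0 : ψ T = 0) :
    Integrable (fun t => inner ℝ (∫ r in Icc 0 t, b r) (ψ' t)) (volume.restrict (Icc 0 T)) ∧
    ∫ t in Icc 0 T, inner ℝ (∫ r in Icc 0 t, b r) (ψ' t) = - ∫ t in Icc 0 T, inner ℝ (b t) (ψ t) := by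
  set μ := (volume : Measure ℝ).restrict (Icc 0 T) with hμ
  let G : ℝ × ℝ → ℝ := {z : ℝ × ℝ | z.2 ≤ z.1}.indicator fun z => inner ℝ (b z.2) (ψ' z.1)
  have hψ'i : Integrable ψ' μ := hc.integrableOn_Icc
  have hG : Integrable G (μ.prod μ) := by
    refine Integrable.indicator ?_ (measurableSet_le measurable_snd measurable_fst)
    refine (hψ'i.norm.mul_prod hb.norm).mono' (hb.1.comp_snd.inner hψ'i.1.comp_fst)
      (Eventually.of_forall fun z => ?_)
    rw [mul_comm]
    exact norm_inner_le_norm (𝕜 := ℝ) _ _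
  have e1 : ∀ t ∈ Icc 0 T, inner ℝ (∫ r in Icc 0 t, b r) (ψ' t) = ∫ r, G (t, r) ∂μ := by
    intro t ht
    have hs : Icc 0 t ⊆ Icc 0 T := Icc_subset_Icc_right ht.2
    have hbt : Integrable b (volume.restrict (Icc 0 t)) := hb.mono_measure
      (Measure.restrict_mono hs le_rfl)
    rw [← inner_integral_right hbt]
    have e : ∀ r, G (t, r) = (Iic t).indicator (fun r => inner ℝ (b r) (ψ' t)) r := fun r => rfl
    simp only [e]
    rw [integral_indicator measurableSet_Iic, hμ, Measure.restrict_restrict measurableSet_Iic]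
    congr 2
    ext r
    simp only [mem_Icc, mem_inter_iff, mem_Iic]
    constructor
    · exact fun h => ⟨h.2, h.1, h.2.trans ht.2⟩
    · exact fun h => ⟨h.2.1, h.1⟩
  have e2 : ∀ r ∈ Icc 0 T, ∫ t, G (t, r) ∂μ = - inner ℝ (b r) (ψ r) := by
    intro r hr
    have e : ∀ t, G (t, r) = (Ici r).indicator (fun t => inner ℝ (ψ' t) (b r)) t := fun t => by
      simp only [G, indicator, Set.mem_ofPred_eq, mem_Ici, real_inner_comm]
    simp only [e]
    rw [integral_indicator measurableSet_Ici, hμ, Measure.restrict_restrict measurableSet_Ici]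
    have e' : Ici r ∩ Icc 0 T = Icc r T := by
      ext t
      simp only [mem_Icc, mem_inter_iff, mem_Ici]
      constructor
      · exact fun h => ⟨h.1, h.2.2⟩
      · exact fun h => ⟨h.1, hr.1.trans h.1, h.2⟩
    rw [e', inner_integral_right hc.integrableOn_Icc, integral_Icc_eq_integral_Ioc,
      ← intervalIntegral.integral_of_le hr.2,
      intervalIntegral.integral_eq_sub_of_hasDerivAt (fun t _ => hψ t) (hc.intervalIntegrable _ _),
      h0, zero_sub, inner_neg_left, real_inner_comm]
  have a1 : ∀ᵐ t ∂μ, inner ℝ (∫ r in Icc 0 t, b r) (ψ' t) = ∫ r, G (t, r) ∂μ :=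
    (ae_restrict_mem measurableSet_Icc).mono e1
  have a2 : ∀ᵐ r ∂μ, ∫ t, G (t, r) ∂μ = - inner ℝ (b r) (ψ r) :=
    (ae_restrict_mem measurableSet_Icc).mono e2
  refine ⟨hG.integral_prod_left.congr (a1.mono fun t ht => ht.symm), ?_⟩
  rw [integral_congr_ae a1, integral_integral_swap (f := fun a r => G (a, r)) hG, integral_congr_ae a2, integral_neg]

/-! ### Test functions on space-time -/

/-- Smooth compactly supported functions on `ℝ × ℝ³`. -/
def IsSTTest (χ : ℝ × E3 → ℝ) : Prop := ContDiff ℝ ∞ χ ∧ HasCompactSupport χ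

/-- The field `χ(t, ·) e_k`. -/
def slice (k : Fin 3) (χ : ℝ × E3 → ℝ) (t : ℝ) : L2 := toL2 fun x => χ (t, x) • basisVec k

lemma IsSTTest.dt {χ : ℝ × E3 → ℝ} (h : IsSTTest χ) : IsSTTest (dt χ) :=
  ⟨(h.1.fderiv_right (m := ∞) (by simp)).clm_apply contDiff_const,
    h.2.fderiv_apply (𝕜 := ℝ) _⟩

lemma IsSTTest.dx {χ : ℝ × E3 → ℝ} (h : IsSTTest χ) (j : Fin 3) : IsSTTest (dx j χ) :=
  ⟨(h.1.fderiv_right (m := ∞) (by simp)).clm_apply contDiff_const,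
    h.2.fderiv_apply (𝕜 := ℝ) _⟩

lemma IsSTTest.differentiable {χ : ℝ × E3 → ℝ} (h : IsSTTest χ) : Differentiable ℝ χ :=
  h.1.differentiable (by simp)

lemma IsSTTest.slice_eq_zero {χ : ℝ × E3 → ℝ} {t : ℝ} {x : E3}
    (hx : x ∉ Prod.snd '' tsupport χ) : χ (t, x) = 0 :=
  image_eq_zero_of_notMem_tsupport fun h => hx ⟨_, h, rfl⟩

lemma IsSTTest.isCompact_snd {χ : ℝ × E3 → ℝ} (h : IsSTTest χ) :
    IsCompact (Prod.snd '' tsupport χ) := h.2.isCompact.image continuous_snd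

lemma IsSTTest.isTest {χ : ℝ × E3 → ℝ} (h : IsSTTest χ) (t : ℝ) : IsTest fun x => χ (t, x) :=
  ⟨h.1.comp (contDiff_const.prodMk contDiff_id),
    HasCompactSupport.intro h.isCompact_snd fun _ hx => IsSTTest.slice_eq_zero hx⟩

lemma IsSTTest.pd_slice {χ : ℝ × E3 → ℝ} (h : IsSTTest χ) (j : Fin 3) (t : ℝ) :
    pd j (fun x => χ (t, x)) = fun x => DampedNS.dx j χ (t, x) := by
  ext1 x
  have h1 : HasFDerivAt (fun x : E3 => (t, x)) (ContinuousLinearMap.inr ℝ ℝ E3) x :=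
    hasFDerivAt_prodMk_right t x
  have := ((h.differentiable (t, x)).hasFDerivAt.comp x h1).fderiv
  have h2 : fderiv ℝ (fun x => χ (t, x)) x
      = (fderiv ℝ χ (t, x)).comp (ContinuousLinearMap.inr ℝ ℝ E3) := this
  simp [pd, DampedNS.dx, h2]

lemma IsSTTest.hasDerivAt {χ : ℝ × E3 → ℝ} (h : IsSTTest χ) (t : ℝ) (x : E3) :
    HasDerivAt (fun s => χ (s, x)) (DampedNS.dt χ (t, x)) t := by
  have h1 : HasDerivAt (fun s : ℝ => (s, x)) ((1 : ℝ), (0 : E3)) t :=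
    (hasDerivAt_id t).prodMk (hasDerivAt_const t x)
  exact (h.differentiable (t, x)).hasFDerivAt.comp_hasDerivAt t h1

lemma IsSTTest.dx_dt_comm {χ : ℝ × E3 → ℝ} (h : IsSTTest χ) (j : Fin 3) :
    DampedNS.dx j (DampedNS.dt χ) = DampedNS.dt (DampedNS.dx j χ) := by
  ext1 z
  have hs : IsSymmSndFDerivAt ℝ χ z := h.1.contDiffAt.isSymmSndFDerivAt (by
    simp only [minSmoothness_of_isRCLikeNormedField]; norm_cast)
  have hd : DifferentiableAt ℝ (fderiv ℝ χ) z :=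
    (h.1.fderiv_right (m := 1) (by norm_cast)).differentiable (by simp) z
  have key : ∀ a b : ℝ × E3, fderiv ℝ (fun y => fderiv ℝ χ y a) z b
      = fderiv ℝ (fderiv ℝ χ) z b a := by
    intro a b
    have := (hd.hasFDerivAt.clm_apply (hasFDerivAt_const a z)).fderiv
    rw [this]; simp
  have e1 : DampedNS.dx j (DampedNS.dt χ) z
    = fderiv ℝ (fun y => fderiv ℝ χ y (1, 0)) z (0, basisVec j) := rfl
  have e2 : DampedNS.dt (DampedNS.dx j χ) z
    = fderiv ℝ (fun y => fderiv ℝ χ y (0, basisVec j)) z (1, 0) := rfl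
  rw [e1, e2, key, key]
  exact hs _ _

lemma IsSTTest.hasDerivAt_slice {χ : ℝ × E3 → ℝ} (h : IsSTTest χ) (k : Fin 3) (t : ℝ) :
    HasDerivAt (slice k χ) (slice k (DampedNS.dt χ) t) t := by
  refine hasDerivAt_toL2 (Φ := fun t x => χ (t, x) • basisVec k)
    (Ψ := fun t x => DampedNS.dt χ (t, x) • basisVec k) (fun t => ?_) ?_ (fun t x => ?_)
    h.isCompact_snd (Eventually.of_forall fun t x hx => ?_)
  · exact ((h.isTest t).smul_basisVec k).1.continuous
  · exact h.dt.1.continuous.smul continuous_const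
  · exact (h.hasDerivAt t x).smul_const _
  · rw [IsSTTest.slice_eq_zero hx, zero_smul]

lemma IsSTTest.continuous_slice {χ : ℝ × E3 → ℝ} (h : IsSTTest χ) (k : Fin 3) :
    Continuous (slice k χ) :=
  continuous_iff_continuousAt.2 fun t => (h.hasDerivAt_slice k t).continuousAt

lemma IsSTTest.inner_slice {χ : ℝ × E3 → ℝ} (h : IsSTTest χ) (k : Fin 3) (t : ℝ) (v : L2) :
    inner ℝ v (slice k χ t) = ∫ x, v x k * χ (t, x) := inner_smul_basisVec v (h.isTest t).memLp k

lemma IsSTTest.toL2_pdv_slice {χ : ℝ × E3 → ℝ} (h : IsSTTest χ) (j k : Fin 3) (t : ℝ) :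
    toL2 (pdv j fun x => χ (t, x) • basisVec k) = slice k (DampedNS.dx j χ) t := by
  rw [pdv_smul_basisVec (h.isTest t).differentiable, h.pd_slice]
  rfl

lemma slice_eq_zero {χ : ℝ × E3 → ℝ} {t : ℝ} (h : ∀ x, χ (t, x) = 0) (k : Fin 3) :
    slice k χ t = 0 := by
  have : (fun x => χ (t, x) • basisVec k) = fun _ => (0 : ℝ) • (0 : E3) := by
    ext1 x; rw [h x, zero_smul, zero_smul]
  rw [slice, this, toL2_smul 0 MemLp.zero', zero_smul]

/-! ### The pressure and the momentum equation -/

/-- The viscous part of the flux is already divergence free, so the projection acts only on the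
product. -/
lemma leray_flux (ν : ℝ) (j : Fin 3) {v : L2} (hv : v ∈ solenoidal) (h1 : MemHDotOne v) :
    leray (flux ν j v) = leray (prodF j v v) - ν • weakPartial j v := by
  rw [flux, map_sub, map_smul, leray_eq_self (weakPartial_mem_solenoidal hv h1 j)]

/-- The gradient part of the flux `v_j v`. -/
def pressureField (j : Fin 3) (v : L2) : L2 := prodF j v v - leray (prodF j v v)

/-- The pressure field is curl-free, so its pairing with `∂_jφ e_k` may be replaced by the one with
`∂_kφ e_j`. This exchange produces the pressure gradient once summed over `j`. -/
lemma inner_leray_flux_slice (ν : ℝ) (j k : Fin 3) {v : L2} (hv : v ∈ solenoidal)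
    (h1 : MemHDotOne v) {φ : ℝ × E3 → ℝ} (hφ : IsSTTest φ) (t : ℝ) :
    inner ℝ (leray (flux ν j v)) (slice k (dx j φ) t)
      = inner ℝ (prodF j v v) (slice k (dx j φ) t)
        - inner ℝ (pressureField j v) (slice j (dx k φ) t)
        + ν * inner ℝ v (slice k (dx j (dx j φ)) t) := by
  have e1 : inner ℝ (pressureField j v) (slice j (dx k φ) t)
      = inner ℝ (pressureField j v) (slice k (dx j φ) t) := by
    have := inner_pd_comm_of_mem_orthogonal (sub_leray_mem_orthogonal (prodF j v v)) (hφ.isTest t) k j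
    rwa [hφ.pd_slice, hφ.pd_slice] at this
  have e2 : inner ℝ v (slice k (dx j (dx j φ)) t)
      = - inner ℝ (weakPartial j v) (slice k (dx j φ) t) := by
    have := isWeakPartial_iff.1 (h1.isWeakPartial j) _ (((hφ.dx j).isTest t).smul_basisVec k)
    rwa [(hφ.dx j).toL2_pdv_slice] at this
  rw [e1, e2, leray_flux ν j hv h1, pressureField, inner_sub_left, inner_sub_left,
    real_inner_smul_left]
  ring

section Limit

variable {ν β : ℝ} {u₀ f : L2} {w : ℕ → solenoidalOne} {x : ℕ → ℝ → L2} {u : ℝ → L2}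

/-- The weak formulation against a test function, at a fixed time. -/
lemma IsLimit.weak_eq_slice (h : IsLimit ν β u₀ f w x u) (hν : 0 < ν) (hβ : 0 < β)
    (hw : ∀ (v : solenoidalOne) (ε : ℝ), 0 < ε →
      ∃ k, ‖(v : L2) - w k‖ < ε ∧ ∀ j, ‖wpd j v - wpd j (w k)‖ < ε)
    (hf : f ∈ solenoidal) {χ : ℝ × E3 → ℝ} (hχ : IsSTTest χ) (k : Fin 3) {t : ℝ} (ht : 0 ≤ t) :
    inner ℝ (u t) (slice k χ t) - inner ℝ u₀ (slice k χ t)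
      = ∑ j, inner ℝ (∫ r in Icc 0 t, leray (flux ν j (u r))) (slice k (dx j χ) t)
        + inner ℝ (∫ r in Icc 0 t, (f - β • u r)) (slice k χ t) := by
  have hg := (hχ.isTest t).smul_basisVec k
  have key := h.weak_eq hν hβ hw ht ⟨_, leray_testField_mem hg⟩
  have hu₀ : u₀ ∈ solenoidal := h.initial ▸ h.mem 0 le_rfl
  have hfu : Integrable (fun r => f - β • u r) (volume.restrict (Icc 0 t)) :=
    (integrable_const f).sub ((h.integrable_limit hν hβ t).smul β)
  have e1 : leray (∫ r in Icc 0 t, (f - β • u r)) = ∫ r in Icc 0 t, (f - β • u r) := by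
    rw [← leray.integral_comp_comm hfu]
    refine setIntegral_congr_fun measurableSet_Icc fun r hr => ?_
    exact leray_eq_self (solenoidal.sub_mem hf (solenoidal.smul_mem β (h.mem r hr.1)))
  -- The equation is tested against the projected slice, whose derivatives are the projected
  -- derivatives. Self-adjointness moves the projection to the fluxes, and it disappears on the
  -- fields that are already divergence free.
  simp only [weakPartial_eq (hg.isWeakPartial_leray _), hχ.toL2_pdv_slice] at key
  rw [inner_leray_of_mem (h.mem t ht), inner_leray_of_mem hu₀, ← inner_leray_left _ (toL2 _), e1]
    at key
  simp only [← inner_leray_left (∫ r in Icc 0 t, flux ν _ (u r))] at key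
  simp only [leray.integral_comp_comm (h.integrable_flux hν hβ t _)]
  exact key

/-- The weak formulation against a test function on space-time. -/
lemma IsLimit.integral_slice_eq_zero (h : IsLimit ν β u₀ f w x u) (hν : 0 < ν) (hβ : 0 < β)
    (hw : ∀ (v : solenoidalOne) (ε : ℝ), 0 < ε →
      ∃ k, ‖(v : L2) - w k‖ < ε ∧ ∀ j, ‖wpd j v - wpd j (w k)‖ < ε)
    (hf : f ∈ solenoidal) {φ : ℝ × E3 → ℝ} (hφ : IsSTTest φ) (k : Fin 3) {T : ℝ} (hT : 0 ≤ T)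
    (h0 : ∀ x, φ (0, x) = 0) (hφT : ∀ x, φ (T, x) = 0) (hφT' : ∀ j x, dx j φ (T, x) = 0) :
    ∫ t in Icc 0 T, (inner ℝ (u t) (slice k (dt φ) t) + inner ℝ (f - β • u t) (slice k φ t)
      + ∑ j, inner ℝ (leray (flux ν j (u t))) (slice k (dx j φ) t)) = 0 := by
  set μ := (volume : Measure ℝ).restrict (Icc 0 T) with hμ
  have hfu : Integrable (fun r => f - β • u r) μ :=
    (integrable_const f).sub ((h.integrable_limit hν hβ T).smul β)
  have hfl : ∀ j, Integrable (fun r => leray (flux ν j (u r))) μ := fun j =>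
    leray.integrable_comp (h.integrable_flux hν hβ T j)
  have hbd : ∀ {F : ℝ → L2} {ψ : ℝ → L2}, Integrable F μ → Continuous ψ →
      Integrable (fun t => inner ℝ (F t) (ψ t)) μ := by
    intro F ψ hF hψ
    obtain ⟨C, hC⟩ := isCompact_Icc.exists_bound_of_continuousOn (s := Icc 0 T) hψ.continuousOn
    refine (hF.norm.mul_const C).mono' (hF.1.inner hψ.aestronglyMeasurable) ?_
    filter_upwards [ae_restrict_mem measurableSet_Icc] with t ht
    exact (norm_inner_le_norm (𝕜 := ℝ) _ _).trans (by gcongr; exact hC t ht)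
  obtain ⟨i1, p1⟩ := integral_inner_primitive hfu (fun t => hφ.hasDerivAt_slice k t)
    (hφ.dt.continuous_slice k) (slice_eq_zero hφT k)
  have hp := fun j => integral_inner_primitive (hfl j) (fun t => (hφ.dx j).hasDerivAt_slice k t)
    ((hφ.dx j).dt.continuous_slice k) (slice_eq_zero (hφT' j) k)
  have iu : Integrable (fun t => inner ℝ (u t) (slice k (dt φ) t)) μ :=
    hbd (h.integrable_limit hν hβ T) (hφ.dt.continuous_slice k)
  -- The initial value contributes nothing because `φ` vanishes at both ends of the time interval.
  have e0 : ∫ t in Icc 0 T, inner ℝ u₀ (slice k (dt φ) t) = 0 := by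
    rw [integral_inner (hφ.dt.continuous_slice k).integrableOn_Icc, integral_Icc_eq_integral_Ioc,
      ← intervalIntegral.integral_of_le hT,
      intervalIntegral.integral_eq_sub_of_hasDerivAt (fun t _ => hφ.hasDerivAt_slice k t)
        ((hφ.dt.continuous_slice k).intervalIntegrable _ _),
      slice_eq_zero hφT, slice_eq_zero h0, sub_zero, inner_zero_right]
  have e1 : ∫ t in Icc 0 T, inner ℝ (u t) (slice k (dt φ) t)
      = ∑ j, (∫ t in Icc 0 T,
          inner ℝ (∫ r in Icc 0 t, leray (flux ν j (u r))) (slice k (dt (dx j φ)) t))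
        + ∫ t in Icc 0 T, inner ℝ (∫ r in Icc 0 t, (f - β • u r)) (slice k (dt φ) t) := by
    have e2 : ∫ t in Icc 0 T, inner ℝ (u t) (slice k (dt φ) t)
        = ∫ t in Icc 0 T, (inner ℝ (u t) (slice k (dt φ) t) - inner ℝ u₀ (slice k (dt φ) t)) := by
      rw [integral_sub iu (hbd (integrable_const u₀) (hφ.dt.continuous_slice k)), e0, sub_zero]
    rw [← integral_finsetSum _ fun j _ => (hp j).1,
      ← integral_add (integrable_finsetSum _ fun j _ => (hp j).1) i1, e2]
    refine setIntegral_congr_fun measurableSet_Icc fun t ht => ?_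
    -- The fixed-time identity is applied, at each `t`, to the slice of `∂_t φ`; integrating in `t`
    -- and using the primitives then recovers the weak equation without differentiating `u` in time.
    have := h.weak_eq_slice hν hβ hw hf hφ.dt k ht.1
    simp only [hφ.dx_dt_comm] at this
    exact this
  have i2 : Integrable (fun t => inner ℝ (f - β • u t) (slice k φ t)) μ :=
    hbd hfu (hφ.continuous_slice k)
  have i3 : ∀ j, Integrable (fun t => inner ℝ (leray (flux ν j (u t))) (slice k (dx j φ) t)) μ :=
    fun j => hbd (hfl j) ((hφ.dx j).continuous_slice k)
  have i12 : Integrable (fun t => inner ℝ (u t) (slice k (dt φ) t)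
    + inner ℝ (f - β • u t) (slice k φ t)) μ := iu.add i2
  rw [integral_add i12 (integrable_finsetSum _ fun j _ => i3 j), integral_add iu i2,
    integral_finsetSum _ fun j _ => i3 j, e1, p1]
  simp only [(hp _).2, Finset.sum_neg_distrib]
  ring

lemma IsLimit.integrable_pressureField (h : IsLimit ν β u₀ f w x u) (hν : 0 < ν) (hβ : 0 < β)
    (T : ℝ) (j : Fin 3) :
    Integrable (fun t => pressureField j (u t)) (volume.restrict (Icc 0 T)) :=
  (h.integrable_prodF hν hβ T j).sub (leray.integrable_comp (h.integrable_prodF hν hβ T j))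

lemma iUnion_Icc_natCast : ⋃ n : ℕ, Icc (0 : ℝ) (n : ℝ) = Ici 0 := by
  ext t
  simp only [mem_iUnion, mem_Icc, mem_Ici]
  constructor
  · rintro ⟨n, hn⟩; exact hn.1
  · intro ht; exact ⟨⌈t⌉₊, ht, Nat.le_ceil t⟩

/-- The pressure as a function on space-time. -/
lemma IsLimit.exists_pressure (h : IsLimit ν β u₀ f w x u) (hν : 0 < ν) (hβ : 0 < β) :
    ∃ p : ℝ × E3 → ℝ, LocallyIntegrableOn p (Ioi (0 : ℝ) ×ˢ (univ : Set E3)) ∧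
      ∀ T : ℝ, ∀ᵐ t ∂volume.restrict (Icc 0 T), ∀ᵐ x,
        p (t, x) = - ∑ j, pressureField j (u t) x j := by
  -- Measurability on the whole half-line provides one pressure valid for every `T`.
  have hm : ∀ j, AEStronglyMeasurable (fun t => pressureField j (u t))
      (volume.restrict (Ici (0 : ℝ))) := by
    intro j
    rw [← iUnion_Icc_natCast, aestronglyMeasurable_iUnion_iff]
    exact fun n => (h.integrable_pressureField hν hβ n j).1
  choose p hp1 hp2 using fun j => exists_joint_representative (hm j).stronglyMeasurable_mk j
  have hae : ∀ (T : ℝ) (j : Fin 3), ∀ᵐ t ∂volume.restrict (Icc 0 T), ∀ᵐ x,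
      p j (t, x) = pressureField j (u t) x j := by
    intro T j
    filter_upwards [ae_restrict_of_ae_restrict_of_subset Icc_subset_Ici_self (hm j).ae_eq_mk]
      with t ht
    have := hp2 j t
    rwa [← ht] at this
  refine ⟨fun z => - ∑ j, p j z, ?_, fun T => ?_⟩
  · have hint : ∀ (T R : ℝ), IntegrableOn (fun z => - ∑ j, p j z)
        (Icc 0 T ×ˢ Metric.ball (0 : E3) R) := fun T R =>
      (integrable_finsetSum _ fun j _ => integrableOn_joint (hp1 j)
        (h.integrable_pressureField hν hβ T j) (hae T j) R).neg
    rintro ⟨t, y⟩ ⟨ht, -⟩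
    -- Since `t > 0`, this product is a neighbourhood of the point even though its time interval
    -- starts at `0`.
    refine ⟨Icc 0 (t + 1) ×ˢ Metric.ball (0 : E3) (‖y‖ + 1), ?_, hint _ _⟩
    refine mem_nhdsWithin_of_mem_nhds (prod_mem_nhds (Icc_mem_nhds ht (by linarith)) ?_)
    exact Metric.isOpen_ball.mem_nhds (by simp)
  · filter_upwards [ae_all_iff.2 (hae T)] with t ht
    filter_upwards [ae_all_iff.2 ht] with x hx
    simp only [hx]

/-- The spatial integral in the momentum equation, written with pairings. -/
lemma momentum_slice (ν β : ℝ) (f : L2) {v : L2} (hv : v ∈ solenoidal) (h1 : MemHDotOne v)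
    {φ : ℝ × E3 → ℝ} (hφ : IsSTTest φ) (k : Fin 3) (t : ℝ) {q : E3 → ℝ}
    (hq : ∀ᵐ x, q x = - ∑ j, pressureField j v x j) :
    ∫ x, (v x k * dt φ (t, x) + ν * (v x k * lap φ (t, x))
        + ∑ j, v x k * v x j * dx j φ (t, x) + q x * dx k φ (t, x)
        + f x k * φ (t, x) - β * (v x k * φ (t, x)))
      = inner ℝ v (slice k (dt φ) t) + inner ℝ (f - β • v) (slice k φ t)
        + ∑ j, inner ℝ (leray (flux ν j v)) (slice k (dx j φ) t) := by
  have hi : ∀ (a : L2) (i : Fin 3) {χ : ℝ × E3 → ℝ}, IsSTTest χ →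
      Integrable (fun x => a x i * χ (t, x)) volume := fun a i χ hχ =>
    integrable_mul_of_memLp_two (memLp_coeFn_apply a i) (hχ.isTest t).memLp
  have hprod : ∀ᵐ x, ∀ j, prodF j v v x = v x j • v x :=
    ae_all_iff.2 fun j => coeFn_prodF j h1.memLp_four h1.memLp_four
  -- Almost everywhere the Laplacian, the convection term and the pressure are regrouped as one sum
  -- over `j`, matching the decomposition of the projected fluxes.
  have e : ∫ x, (v x k * dt φ (t, x) + ν * (v x k * lap φ (t, x))
        + ∑ j, v x k * v x j * dx j φ (t, x) + q x * dx k φ (t, x)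
        + f x k * φ (t, x) - β * (v x k * φ (t, x)))
      = ∫ x, (v x k * dt φ (t, x) + (f x k * φ (t, x) - β * (v x k * φ (t, x)))
        + ∑ j, (prodF j v v x k * dx j φ (t, x) - pressureField j v x j * dx k φ (t, x)
          + ν * (v x k * dx j (dx j φ) (t, x)))) := by
    refine integral_congr_ae ?_
    filter_upwards [hprod, hq] with x hx hqx
    simp only [hx, hqx, lap, Fin.sum_univ_three, PiLp.smul_apply, smul_eq_mul]
    ring
  have j1 : ∀ j, Integrable (fun x => prodF j v v x k * dx j φ (t, x)
      - pressureField j v x j * dx k φ (t, x)) volume := fun j =>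
    (hi _ k (hφ.dx j)).sub (hi _ j (hφ.dx k))
  have j2 : ∀ j, Integrable (fun x => ν * (v x k * dx j (dx j φ) (t, x))) volume := fun j =>
    (hi v k ((hφ.dx j).dx j)).const_mul ν
  have j3 : ∀ j, Integrable (fun x => prodF j v v x k * dx j φ (t, x)
      - pressureField j v x j * dx k φ (t, x) + ν * (v x k * dx j (dx j φ) (t, x))) volume :=
    fun j => (j1 j).add (j2 j)
  have j4 : Integrable (fun x => f x k * φ (t, x) - β * (v x k * φ (t, x))) volume :=
    (hi f k hφ).sub ((hi v k hφ).const_mul β)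
  have j5 : Integrable (fun x => v x k * dt φ (t, x)
      + (f x k * φ (t, x) - β * (v x k * φ (t, x)))) volume := (hi v k hφ.dt).add j4
  rw [e, integral_add j5 (integrable_finsetSum _ fun j _ => j3 j), integral_add (hi v k hφ.dt) j4,
    integral_sub (hi f k hφ) ((hi v k hφ).const_mul β), integral_const_mul,
    integral_finsetSum _ fun j _ => j3 j]
  simp only [← hφ.inner_slice, ← hφ.dt.inner_slice]
  rw [inner_sub_left, real_inner_smul_left]
  congr 1
  refine Finset.sum_congr rfl fun j _ => ?_
  rw [integral_add (j1 j) (j2 j), integral_sub (hi _ k (hφ.dx j)) (hi _ j (hφ.dx k)),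
    integral_const_mul, ← (hφ.dx j).inner_slice, ← (hφ.dx k).inner_slice,
    ← ((hφ.dx j).dx j).inner_slice, inner_leray_flux_slice ν j k hv h1 hφ]

lemma exists_time_bound {φ : ℝ × E3 → ℝ} (hφ : IsSTTest φ) :
    ∃ T : ℝ, 0 ≤ T ∧ ∀ z ∈ tsupport φ, z.1 < T := by
  obtain ⟨R, hR⟩ := hφ.2.isBounded.subset_ball (0 : ℝ × E3)
  refine ⟨max R 0, le_max_right _ _, fun z hz => lt_max_of_lt_left ?_⟩
  have h1 := hR hz
  rw [mem_ball_zero_iff] at h1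
  exact (le_abs_self _).trans_lt ((norm_fst_le z).trans_lt h1)

theorem IsLimit.momentumEq (h : IsLimit ν β u₀ f w x u) (hν : 0 < ν) (hβ : 0 < β)
    (hw : ∀ (v : solenoidalOne) (ε : ℝ), 0 < ε →
      ∃ k, ‖(v : L2) - w k‖ < ε ∧ ∀ j, ‖wpd j v - wpd j (w k)‖ < ε)
    (hf : f ∈ solenoidal) {p : ℝ × E3 → ℝ}
    (hp : ∀ T : ℝ, ∀ᵐ t ∂volume.restrict (Icc 0 T), ∀ᵐ x,
        p (t, x) = - ∑ j, pressureField j (u t) x j) : MomentumEq ν β f u p := by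
  intro φ hφ i
  have hφ' : IsSTTest φ := ⟨hφ.1, hφ.2.1⟩
  obtain ⟨T, hT0, hT⟩ := exists_time_bound hφ'
  have hz : ∀ z, z ∉ tsupport φ → φ z = 0 ∧ dt φ z = 0 ∧ (∀ j, dx j φ z = 0) ∧ lap φ z = 0 := by
    intro z hz
    have d1 : ∀ {χ : ℝ × E3 → ℝ} (v : ℝ × E3), z ∉ tsupport χ → fderiv ℝ χ z v = 0 := by
      intro χ v hχ
      rw [fderiv_of_notMem_tsupport ℝ hχ]; rfl
    refine ⟨image_eq_zero_of_notMem_tsupport hz, d1 _ hz, fun j => d1 _ hz, ?_⟩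
    refine Finset.sum_eq_zero fun j _ => d1 _ fun hz' => hz ?_
    exact tsupport_fderiv_apply_subset ℝ _ hz'
  have h0 : ∀ x, (0, x) ∉ tsupport φ := fun x hx => lt_irrefl (0 : ℝ) (hφ.2.2 hx).1
  have hTs : ∀ t, T ≤ t → ∀ x, (t, x) ∉ tsupport φ := fun t ht x hx =>
    absurd (hT _ hx) (not_lt.2 ht)
  have hmain := h.integral_slice_eq_zero hν hβ hw hf hφ' i hT0 (fun x => (hz _ (h0 x)).1)
    (fun x => (hz _ (hTs T le_rfl x)).1) (fun j x => (hz _ (hTs T le_rfl x)).2.2.1 j)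
  -- Beyond `T` the test function and all its derivatives vanish, so the integral over the half-line
  -- reduces to `[0, T]`.
  rw [setIntegral_eq_of_subset_of_forall_sdiff_eq_zero measurableSet_Ioi
    (Ioc_subset_Ioi_self : Ioc 0 T ⊆ Ioi 0), ← integral_Icc_eq_integral_Ioc]
  · refine Eq.trans (integral_congr_ae ?_) hmain
    filter_upwards [h.ae_memHDotOne hν hβ T, hp T, ae_restrict_mem measurableSet_Icc]
      with t h1 h2 h3
    exact momentum_slice ν β f (h.mem t h3.1) h1 hφ' i t h2
  · intro t ht
    have htT : T ≤ t := by
      by_contra hlt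
      exact ht.2 ⟨ht.1, (not_le.1 hlt).le⟩
    have : ∀ y, _ := fun y => hz _ (hTs t htT y)
    simp [(this _).1, (this _).2.1, (this _).2.2.1, (this _).2.2.2]

end Limit

theorem IsLimit.isWeakSolution {ν β : ℝ} {u₀ f : L2} {w : ℕ → solenoidalOne} {x : ℕ → ℝ → L2}
    {u : ℝ → L2} (h : IsLimit ν β u₀ f w x u) (hν : 0 < ν) (hβ : 0 < β)
    (hw : ∀ (v : solenoidalOne) (ε : ℝ), 0 < ε →
      ∃ k, ‖(v : L2) - w k‖ < ε ∧ ∀ j, ‖wpd j v - wpd j (w k)‖ < ε)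
    (hf : f ∈ solenoidal) : IsWeakSolution ν β u₀ f u := by
  obtain ⟨p, hp1, hp2⟩ := h.exists_pressure hν hβ
  exact ⟨fun t ht => mem_solenoidal.1 (h.mem t ht), ⟨p, hp1, h.momentumEq hν hβ hw hf hp2⟩,
    h.weakCont, h.initial⟩

end DampedNS

end

theorem theorem2p1 (ν β : ℝ) (hν : 0 < ν) (hβ : 0 < β)
    (u₀ f : DampedNS.L2) (hu₀ : DampedNS.IsDivFree u₀)
    (hf : DampedNS.IsDivFree f) (hf' : DampedNS.MemHDotNegOne f) :
    ∃ u : ℝ → DampedNS.L2,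
      DampedNS.MemLinftyLocL2 u ∧ DampedNS.MemL2LocHDotOne u ∧
      DampedNS.IsWeakSolution ν β u₀ f u ∧
      ∀ t : ℝ, 0 ≤ t →
        ‖u t‖ ^ 2 ≤ ‖u₀‖ ^ 2 - 2 * ν * (∫ s in (0 : ℝ)..t, DampedNS.hDotOneSq (u s))
          + 2 * (∫ s in (0 : ℝ)..t, inner ℝ f (u s))
          - 2 * β * (∫ s in (0 : ℝ)..t, ‖u s‖ ^ 2) := by
  obtain ⟨w, hw⟩ := DampedNS.exists_dense_seq_solenoidalOne
  obtain ⟨x, u, hx, hu, hum, huc, hu0⟩ := DampedNS.exists_isApprox_limit hν hβ u₀ f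
    (DampedNS.mem_solenoidal.2 hu₀) fun v ε hε => (hw v ε hε).imp fun _ h => h.1
  have h : DampedNS.IsLimit ν β u₀ f w x u := ⟨hx, hu, hum, huc, hu0⟩
  exact ⟨u, h.memLinftyLocL2 hν hβ, h.memL2LocHDotOne hν hβ,
    h.isWeakSolution hν hβ hw (DampedNS.mem_solenoidal.2 hf),
    fun t ht => h.energy_inequality hν hβ ht⟩
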